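/- **Setting.** Let $\Omega\subset\mathbb C$ be a nonempty connected open set, $K$ the field of meromorphic functions of $x$ on $\Omega$, and $'=d/dx$. Let $\kappa_0,\kappa_1,\kappa_t,\kappa_\infty\in\mathbb C$, $\kappa=\frac14(\kappa_0+\kappa_1+\kappa_t-1)^2-\frac14\kappa_\infty^2$ and $$\alpha=\tfrac12(\kappa_t+\kappa_0+\kappa_1-1)^2-2\kappa,\quad \beta=-\tfrac12\kappa_0^2,\quad \gamma=\tfrac12\kappa_1^2,\quad \delta=\tfrac12(1-\kappa_t^2).$$ A function $q\in K$ is called admissible if it is none of the functions $0,1,x$. The sixth Painlevé equation is $$(\mathrm P_{\mathrm{VI}})\quad q''=\tfrac12\Big(\tfrac1q+\tfrac1{q-1}+\tfrac1{q-x}\Big)q'^2-\Big(\tfrac1x+\tfrac1{x-1}+\tfrac1{q-x}\Big)q'+\frac{q(q-1)(q-x)}{x^2(x-1)^2}\Big(\alpha+\frac{\beta x}{q^2}+\frac{\gamma(x-1)}{(q-1)^2}+\frac{\delta x(x-1)}{(q-x)^2}\Big);$$ a $\mathrm P_{\mathrm{VI}}$ transcendent is an admissible solution $q\in K$. Okamoto's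 Hamiltonian is $$H=\tfrac{1}{x(x-1)}\Big(y_6(y_6-1)(y_6-x)z_6^2-z_6\big(\kappa_0(y_6-1)(y_6-x)+\kappa_1y_6(y_6-x)+(\kappa_t-1)y_6(y_6-1)\big)+\kappa(y_6-x)\Big),$$ with system $y_6'=F:=\partial H/\partial z_6$, $z_6'=G:=-\partial H/\partial y_6$. Solving the first equation for $z_6$ gives $z_6=h(y_6,y_6';x)$ with $$h(q,q';x)=\frac{x(x-1)q'+\kappa_0(q-1)(q-x)+\kappa_1q(q-x)+(\kappa_t-1)q(q-1)}{2q(q-1)(q-x)}.$$ For admissible $q$ the blow-up-like change of variables $y_6=z+q$, $z_6=yz+h(q,q';x)$ turns the Okamoto system into the system $S_q$: $$z'=F(z+q,yz+h)-q',\qquad y'=\frac{G(z+q,yz+h)-G(q,h)-y\,z'}{z},$$ where $h'$ has been replaced by $G(q,h)$, its value when $(q,h)$ moves along the orbit; so the coefficients of $S_q$ involve only $x,q,q'$, and $S_q$ makes sense for every admissible $q$. **Regularisation.** A system over $K$ in the variables $y,z$ is considered in the charts $(y,z)$, $(1/y,z/y)$, $(y/z,1/z)$ of $\mathbb P^2$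 (points have coordinates in an algebraic closure of $K$). A base point is a point of a chart at which the right-hand side becomes $0/0$: written in lowest terms, at least one component is $0/0$ and none is $c/0$ with $c\ne0$. A point $(a,b)$ of a chart $(u,v)$ is blown up by passing to the two charts $\big(u-a,\frac{v-b}{u-a}\big)$ and $\big(\frac{u-a}{v-b},v-b\big)$. The system is *regularised* if all base points in $\mathbb P^2$, and all base points that successively appear in either chart on the exceptional curves of their blow-ups, have coordinates in $K$; the cascades of blow-ups at all of them end after finitely many steps; and each time no base point is left on an exceptional curve, the system is regular along that whole curve in one of the two charts. Let $$A(q)=\frac{x^2(x-1)^2}{q(q-1)(q-x)}\Big(q''-\tfrac12\big(\tfrac1q+\tfrac1{q-1}+\tfrac1{q-x}\big)q'^2+\big(\tfrac1x+\tfrac1{x-1}+\tfrac1{q-x}\big)q'\Big)-\frac{\beta x}{q^2}-\frac{\gamma(x-1)}{(q-1)^2}-\frac{\delta x(x-1)}{(q-x)^2}.$$ **Proposition.** (1) For every admissible $q\in K$: one has $F(q,h(q,q';x))=q'$; the right-hand sides of $S_q$ are polynomials in $y,z$ with coefficients in $\mathbb C(x,q,q')$; the base points of $S_q$ in $\mathbb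 P^2$ are exactly the origins of the charts $(1/y,z/y)$ and $(y/z,1/z)$; and $S_q$ is regularised if and only if $q$ satisfies the third-order equation $\frac{d}{dx}A(q)=0$ (the regularising condition). (2) If $q$ is a $\mathrm P_{\mathrm{VI}}$ transcendent, then moreover $G(q,h)=\frac{d}{dx}h(q,q';x)$, so that $(q,h(q,q';x))$ moves along the orbit; the change of variables is birational over $K$ and transforms the Okamoto system exactly into $S_q$; the regularising condition $\frac{d}{dx}A(q)=0$ holds; and $S_q$ is Bureau–Guillot for $(\mathrm P_{\mathrm{VI}})$, that is: (i) it is birationally equivalent to the Okamoto Hamiltonian system, whose coefficients are rational in $x$; (ii) it is a rational system whose coefficients are meromorphic in $x$ and are rational functions of $x$, $q$ and the derivatives of $q$; (iii) it is regularised, and $(\mathrm P_{\mathrm{VI}})$ is the regularising condition: for every admissible $p\in K$, the system $S_p$ is regularised if and only if $p$ solves $(\mathrm P_{\mathrm{VI}})$ with the given $\beta,\gamma,\delta$ and some constant $\alpha\in\mathbb C$. -/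

import Mathlib

noncomputable section

open Filter

/-- A domain of the complex plane: a nonempty connected open set. -/
structure PlaneDomain where
  carrier : Set ℂ
  isOpen : IsOpen carrier
  isConnected : IsConnected carrier

/-- The functions meromorphic on `Ω`, two of them being identified when they agree off a closed
discrete subset of `Ω`, as a ring of germs along the filter of codiscrete subsets of `Ω`. -/
def meroSubring (Ω : PlaneDomain) : Subring (Germ (codiscreteWithin Ω.carrier) ℂ) where
  carrier := {g | ∃ f : ℂ → ℂ, MeromorphicOn f Ω.carrier ∧ g = (f : Germ _ ℂ)}
  mul_mem' := by
    rintro _ _ ⟨f, hf, rfl⟩ ⟨g, hg, rfl⟩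
    exact ⟨f * g, hf.mul hg, rfl⟩
  one_mem' := ⟨fun _ => 1, MeromorphicOn.const 1, rfl⟩
  add_mem' := by
    rintro _ _ ⟨f, hf, rfl⟩ ⟨g, hg, rfl⟩
    exact ⟨f + g, hf.add hg, rfl⟩
  zero_mem' := ⟨fun _ => 0, MeromorphicOn.const 0, rfl⟩
  neg_mem' := by
    rintro _ ⟨f, hf, rfl⟩
    exact ⟨-f, hf.neg, rfl⟩

/-- The field of meromorphic functions on the domain `Ω`. -/
def Mero (Ω : PlaneDomain) : Type := meroSubring Ω

namespace Mero

variable {Ω : PlaneDomain}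

instance : CommRing (Mero Ω) := inferInstanceAs (CommRing (meroSubring Ω))

/-- The element of `Mero Ω` given by a meromorphic function. -/
def mk (f : ℂ → ℂ) (hf : MeromorphicOn f Ω.carrier) : Mero Ω := ⟨(f : Germ _ ℂ), f, hf, rfl⟩

theorem mk_eq_mk {f g : ℂ → ℂ} {hf : MeromorphicOn f Ω.carrier}
    {hg : MeromorphicOn g Ω.carrier} :
    mk f hf = mk g hg ↔ f =ᶠ[codiscreteWithin Ω.carrier] g :=
  Subtype.ext_iff.trans Germ.coe_eq

theorem exists_rep (a : Mero Ω) : ∃ f, ∃ hf : MeromorphicOn f Ω.carrier, a = mk f hf := by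
  obtain ⟨_, f, hf, rfl⟩ := a
  exact ⟨f, hf, rfl⟩

theorem neBot (Ω : PlaneDomain) : (codiscreteWithin Ω.carrier).NeBot := by
  rw [neBot_iff, Ne, codiscreteWithin_eq_bot_iff]
  intro h
  obtain ⟨x, hx⟩ := Ω.isConnected.nonempty
  rw [isDiscrete_iff_nhdsNE] at h
  have h1 := h x hx
  have h2 : nhdsWithin x {x}ᶜ ⊓ 𝓟 Ω.carrier = nhdsWithin x {x}ᶜ :=
    inf_eq_left.2 (le_principal_iff.2
      (mem_nhdsWithin_of_mem_nhds (Ω.isOpen.mem_nhds hx)))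
  rw [h2] at h1
  exact (inferInstance : (nhdsWithin x {x}ᶜ).NeBot).ne h1

instance : Nontrivial (Mero Ω) := by
  have := neBot Ω
  refine ⟨⟨0, 1, fun h => ?_⟩⟩
  have h1 : ((fun _ => (0 : ℂ)) : ℂ → ℂ) =ᶠ[codiscreteWithin Ω.carrier] fun _ => 1 :=
    Germ.coe_eq.1 (congrArg Subtype.val h)
  obtain ⟨x, hx⟩ := h1.exists
  exact zero_ne_one hx

theorem mk_eq_zero {f : ℂ → ℂ} {hf : MeromorphicOn f Ω.carrier} :
    mk f hf = 0 ↔ f =ᶠ[codiscreteWithin Ω.carrier] 0 :=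
  mk_eq_mk (hg := MeromorphicOn.const 0)

/-- A nonzero meromorphic function on a domain vanishes only on a discrete set. -/
theorem eventually_ne_zero {f : ℂ → ℂ} {hf : MeromorphicOn f Ω.carrier} (h : mk f hf ≠ 0) :
    ∀ᶠ x in codiscreteWithin Ω.carrier, f x ≠ 0 := by
  apply hf.eventually_codiscreteWithin_apply_ne_zero
  rw [← hf.exists_meromorphicOrderAt_ne_top_iff_forall_mem Ω.isConnected]
  by_contra! hc
  apply h
  rw [mk_eq_zero, EventuallyEq, Filter.Eventually, mem_codiscreteWithin_iff_forall_mem_nhdsNE]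
  intro x hx
  filter_upwards [meromorphicOrderAt_eq_top_iff.1 (hc x hx)] with y hy
  exact Or.inl hy

/-- Pointwise inversion. -/
def inv (a : Mero Ω) : Mero Ω :=
  ⟨(a.1)⁻¹, by
    obtain ⟨_, f, hf, rfl⟩ := a
    exact ⟨f⁻¹, hf.inv, rfl⟩⟩

instance : Field (Mero Ω) where
  inv := inv
  mul_inv_cancel := by
    intro a ha
    obtain ⟨f, hf, rfl⟩ := exists_rep a
    refine Subtype.ext (Germ.coe_eq.2 ?_)
    filter_upwards [eventually_ne_zero ha] with x hx
    exact mul_inv_cancel₀ hx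
  inv_zero := by
    refine Subtype.ext (Germ.coe_eq.2 ?_)
    exact Eventually.of_forall fun x => inv_zero
  nnqsmul := _
  nnqsmul_def := fun _ _ => rfl
  qsmul := _
  qsmul_def := fun _ _ => rfl

/-- Complex numbers as constant functions. -/
instance : Algebra ℂ (Mero Ω) :=
  RingHom.toAlgebra
    { toFun := fun c => mk (fun _ => c) (MeromorphicOn.const c)
      map_one' := rfl
      map_mul' := fun _ _ => rfl
      map_zero' := rfl
      map_add' := fun _ _ => rfl }

/-- The independent variable `x`. -/
def coord (Ω : PlaneDomain) : Mero Ω := mk id MeromorphicOn.id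

/-- Differentiation with respect to the independent variable, as a function. -/
def derivFun (a : Mero Ω) : Mero Ω :=
  mk (deriv (exists_rep a).choose) (exists_rep a).choose_spec.choose.deriv

theorem derivFun_mk (f : ℂ → ℂ) (hf : MeromorphicOn f Ω.carrier) :
    derivFun (mk f hf) = mk (deriv f) hf.deriv :=
  mk_eq_mk.2 (MeromorphicOn.deriv_eventuallyEq_codiscreteWithin
    (exists_rep (mk f hf)).choose_spec.choose hf
    (mk_eq_mk.1 (exists_rep (mk f hf)).choose_spec.choose_spec.symm))

/-- Differentiation `d/dx` of meromorphic functions on `Ω`. -/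
def ddx (Ω : PlaneDomain) : Derivation ℂ (Mero Ω) (Mero Ω) where
  toFun := derivFun
  map_add' := by
    intro a b
    obtain ⟨f, hf, rfl⟩ := exists_rep a
    obtain ⟨g, hg, rfl⟩ := exists_rep b
    have h : mk f hf + mk g hg = mk (f + g) (hf.add hg) := rfl
    rw [h, derivFun_mk, derivFun_mk, derivFun_mk]
    refine Subtype.ext (Germ.coe_eq.2 ?_)
    filter_upwards [MeromorphicOn.eventually_codiscreteWithin_analyticAt f hf,
      MeromorphicOn.eventually_codiscreteWithin_analyticAt g hg] with x hx hy
    exact deriv_add hx.differentiableAt hy.differentiableAt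
  map_smul' := by
    intro c a
    obtain ⟨f, hf, rfl⟩ := exists_rep a
    have h : c • mk f hf = mk ((fun _ => c) * f) ((MeromorphicOn.const c).mul hf) := rfl
    rw [h, derivFun_mk, derivFun_mk, RingHom.id_apply]
    refine Subtype.ext (Germ.coe_eq.2 ?_)
    filter_upwards [MeromorphicOn.eventually_codiscreteWithin_analyticAt f hf] with x hx
    exact deriv_const_mul c hx.differentiableAt
  map_one_eq_zero' := by
    have h : (1 : Mero Ω) = mk (fun _ => 1) (MeromorphicOn.const 1) := rfl
    change derivFun 1 = 0
    rw [h, derivFun_mk, mk_eq_zero]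
    exact Eventually.of_forall fun x => by simp
  leibniz' := by
    intro a b
    obtain ⟨f, hf, rfl⟩ := exists_rep a
    obtain ⟨g, hg, rfl⟩ := exists_rep b
    have h : mk f hf * mk g hg = mk (f * g) (hf.mul hg) := rfl
    change derivFun _ = mk f hf * derivFun (mk g hg) + mk g hg * derivFun (mk f hf)
    rw [h, derivFun_mk, derivFun_mk, derivFun_mk]
    refine Subtype.ext (Germ.coe_eq.2 ?_)
    filter_upwards [MeromorphicOn.eventually_codiscreteWithin_analyticAt f hf,
      MeromorphicOn.eventually_codiscreteWithin_analyticAt g hg] with x hx hy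
    change deriv (f * g) x = f x * deriv g x + g x * deriv f x
    rw [deriv_mul hx.differentiableAt hy.differentiableAt]
    ring

theorem ddx_mk (f : ℂ → ℂ) (hf : MeromorphicOn f Ω.carrier) :
    ddx Ω (mk f hf) = mk (deriv f) hf.deriv := derivFun_mk f hf

end Mero
open MvPolynomial
open scoped DualNumber

section Systems

variable {K : Type} [Field K]

/-- The field `K(y, z)` of rational functions in two dependent variables over `K`. -/
abbrev RatFun (K : Type) [Field K] : Type := FractionRing (MvPolynomial (Fin 2) K)

namespace RatFun

/-- The first dependent variable. -/
def y (K : Type) [Field K] : RatFun K := algebraMap (MvPolynomial (Fin 2) K) (RatFun K) (X 0)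

/-- The second dependent variable. -/
def z (K : Type) [Field K] : RatFun K := algebraMap (MvPolynomial (Fin 2) K) (RatFun K) (X 1)

variable [Algebra ℂ K]

/-- The ring homomorphism `A ↦ A + ε · dA/dx` on polynomials, where `y' = P` and `z' = Q`. -/
def taylorPoly (δ : Derivation ℂ K K) (P Q : RatFun K) :
    MvPolynomial (Fin 2) K →+* (RatFun K)[ε] :=
  eval₂Hom
    { toFun := fun k => TrivSqZeroExt.inl (algebraMap K (RatFun K) k) +
        TrivSqZeroExt.inr (algebraMap K (RatFun K) (δ k))
      map_one' := by ext <;> simp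
      map_mul' := by
        intro a b
        ext
        · simp only [TrivSqZeroExt.fst_add, TrivSqZeroExt.fst_mul, TrivSqZeroExt.fst_inl,
            TrivSqZeroExt.fst_inr, map_mul, add_zero]
        · simp only [TrivSqZeroExt.snd_add, DualNumber.snd_mul, TrivSqZeroExt.fst_add,
            TrivSqZeroExt.fst_inl, TrivSqZeroExt.fst_inr, TrivSqZeroExt.snd_inl,
            TrivSqZeroExt.snd_inr, Derivation.leibniz, smul_eq_mul, map_add, map_mul]
          ring
      map_zero' := by ext <;> simp
      map_add' := by
        intro a b
        ext
        · simp only [TrivSqZeroExt.fst_add, TrivSqZeroExt.fst_inl,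
            TrivSqZeroExt.fst_inr, map_add, add_zero]
        · simp only [TrivSqZeroExt.snd_add, TrivSqZeroExt.snd_inl,
            TrivSqZeroExt.snd_inr, map_add, zero_add] }
    ![TrivSqZeroExt.inl (y K) + TrivSqZeroExt.inr P,
      TrivSqZeroExt.inl (z K) + TrivSqZeroExt.inr Q]

theorem fst_taylorPoly (δ : Derivation ℂ K K) (P Q : RatFun K) (A : MvPolynomial (Fin 2) K) :
    (taylorPoly δ P Q A).fst = algebraMap _ (RatFun K) A := by
  induction A using MvPolynomial.induction_on with
  | C k =>
    simp only [taylorPoly, coe_eval₂Hom, eval₂_C, RingHom.coe_mk, MonoidHom.coe_mk,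
      OneHom.coe_mk, TrivSqZeroExt.fst_add, TrivSqZeroExt.fst_inl, TrivSqZeroExt.fst_inr, add_zero]
    rfl
  | add A B hA hB => rw [map_add, TrivSqZeroExt.fst_add, hA, hB, map_add]
  | mul_X A i hA =>
    rw [map_mul, TrivSqZeroExt.fst_mul, hA, map_mul]
    congr 1
    fin_cases i <;>
      simp only [taylorPoly, coe_eval₂Hom, eval₂_X, TrivSqZeroExt.fst_add, TrivSqZeroExt.fst_inl,
        TrivSqZeroExt.fst_inr, add_zero, y, z, Fin.zero_eta, Fin.mk_one, Matrix.cons_val_zero,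
        Matrix.cons_val_one]

/-- The extension of `taylorPoly` to rational functions. -/
def taylor (δ : Derivation ℂ K K) (P Q : RatFun K) : RatFun K →+* (RatFun K)[ε] :=
  IsLocalization.lift (M := nonZeroDivisors (MvPolynomial (Fin 2) K)) (g := taylorPoly δ P Q) (by
    intro s
    rw [TrivSqZeroExt.isUnit_iff_isUnit_fst, fst_taylorPoly]
    exact IsLocalization.map_units _ s)

theorem taylor_algebraMap (δ : Derivation ℂ K K) (P Q : RatFun K) (A : MvPolynomial (Fin 2) K) :
    taylor δ P Q (algebraMap _ _ A) = taylorPoly δ P Q A :=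
  IsLocalization.lift_eq _ A

theorem fst_taylor (δ : Derivation ℂ K K) (P Q : RatFun K) (f : RatFun K) :
    (taylor δ P Q f).fst = f := by
  have h : (TrivSqZeroExt.fstHom (RatFun K) (RatFun K) (RatFun K)).toRingHom.comp
      (taylor δ P Q) = RingHom.id _ := by
    apply IsLocalization.ringHom_ext (nonZeroDivisors (MvPolynomial (Fin 2) K))
    refine RingHom.ext fun A => ?_
    change (taylor δ P Q (algebraMap _ _ A)).fst = algebraMap _ _ A
    rw [taylor_algebraMap, fst_taylorPoly]
  exact congrArg (fun φ => φ f) h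

/-- The coefficientwise derivation together with `y' = P`, `z' = Q`: the total derivative `d/dx`
of a rational function of `y`, `z` with coefficients in `K` along the system `y' = P`, `z' = Q`,
where the elements of `K` are differentiated by `δ`. -/
def totalDeriv (δ : Derivation ℂ K K) (P Q : RatFun K) :
    Derivation ℂ (RatFun K) (RatFun K) where
  toFun := fun f => (taylor δ P Q f).snd
  map_add' := by intro f g; simp
  map_smul' := by
    intro c f
    have h : (taylor δ P Q (algebraMap ℂ (RatFun K) c)) =
        TrivSqZeroExt.inl (algebraMap ℂ (RatFun K) c) := by
      have h1 : algebraMap ℂ (RatFun K) c =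
          algebraMap (MvPolynomial (Fin 2) K) (RatFun K) (C (algebraMap ℂ K c)) := by
        rw [IsScalarTower.algebraMap_apply ℂ (MvPolynomial (Fin 2) K) (RatFun K)]
        rfl
      rw [h1, taylor_algebraMap]
      simp only [taylorPoly, coe_eval₂Hom, eval₂_C, RingHom.coe_mk, MonoidHom.coe_mk,
        OneHom.coe_mk, Derivation.map_algebraMap, map_zero, TrivSqZeroExt.inr_zero, add_zero]
      rfl
    simp only [Algebra.smul_def, map_mul, h, RingHom.id_apply]
    simp
  map_one_eq_zero' := by simp
  leibniz' := by
    intro f g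
    simp [fst_taylor]
    ring

theorem totalDeriv_apply (δ : Derivation ℂ K K) (P Q f : RatFun K) :
    totalDeriv δ P Q f = (taylor δ P Q f).snd := rfl

@[simp]
theorem totalDeriv_algebraMap (δ : Derivation ℂ K K) (P Q : RatFun K) (k : K) :
    totalDeriv δ P Q (algebraMap K (RatFun K) k) = algebraMap K (RatFun K) (δ k) := by
  have h1 : algebraMap K (RatFun K) k =
      algebraMap (MvPolynomial (Fin 2) K) (RatFun K) (C k) := rfl
  rw [totalDeriv_apply, h1, taylor_algebraMap]
  simp only [taylorPoly, coe_eval₂Hom, eval₂_C, RingHom.coe_mk, MonoidHom.coe_mk,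
    OneHom.coe_mk, TrivSqZeroExt.snd_add, TrivSqZeroExt.snd_inl, TrivSqZeroExt.snd_inr, zero_add]

@[simp]
theorem totalDeriv_y (δ : Derivation ℂ K K) (P Q : RatFun K) : totalDeriv δ P Q (y K) = P := by
  rw [totalDeriv_apply, y, taylor_algebraMap]
  simp [taylorPoly]

@[simp]
theorem totalDeriv_z (δ : Derivation ℂ K K) (P Q : RatFun K) : totalDeriv δ P Q (z K) = Q := by
  rw [totalDeriv_apply, z, taylor_algebraMap]
  simp [taylorPoly]

end RatFun

end Systems
section Regularisation

variable {K : Type} [Field K]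

/-- The value of a polynomial in two chart variables at a geometric point. -/
def valueAt (A : MvPolynomial (Fin 2) K) (p : AlgebraicClosure K × AlgebraicClosure K) :
    AlgebraicClosure K :=
  aeval ![p.1, p.2] A

/-- The rational function `f`, written in the chart with coordinates `(u, v)`, is regular at the
point `p`: it is a fraction whose denominator does not vanish there. -/
def IsRegularAt (u v f : RatFun K) (p : AlgebraicClosure K × AlgebraicClosure K) : Prop :=
  ∃ N M : MvPolynomial (Fin 2) K,
    f * aeval ![u, v] M = aeval ![u, v] N ∧ valueAt M p ≠ 0

/-- The rational function `f`, written in the chart with coordinates `(u, v)` as a fraction in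
lowest terms, becomes `0/0` at the point `p`. -/
def IsIndeterminateAt (u v f : RatFun K) (p : AlgebraicClosure K × AlgebraicClosure K) : Prop :=
  ∃ N M : MvPolynomial (Fin 2) K, M ≠ 0 ∧ IsRelPrime N M ∧
    f * aeval ![u, v] M = aeval ![u, v] N ∧ valueAt N p = 0 ∧ valueAt M p = 0

variable [Algebra ℂ K]

/-- `p` is a base point, in the chart `(u, v)`, of the system `u' = D u`, `v' = D v`: the
right-hand side becomes `0/0` there. That is, one of its components is `0/0`, and none of them is
`c/0` with `c ≠ 0` (where the right-hand side is infinite but determined). -/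
def IsBasePoint (D : Derivation ℂ (RatFun K) (RatFun K)) (u v : RatFun K)
    (p : AlgebraicClosure K × AlgebraicClosure K) : Prop :=
  (IsIndeterminateAt u v (D u) p ∨ IsIndeterminateAt u v (D v) p) ∧
    (IsRegularAt u v (D u) p ∨ IsIndeterminateAt u v (D u) p) ∧
    (IsRegularAt u v (D v) p ∨ IsIndeterminateAt u v (D v) p)

/-- The system is regular at the point `p` of the chart `(u, v)`. -/
def IsRegularSystemAt (D : Derivation ℂ (RatFun K) (RatFun K)) (u v : RatFun K)
    (p : AlgebraicClosure K × AlgebraicClosure K) : Prop :=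
  IsRegularAt u v (D u) p ∧ IsRegularAt u v (D v) p

/-- First coordinates after the blow-up of the chart `(u, v)` at the point `(a, b)`:
`(u₁, v₁) = (u - a, (v - b)/(u - a))`, with exceptional curve `u₁ = 0`. -/
def blowupFst (u v : RatFun K) (a b : K) : RatFun K × RatFun K :=
  (u - algebraMap K _ a, (v - algebraMap K _ b) / (u - algebraMap K _ a))

/-- Second coordinates after the blow-up of the chart `(u, v)` at the point `(a, b)`:
`(U₁, V₁) = ((u - a)/(v - b), v - b)`, with exceptional curve `V₁ = 0`. -/
def blowupSnd (u v : RatFun K) (a b : K) : RatFun K × RatFun K :=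
  ((u - algebraMap K _ a) / (v - algebraMap K _ b), v - algebraMap K _ b)

/-- The cascades of blow-ups issuing from the point `(a, b)` of the chart `(u, v)` end after
finitely many steps, and the system is regularised at their end. The point is blown up; every base
point on the exceptional curve, in either of the two charts, has coordinates in `K`, is blown up in
its turn, and its cascades end and are regularised; and if there is no base point left on the
exceptional curve, then the system is regular along the whole exceptional curve in one of the two
charts. -/
inductive CascadesRegularised (D : Derivation ℂ (RatFun K) (RatFun K)) :
    RatFun K → RatFun K → K → K → Prop
  | blowup (u v : RatFun K) (a b : K)
      (rational_fst : ∀ t : AlgebraicClosure K,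
        IsBasePoint D (blowupFst u v a b).1 (blowupFst u v a b).2 (0, t) →
          ∃ s : K, algebraMap K (AlgebraicClosure K) s = t)
      (rational_snd : ∀ t : AlgebraicClosure K,
        IsBasePoint D (blowupSnd u v a b).1 (blowupSnd u v a b).2 (t, 0) →
          ∃ s : K, algebraMap K (AlgebraicClosure K) s = t)
      (next_fst : ∀ s : K,
        IsBasePoint D (blowupFst u v a b).1 (blowupFst u v a b).2
          (0, algebraMap K (AlgebraicClosure K) s) →
        CascadesRegularised D (blowupFst u v a b).1 (blowupFst u v a b).2 0 s)
      (next_snd : ∀ s : K,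
        IsBasePoint D (blowupSnd u v a b).1 (blowupSnd u v a b).2
          (algebraMap K (AlgebraicClosure K) s, 0) →
        CascadesRegularised D (blowupSnd u v a b).1 (blowupSnd u v a b).2 s 0)
      (final :
        ((∀ t, ¬ IsBasePoint D (blowupFst u v a b).1 (blowupFst u v a b).2 (0, t)) ∧
          ∀ t, ¬ IsBasePoint D (blowupSnd u v a b).1 (blowupSnd u v a b).2 (t, 0)) →
        (∀ t, IsRegularSystemAt D (blowupFst u v a b).1 (blowupFst u v a b).2 (0, t)) ∨
          ∀ t, IsRegularSystemAt D (blowupSnd u v a b).1 (blowupSnd u v a b).2 (t, 0)) :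
      CascadesRegularised D u v a b

/-- Every base point visible in the affine chart `(u, v)` has coordinates in `K`, and its cascades
of blow-ups end and are regularised. -/
def ChartRegularised (D : Derivation ℂ (RatFun K) (RatFun K)) (u v : RatFun K) : Prop :=
  ∀ p : AlgebraicClosure K × AlgebraicClosure K, IsBasePoint D u v p →
    ∃ a b : K, p = (algebraMap K _ a, algebraMap K _ b) ∧ CascadesRegularised D u v a b

/-- The system `y' = P`, `z' = Q`, compactified to the projective plane with the three affine
charts `(y, z)`, `(1/y, z/y)` and `(y/z, 1/z)`, is regularised by the blow-up process. -/
def IsRegularised (δ : Derivation ℂ K K) (S : RatFun K × RatFun K) : Prop :=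
  ChartRegularised (RatFun.totalDeriv δ S.1 S.2) (RatFun.y K) (RatFun.z K) ∧
    ChartRegularised (RatFun.totalDeriv δ S.1 S.2) (1 / RatFun.y K)
      (RatFun.z K / RatFun.y K) ∧
    ChartRegularised (RatFun.totalDeriv δ S.1 S.2) (RatFun.y K / RatFun.z K)
      (1 / RatFun.z K)

end Regularisation

section PainleveSix

/-- The parameters `κ₀, κ₁, κ_t, κ_∞` of the Okamoto Hamiltonian. -/
structure PVIParams where
  κ0 : ℂ
  κ1 : ℂ
  κt : ℂ
  κinf : ℂ

namespace PVIParams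

def κ (c : PVIParams) : ℂ := (c.κ0 + c.κ1 + c.κt - 1) ^ 2 / 4 - c.κinf ^ 2 / 4

def α (c : PVIParams) : ℂ := (c.κt + c.κ0 + c.κ1 - 1) ^ 2 / 2 - 2 * c.κ

def β (c : PVIParams) : ℂ := -(c.κ0 ^ 2 / 2)

def γ (c : PVIParams) : ℂ := c.κ1 ^ 2 / 2

def δ (c : PVIParams) : ℂ := (1 - c.κt ^ 2) / 2

end PVIParams

variable {Ω : PlaneDomain}

/-- A meromorphic function which is none of the functions `0`, `1`, `x`, at which the sixth
Painlevé equation is singular. -/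
def IsAdmissible (q : Mero Ω) : Prop := q ≠ 0 ∧ q ≠ 1 ∧ q ≠ Mero.coord Ω

/-- `q` solves the sixth Painlevé equation with parameters `α, β, γ, δ`. -/
def SolvesPVI (α β γ δ : ℂ) (q : Mero Ω) : Prop :=
  let x := Mero.coord Ω
  let q' := Mero.ddx Ω q
  IsAdmissible q ∧
    Mero.ddx Ω q' =
      1 / 2 * (1 / q + 1 / (q - 1) + 1 / (q - x)) * q' ^ 2
        - (1 / x + 1 / (x - 1) + 1 / (q - x)) * q'
        + q * (q - 1) * (q - x) / (x ^ 2 * (x - 1) ^ 2)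
          * (algebraMap ℂ _ α + algebraMap ℂ _ β * x / q ^ 2
            + algebraMap ℂ _ γ * (x - 1) / (q - 1) ^ 2
            + algebraMap ℂ _ δ * x * (x - 1) / (q - x) ^ 2)

variable (Ω) in
/-- The Okamoto Hamiltonian of the sixth Painlevé equation, a polynomial in `(y₆, z₆)` with
coefficients rational in `x`. -/
def okamotoHamiltonian (c : PVIParams) : MvPolynomial (Fin 2) (Mero Ω) :=
  let x : MvPolynomial (Fin 2) (Mero Ω) := C (Mero.coord Ω)
  let y : MvPolynomial (Fin 2) (Mero Ω) := X 0
  let z : MvPolynomial (Fin 2) (Mero Ω) := X 1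
  let k : ℂ → MvPolynomial (Fin 2) (Mero Ω) := fun a => C (algebraMap ℂ (Mero Ω) a)
  C (1 / (Mero.coord Ω * (Mero.coord Ω - 1))) *
    (y * (y - 1) * (y - x) * z ^ 2
      - z * (k c.κ0 * (y - 1) * (y - x) + k c.κ1 * y * (y - x) + (k c.κt - 1) * y * (y - 1))
      + k c.κ * (y - x))

variable (Ω) in
/-- The right-hand side `∂H/∂z₆` of the Okamoto equation for `y₆'`. -/
def okamotoF (c : PVIParams) : MvPolynomial (Fin 2) (Mero Ω) :=
  pderiv 1 (okamotoHamiltonian Ω c)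

variable (Ω) in
/-- The right-hand side `-∂H/∂y₆` of the Okamoto equation for `z₆'`. -/
def okamotoG (c : PVIParams) : MvPolynomial (Fin 2) (Mero Ω) :=
  -pderiv 0 (okamotoHamiltonian Ω c)

variable (Ω) in
/-- The Okamoto Hamiltonian system. -/
def okamotoSystem (c : PVIParams) : RatFun (Mero Ω) × RatFun (Mero Ω) :=
  (algebraMap _ _ (okamotoF Ω c), algebraMap _ _ (okamotoG Ω c))

/-- The function `h(q, q'; x)` whose graph is the orbit: the first Okamoto equation, which is
linear in `z₆`, solved for `z₆ = h(y₆, y₆'; x)` and evaluated at `q`. -/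
def orbitH (c : PVIParams) (q : Mero Ω) : Mero Ω :=
  let x := Mero.coord Ω
  let k : ℂ → Mero Ω := algebraMap ℂ (Mero Ω)
  (x * (x - 1) * Mero.ddx Ω q
      + k c.κ0 * (q - 1) * (q - x) + k c.κ1 * q * (q - x) + (k c.κt - 1) * q * (q - 1))
    / (2 * q * (q - 1) * (q - x))

/-- The value of a polynomial in `(y₆, z₆)` at the point `(q, h(q, q'; x))` of the orbit. -/
def atOrbit (c : PVIParams) (q : Mero Ω) (A : MvPolynomial (Fin 2) (Mero Ω)) : Mero Ω :=
  aeval ![q, orbitH c q] A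

/-- The image of `y₆` under the blow-up-like change of variables, namely `y₆ = z + q`. -/
def subY (q : Mero Ω) : RatFun (Mero Ω) :=
  RatFun.z (Mero Ω) + algebraMap _ _ q

/-- The image of `z₆` under the blow-up-like change of variables, namely `z₆ = y z + h(q, q'; x)`. -/
def subZ (c : PVIParams) (q : Mero Ω) : RatFun (Mero Ω) :=
  RatFun.y (Mero Ω) * RatFun.z (Mero Ω) + algebraMap _ _ (orbitH c q)

/-- The second component of the system in `(y, z)`: from `z = y₆ - q`,
`z' = F(z + q, y z + h) - q'`. -/
def newZ' (c : PVIParams) (q : Mero Ω) : RatFun (Mero Ω) :=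
  aeval ![subY q, subZ c q] (okamotoF Ω c) - algebraMap _ _ (Mero.ddx Ω q)

/-- The first component of the system in `(y, z)`: from `y z = z₆ - h`,
`y' = (G(z + q, y z + h) - h' - y z') / z`, where the derivative `h'` is expressed through `q` and
`q'` as `G(q, h)`, its value when the point `(q, h)` moves along the orbit. -/
def newY' (c : PVIParams) (q : Mero Ω) : RatFun (Mero Ω) :=
  (aeval ![subY q, subZ c q] (okamotoG Ω c) - algebraMap _ _ (atOrbit c q (okamotoG Ω c))
    - RatFun.y (Mero Ω) * newZ' c q) / RatFun.z (Mero Ω)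

/-- The system in `(y, z)` obtained from the Okamoto system by the blow-up-like change of variables
`(y₆, z₆) = (z + q, y z + h)` at the
point `(q, h(q, q'; x))`. Its coefficients are functions of `x`, `q` and `q'`. -/
def newSystem (c : PVIParams) (q : Mero Ω) : RatFun (Mero Ω) × RatFun (Mero Ω) :=
  (newY' c q, newZ' c q)

/-- The invertible substitution `φ` carries the system `S` to the system `T`: it intertwines the
total derivatives along the two systems. -/
def Intertwines (φ : RatFun (Mero Ω) ≃ₐ[Mero Ω] RatFun (Mero Ω))
    (S T : RatFun (Mero Ω) × RatFun (Mero Ω)) : Prop :=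
  ∀ f, φ (RatFun.totalDeriv (Mero.ddx Ω) S.1 S.2 f) =
    RatFun.totalDeriv (Mero.ddx Ω) T.1 T.2 (φ f)

/-- The value which the sixth Painlevé equation, with `β, γ, δ` given, forces on the parameter `α`:
the equation solved for `α`. -/
def solvedForAlpha (c : PVIParams) (q : Mero Ω) : Mero Ω :=
  let x := Mero.coord Ω
  let q' := Mero.ddx Ω q
  x ^ 2 * (x - 1) ^ 2 / (q * (q - 1) * (q - x))
      * (Mero.ddx Ω q' - 1 / 2 * (1 / q + 1 / (q - 1) + 1 / (q - x)) * q' ^ 2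
        + (1 / x + 1 / (x - 1) + 1 / (q - x)) * q')
    - algebraMap ℂ _ c.β * x / q ^ 2
    - algebraMap ℂ _ c.γ * (x - 1) / (q - 1) ^ 2
    - algebraMap ℂ _ c.δ * x * (x - 1) / (q - x) ^ 2

/-- The regularising condition: a differential equation of third order for `q`, the derivative of
the sixth Painlevé equation solved for `α`. -/
def RegularisingCondition (c : PVIParams) (q : Mero Ω) : Prop :=
  Mero.ddx Ω (solvedForAlpha c q) = 0

/-- A family of systems `S q` in `(y, z)`, depending on a meromorphic function `q`, is
Bureau-Guillot for the sixth Painlevé equation with parameters `c` at the transcendent `q`. -/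
structure IsBureauGuillot (c : PVIParams)
    (S : Mero Ω → RatFun (Mero Ω) × RatFun (Mero Ω)) (q : Mero Ω) : Prop where
  /-- `q` is a transcendent of the equation. -/
  transcendent : SolvesPVI c.α c.β c.γ c.δ q
  /-- The system is birationally equivalent to the Hamiltonian system of the equation. -/
  birational : ∃ φ, Intertwines φ (okamotoSystem Ω c) (S q)
  /-- The system is rational, its coefficients being meromorphic functions of `x` which are
  rational functions of `x`, `q` and the derivatives of `q`. -/
  coefficients : ∃ A₁ B₁ A₂ B₂ : MvPolynomial (Fin 2) (Mero Ω), B₁ ≠ 0 ∧ B₂ ≠ 0 ∧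
    S q = (algebraMap _ _ A₁ / algebraMap _ _ B₁, algebraMap _ _ A₂ / algebraMap _ _ B₂) ∧
    ∀ A ∈ ({A₁, B₁, A₂, B₂} : Set (MvPolynomial (Fin 2) (Mero Ω))), ∀ m,
      A.coeff m ∈ IntermediateField.adjoin ℂ
        (insert (Mero.coord Ω) (Set.range fun n : ℕ => (Mero.ddx Ω)^[n] q))
  /-- The system at the transcendent `q` is regularised. -/
  regularised : IsRegularised (Mero.ddx Ω) (S q)
  /-- The sixth Painlevé equation is the regularising condition: for an arbitrary coefficient
  function `p`, the system `S p` is regularised exactly when `p` solves the equation with the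
  given `β, γ, δ` and some constant `α`. -/
  regularising : ∀ p : Mero Ω, IsAdmissible p →
    (IsRegularised (Mero.ddx Ω) (S p) ↔ ∃ a : ℂ, SolvesPVI a c.β c.γ c.δ p)

end PainleveSix

end

/-! The point is that `S_q` is an Okamoto system in disguise for every admissible `q`. In the
variables `Y = z + q`, `Z = y z + h` it satisfies the first Okamoto equation exactly, and the second
one up to the defect `h' - G(q, h)`, a function of `x` alone. Since `κ` enters `G` only through the
additive term `-κ / (x (x - 1))`, the defect is absorbed by replacing `κ` with the function `k = κ -
x (x - 1) (h' - G(q, h))`, the `movingParameter`. By construction `(q, h)` is an orbit of this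
modified system, and a computation (`solvedForAlpha_eq`) gives `A(q) = const - 2 k`. Hence `A(q)' =
0` means `k' = 0`, and `(P_VI)` with the given `α` means `k = κ`, that is, zero defect. It remains
to show that the modified system is regularised exactly when `k' = 0`.

Put `s = 1 / (x (x - 1))`, `w = Y - q`, `ζ = Z - h`, `y = ζ / w`. Because `(q, h)` is an orbit, the
equations for `w` and `ζ` have no constant terms, so the system in `y, w` is polynomial, and `k`
drops out of it. Over the origin of the chart `(1/y, w/y)` one blow-up yields the coordinates `1/y`,
`w`. The base points there are `w = 0`, where one further blow-up restores the contracted line `Y =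
q`, and the points `Z = ∞`, `Y = a` with `a = 0, 1, x`. At the latter, `(Y - a) Z` tends to the
constants `κ₀, κ₁, κ_t`, and the cascade ends whatever `k` is (`IsOrbit.cascades_fst`). Over the
origin of `(y/w, 1/w)` two blow-ups lead to the point `Y = ∞`, `Z = 0`. The next one introduces `m =
Y Z`, with base points at the roots of `m² - l₂ m + k`, where `l₂ = κ₀ + κ₁ + κ_t - 1`. There the
linear part is resonant, and the obstruction to regularity is the derivative of the root. If `k` is
constant, so are the roots, and the cascades end regularly. If `k' ≠ 0`, a root either lies outside
`K`, or is a nonconstant simple root, and then a pole persists along the whole last exceptional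
curve (`unresolved_infinity`).

Base points and cascades are defined through explicit coordinates. To compute in convenient ones, a
point is treated as a place: `HasValue u v p` is the evaluation map of the local ring at `p`, which
depends on the chart only through that local ring. `Resolved` and `Unresolved` quantify over all
coordinates with the same place and the same first coordinate up to a unit, and `blowup_change`
shows that blowing up respects this equivalence. -/

noncomputable section

open Filter
open MvPolynomial
open scoped DualNumber

/-! ### Regular and indeterminate rational functions at a point of a chart. -/

section Values

variable {K : Type} [Field K]

theorem valueAt_add (A B : MvPolynomial (Fin 2) K) (p) :
    valueAt (A + B) p = valueAt A p + valueAt B p := map_add _ _ _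

theorem valueAt_mul (A B : MvPolynomial (Fin 2) K) (p) :
    valueAt (A * B) p = valueAt A p * valueAt B p := map_mul _ _ _

theorem valueAt_neg (A : MvPolynomial (Fin 2) K) (p) : valueAt (-A) p = -valueAt A p :=
  map_neg _ _

@[simp]
theorem valueAt_one (p) : valueAt (1 : MvPolynomial (Fin 2) K) p = 1 := map_one _

@[simp]
theorem valueAt_zero (p) : valueAt (0 : MvPolynomial (Fin 2) K) p = 0 := map_zero _

@[simp]
theorem valueAt_C (k : K) (p) :
    valueAt (C k) p = algebraMap K (AlgebraicClosure K) k := by simp [valueAt]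

@[simp]
theorem valueAt_X_zero (p : AlgebraicClosure K × AlgebraicClosure K) :
    valueAt (X 0) p = p.1 := by simp [valueAt]

@[simp]
theorem valueAt_X_one (p : AlgebraicClosure K × AlgebraicClosure K) :
    valueAt (X 1) p = p.2 := by simp [valueAt]

theorem valueAt_rational (A : MvPolynomial (Fin 2) K) (a b : K) :
    valueAt A (algebraMap K _ a, algebraMap K _ b) = algebraMap K _ (aeval ![a, b] A) := by
  rw [valueAt, ← MvPolynomial.aeval_algebraMap_apply]
  congr 2
  ext i
  fin_cases i <;> rfl

/-- The rational function `f` is regular at the point `p` of the chart `(u, v)` and takes the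
value `c` there. -/
def HasValue (u v : RatFun K) (p : AlgebraicClosure K × AlgebraicClosure K) (f : RatFun K)
    (c : AlgebraicClosure K) : Prop :=
  ∃ N M : MvPolynomial (Fin 2) K,
    f * aeval ![u, v] M = aeval ![u, v] N ∧ valueAt M p ≠ 0 ∧ valueAt N p = c * valueAt M p

theorem isRegularAt_iff {u v f : RatFun K} {p} :
    IsRegularAt u v f p ↔ ∃ c, HasValue u v p f c := by
  constructor
  · rintro ⟨N, M, h, hM⟩
    exact ⟨valueAt N p / valueAt M p, N, M, h, hM, by field_simp⟩
  · rintro ⟨c, N, M, h, hM, -⟩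
    exact ⟨N, M, h, hM⟩

namespace HasValue

variable {u v f g : RatFun K} {p : AlgebraicClosure K × AlgebraicClosure K}
  {c d : AlgebraicClosure K}

theorem aeval (u v : RatFun K) (p) (A : MvPolynomial (Fin 2) K) :
    HasValue u v p (MvPolynomial.aeval ![u, v] A) (valueAt A p) :=
  ⟨A, 1, by simp, by simp, by simp⟩

theorem fst (u v : RatFun K) (p) : HasValue u v p u p.1 := by
  simpa using HasValue.aeval u v p (X 0)

theorem snd (u v : RatFun K) (p) : HasValue u v p v p.2 := by
  simpa using HasValue.aeval u v p (X 1)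

theorem const (u v : RatFun K) (p) (k : K) :
    HasValue u v p (algebraMap K _ k) (algebraMap K _ k) := by
  simpa using HasValue.aeval u v p (C k)

theorem zero (u v : RatFun K) (p) : HasValue u v p 0 0 := by
  simpa using HasValue.const u v p 0

theorem one (u v : RatFun K) (p) : HasValue u v p 1 1 := by
  simpa using HasValue.const u v p 1

theorem add (hf : HasValue u v p f c) (hg : HasValue u v p g d) :
    HasValue u v p (f + g) (c + d) := by
  obtain ⟨N, M, h, hM, hN⟩ := hf
  obtain ⟨N', M', h', hM', hN'⟩ := hg
  refine ⟨N * M' + N' * M, M * M', ?_, ?_, ?_⟩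
  · rw [map_mul, map_add, map_mul, map_mul, ← h, ← h']
    ring
  · rw [valueAt_mul]
    exact mul_ne_zero hM hM'
  · rw [valueAt_mul, valueAt_add, valueAt_mul, valueAt_mul, hN, hN']
    ring

theorem mul (hf : HasValue u v p f c) (hg : HasValue u v p g d) :
    HasValue u v p (f * g) (c * d) := by
  obtain ⟨N, M, h, hM, hN⟩ := hf
  obtain ⟨N', M', h', hM', hN'⟩ := hg
  refine ⟨N * N', M * M', ?_, ?_, ?_⟩
  · rw [map_mul, map_mul, ← h, ← h']
    ring
  · rw [valueAt_mul]
    exact mul_ne_zero hM hM'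
  · rw [valueAt_mul, valueAt_mul, hN, hN']
    ring

theorem neg (hf : HasValue u v p f c) : HasValue u v p (-f) (-c) := by
  obtain ⟨N, M, h, hM, hN⟩ := hf
  refine ⟨-N, M, ?_, hM, ?_⟩
  · rw [map_neg, ← h]
    ring
  · rw [valueAt_neg, hN]
    ring

theorem sub (hf : HasValue u v p f c) (hg : HasValue u v p g d) :
    HasValue u v p (f - g) (c - d) := by
  rw [sub_eq_add_neg, sub_eq_add_neg]
  exact hf.add hg.neg

theorem pow (hf : HasValue u v p f c) (n : ℕ) : HasValue u v p (f ^ n) (c ^ n) := by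
  induction n with
  | zero => simpa using HasValue.one u v p
  | succ n ih =>
    rw [pow_succ, pow_succ]
    exact ih.mul hf

theorem natCast (u v : RatFun K) (p) (n : ℕ) : HasValue u v p n n := by
  simpa using HasValue.const u v p n

theorem ofNat (u v : RatFun K) (p) (n : ℕ) [n.AtLeastTwo] :
    HasValue u v p (OfNat.ofNat n) (OfNat.ofNat n) := by
  exact_mod_cast HasValue.natCast u v p n

theorem congr_value (hf : HasValue u v p f c) (h : c = d) : HasValue u v p f d := h ▸ hf

end HasValue

/-- The functions `u`, `v` generate the field of rational functions, hence are the coordinates of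
an affine chart. -/
def IsChart (u v : RatFun K) : Prop := IntermediateField.adjoin K {u, v} = ⊤

namespace IsChart

variable {u v : RatFun K}

theorem symm (h : IsChart u v) : IsChart v u := by
  rwa [IsChart, Set.pair_comm]

theorem of_mem {u' v' : RatFun K} (h : IsChart u v)
    (hu : u ∈ IntermediateField.adjoin K {u', v'})
    (hv : v ∈ IntermediateField.adjoin K {u', v'}) : IsChart u' v' := by
  rw [IsChart, eq_top_iff, ← h, IntermediateField.adjoin_le_iff]
  rintro _ (rfl | rfl)
  exacts [hu, hv]

theorem exists_fraction (h : IsChart u v) (f : RatFun K) :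
    ∃ N M : MvPolynomial (Fin 2) K, aeval ![u, v] M ≠ 0 ∧
      f * aeval ![u, v] M = aeval ![u, v] N := by
  have hf : f ∈ IntermediateField.adjoin K (Set.range ![u, v]) := by
    have h1 : Set.range ![u, v] = {u, v} := by simp [Matrix.range_cons, Set.pair_comm]
    rw [h1, h]
    trivial
  obtain ⟨N, M, rfl⟩ := (IntermediateField.mem_adjoin_range_iff K _ f).1 hf
  -- The quotient found for `f` may have denominator zero; then it is `0` by convention, and `0/1`
  -- represents it.
  by_cases hM : aeval ![u, v] M = 0
  · exact ⟨0, 1, by simp, by simp [hM]⟩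
  · exact ⟨N, M, hM, by field_simp⟩

theorem coordinates (K : Type) [Field K] : IsChart (RatFun.y K) (RatFun.z K) := by
  rw [IsChart, eq_top_iff]
  intro f _
  have h1 : ∀ A : MvPolynomial (Fin 2) K, algebraMap _ (RatFun K) A ∈
      IntermediateField.adjoin K {RatFun.y K, RatFun.z K} := by
    intro A
    induction A using MvPolynomial.induction_on with
    | C k => exact (IntermediateField.adjoin K _).algebraMap_mem k
    | add A B hA hB => rw [map_add]; exact add_mem hA hB
    | mul_X A i hA =>
      rw [map_mul]
      refine mul_mem hA (IntermediateField.subset_adjoin _ _ ?_)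
      fin_cases i
      · exact Or.inl rfl
      · exact Or.inr rfl
  obtain ⟨N, M, -, rfl⟩ := IsFractionRing.div_surjective (A := MvPolynomial (Fin 2) K) f
  exact div_mem (h1 N) (h1 M)

theorem trdeg_ratFun (K : Type) [Field K] : (2 : Cardinal) ≤ Algebra.trdeg K (RatFun K) := by
  have h1 := trdeg_le_of_injective
    (IsScalarTower.toAlgHom K (MvPolynomial (Fin 2) K) (RatFun K))
    (IsFractionRing.injective (MvPolynomial (Fin 2) K) (RatFun K))
  simpa using h1

/-- The whole field is algebraic over `K[u, v]` and has transcendence degree at least two, so two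
generators leave no room for an algebraic relation. Identities between rational functions can
therefore be read as polynomial identities in any chart. -/
theorem injective (h : IsChart u v) : Function.Injective (aeval (R := K) ![u, v]) := by
  have h1 : Algebra.IsAlgebraic (Algebra.adjoin K (Set.range ![u, v])) (RatFun K) := by
    refine ⟨fun f => ?_⟩
    obtain ⟨N, M, hM, hf⟩ := h.exists_fraction f
    have hmem : ∀ A : MvPolynomial (Fin 2) K,
        IsAlgebraic (Algebra.adjoin K (Set.range ![u, v])) (aeval ![u, v] A) := by
      intro A
      have hA : aeval ![u, v] A ∈ Algebra.adjoin K (Set.range ![u, v]) := by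
        rw [Algebra.adjoin_range_eq_range_aeval]
        exact ⟨A, rfl⟩
      exact isAlgebraic_algebraMap
        (⟨_, hA⟩ : Algebra.adjoin K (Set.range ![u, v]))
    rw [eq_div_of_mul_eq hM hf, div_eq_mul_inv]
    exact (hmem N).mul (hmem M).inv
  have h2 := Algebra.IsAlgebraic.isTranscendenceBasis_of_le_trdeg_of_finite K ![u, v]
    (by simpa using trdeg_ratFun K)
  exact h2.1

theorem aeval_ne_zero (h : IsChart u v) {A : MvPolynomial (Fin 2) K} (hA : A ≠ 0) :
    aeval ![u, v] A ≠ 0 := fun h0 => hA (h.injective (by rw [h0, map_zero]))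

theorem ne_zero_fst (h : IsChart u v) : u ≠ 0 := by
  simpa using h.aeval_ne_zero (X_ne_zero (0 : Fin 2))

theorem ne_zero_snd (h : IsChart u v) : v ≠ 0 := h.symm.ne_zero_fst

theorem fst_ne_const (h : IsChart u v) (k : K) : u ≠ algebraMap K _ k := by
  intro h1
  have h2 : (X 0 : MvPolynomial (Fin 2) K) = C k := h.injective (by simpa using h1)
  have h3 := congrArg (pderiv 0) h2
  simp at h3

theorem snd_ne_const (h : IsChart u v) (k : K) : v ≠ algebraMap K _ k := h.symm.fst_ne_const k

/-- Every rational function is a fraction in lowest terms in the coordinates of a chart. -/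
theorem exists_reduced (h : IsChart u v) (f : RatFun K) :
    ∃ N M : MvPolynomial (Fin 2) K, M ≠ 0 ∧ IsRelPrime N M ∧
      f * aeval ![u, v] M = aeval ![u, v] N := by
  obtain ⟨N, M, hM, hf⟩ := h.exists_fraction f
  have hM0 : M ≠ 0 := by
    rintro rfl
    exact hM (map_zero _)
  obtain ⟨N', M', R, hrel, rfl, rfl⟩ := UniqueFactorizationMonoid.exists_reduced_factors' N M hM0
  rw [map_mul] at hM
  refine ⟨N', M', right_ne_zero_of_mul hM0, hrel, ?_⟩
  apply mul_left_cancel₀ (left_ne_zero_of_mul hM)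
  rw [map_mul, map_mul] at hf
  rw [← hf]
  ring

end IsChart

namespace HasValue

variable {u v f g : RatFun K} {p : AlgebraicClosure K × AlgebraicClosure K}
  {c d : AlgebraicClosure K}

theorem unique (h : IsChart u v) (hc : HasValue u v p f c) (hd : HasValue u v p f d) : c = d := by
  obtain ⟨N, M, h1, hM, hN⟩ := hc
  obtain ⟨N', M', h1', hM', hN'⟩ := hd
  have h2 : N * M' = N' * M := h.injective (by
    rw [map_mul, map_mul, ← h1, ← h1']
    ring)
  have h3 := congrArg (fun A => valueAt A p) h2
  simp only [valueAt_mul, hN, hN'] at h3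
  have h4 : (c - d) * (valueAt M p * valueAt M' p) = 0 := by linear_combination h3
  exact sub_eq_zero.1 ((mul_eq_zero.1 h4).resolve_right (mul_ne_zero hM hM'))

theorem ne_zero (h : IsChart u v) (hc : HasValue u v p f c) (hc0 : c ≠ 0) : f ≠ 0 := by
  rintro rfl
  exact hc0 (hc.unique h (HasValue.zero u v p))

theorem inv (h : IsChart u v) (hc : HasValue u v p f c) (hc0 : c ≠ 0) :
    HasValue u v p f⁻¹ c⁻¹ := by
  have hf := hc.ne_zero h hc0
  obtain ⟨N, M, h1, hM, hN⟩ := hc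
  refine ⟨M, N, ?_, ?_, ?_⟩
  · rw [← h1]
    field_simp
  · rw [hN]
    exact mul_ne_zero hc0 hM
  · rw [hN]
    field_simp

theorem div (h : IsChart u v) (hf : HasValue u v p f c) (hg : HasValue u v p g d) (hd : d ≠ 0) :
    HasValue u v p (f / g) (c / d) := by
  rw [div_eq_mul_inv, div_eq_mul_inv]
  exact hf.mul (hg.inv h hd)

/-- Regular functions may be rewritten in other coordinates. -/
theorem trans {u' v' : RatFun K} {p' : AlgebraicClosure K × AlgebraicClosure K}
    (hf : HasValue u' v' p' f c) (h : IsChart u v) (hu : HasValue u v p u' p'.1)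
    (hv : HasValue u v p v' p'.2) :
    HasValue u v p f c := by
  have key : ∀ A : MvPolynomial (Fin 2) K,
      HasValue u v p (MvPolynomial.aeval ![u', v'] A) (valueAt A p') := by
    intro A
    induction A using MvPolynomial.induction_on with
    | C k => simpa using HasValue.const u v p k
    | add A B hA hB => rw [map_add, valueAt_add]; exact hA.add hB
    | mul_X A i hA =>
      rw [map_mul, valueAt_mul]
      refine hA.mul ?_
      fin_cases i
      · simpa using hu
      · simpa using hv
  obtain ⟨N, M, h1, hM, hN⟩ := hf
  have h2 := (key N).div h (key M) hM
  rw [hN, mul_div_cancel_right₀ _ hM, ← h1,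
    mul_div_cancel_right₀ _ ((key M).ne_zero h hM)] at h2
  exact h2

/-- This is what makes points coordinate-free: if each pair of coordinates is regular at the other
point, with the right values, the two local rings and their evaluations coincide. -/
theorem place_eq {u' v' : RatFun K} {p' : AlgebraicClosure K × AlgebraicClosure K}
    (h : IsChart u v) (h' : IsChart u' v')
    (hu : HasValue u v p u' p'.1) (hv : HasValue u v p v' p'.2)
    (hu' : HasValue u' v' p' u p.1) (hv' : HasValue u' v' p' v p.2) :
    HasValue u v p = HasValue u' v' p' := by
  funext f c
  exact propext ⟨fun hf => hf.trans h' hu' hv', fun hf => hf.trans h hu hv⟩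

theorem place_swap (h : IsChart u v) (a b : AlgebraicClosure K) :
    HasValue u v (a, b) = HasValue v u (b, a) :=
  place_eq h h.symm (HasValue.snd u v _) (HasValue.fst u v _) (HasValue.snd v u _)
    (HasValue.fst v u _)

/-- Keeps the comparison constants in `blowup_change` inside `K`, so that rationality of base points
is independent of the coordinates. -/
theorem rational {a b : K} (hf : HasValue u v (algebraMap K _ a, algebraMap K _ b) f c) :
    ∃ k : K, c = algebraMap K _ k := by
  obtain ⟨N, M, -, hM, hN⟩ := hf
  rw [valueAt_rational] at hM hN
  rw [valueAt_rational] at hN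
  refine ⟨MvPolynomial.aeval ![a, b] N / MvPolynomial.aeval ![a, b] M, ?_⟩
  rw [map_div₀, hN]
  field_simp

end HasValue

/-- A rational function is indeterminate at a point if and only if neither it nor its inverse is
regular there. -/
theorem isIndeterminateAt_iff {u v f : RatFun K} {p} (h : IsChart u v) :
    IsIndeterminateAt u v f p ↔
      (∀ c, ¬ HasValue u v p f c) ∧ ∀ c, ¬ HasValue u v p f⁻¹ c := by
  have key : ∀ (N M : MvPolynomial (Fin 2) K) (f : RatFun K) c, IsRelPrime N M →
      f * aeval ![u, v] M = aeval ![u, v] N → valueAt M p = 0 → ¬ HasValue u v p f c := by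
    rintro N M f c hrel hf hM ⟨N', M', hf', hM', -⟩
    have h2 : N * M' = N' * M := h.injective (by
      rw [map_mul, map_mul, ← hf, ← hf']
      ring)
    -- In lowest terms `M` divides every other denominator, so every denominator vanishes where `M`
    -- does.
    obtain ⟨R, rfl⟩ : M ∣ M' := hrel.symm.dvd_of_dvd_mul_left ⟨N', by rw [h2, mul_comm]⟩
    rw [valueAt_mul, hM, zero_mul] at hM'
    exact hM' rfl
  constructor
  · rintro ⟨N, M, hM0, hrel, hf, hN, hM⟩
    refine ⟨fun c => key N M f c hrel hf hM, fun c => key M N f⁻¹ c hrel.symm ?_ hN⟩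
    have hN0 : N ≠ 0 := by
      rintro rfl
      have h1 : IsUnit M := isRelPrime_zero_left.1 hrel
      have h2 : IsUnit (valueAt M p) := h1.map (MvPolynomial.aeval ![p.1, p.2])
      exact h2.ne_zero hM
    have hf0 : f ≠ 0 := by
      rintro rfl
      rw [zero_mul] at hf
      exact h.aeval_ne_zero hN0 hf.symm
    rw [← hf]
    field_simp
  · rintro ⟨h1, h2⟩
    obtain ⟨N, M, hM0, hrel, hf⟩ := h.exists_reduced f
    have hM : valueAt M p = 0 := by
      by_contra hM
      exact h1 (valueAt N p / valueAt M p) ⟨N, M, hf, hM, by field_simp⟩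
    refine ⟨N, M, hM0, hrel, hf, ?_, hM⟩
    by_contra hN
    have hf0 : f ≠ 0 := by
      rintro rfl
      exact h1 0 (HasValue.zero u v p)
    exact h2 0 ⟨M, N, by rw [← hf]; field_simp, hN, by rw [hM, zero_mul]⟩

/-- A coordinate of a chart is not a product of two regular functions vanishing at the origin of
the coordinate. -/
theorem IsChart.fst_irreducible {u v : RatFun K} (h : IsChart u v) (b : AlgebraicClosure K)
    {f g : RatFun K} (hf : HasValue u v (0, b) f 0) (hg : HasValue u v (0, b) g 0) :
    f * g ≠ u := by
  rintro rfl
  set u := f * g with hu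
  obtain ⟨N, M, h1, hM, hN⟩ := hf
  obtain ⟨N', M', h1', hM', hN'⟩ := hg
  have h2 : N * N' = X 0 * (M * M') := h.injective (by
    rw [map_mul, map_mul, map_mul, ← h1, ← h1', aeval_X]
    simp only [Matrix.cons_val_zero]
    rw [hu]
    ring)
  -- Differentiate in the first coordinate at the point: the left side gives zero because both
  -- factors vanish there, the right side gives `M M'`, which does not vanish.
  have h3 := congrArg (fun A => valueAt (pderiv 0 A) (0, b)) h2
  simp only [Derivation.leibniz, pderiv_X_self, smul_eq_mul, valueAt_add, valueAt_mul, hN, hN',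
    zero_mul, valueAt_X_zero, mul_one, add_zero, zero_add] at h3
  exact mul_ne_zero hM hM' h3.symm

/-- A function in lowest terms over a power of the first coordinate is not regular where its
denominator vanishes. -/
theorem IsChart.not_hasValue {u v f A : RatFun K} (h : IsChart u v) {k : ℕ} (hk : k ≠ 0)
    {b b' d : AlgebraicClosure K} (hfA : f * u ^ k = A) (hd : d ≠ 0)
    (hA' : HasValue u v (0, b') A d) (c : AlgebraicClosure K) : ¬ HasValue u v (0, b) f c := by
  rintro ⟨N, M, h1, hM, -⟩
  obtain ⟨N', M', h1', hM', hN'⟩ := hA'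
  have h2 : X 0 ^ k * (N * M') = N' * M := h.injective (by
    simp only [map_mul, map_pow, aeval_X, Matrix.cons_val_zero, ← h1, ← h1', ← hfA]
    ring)
  -- The prime `X 0` would have to divide `N'`, which is nonzero at `(0, b')`, or `M`, which is
  -- nonzero at `(0, b)`.
  have hp : Prime (X 0 : MvPolynomial (Fin 2) K) := MvPolynomial.X_prime
  have h3 : (X 0 : MvPolynomial (Fin 2) K) ∣ N' * M := by
    rw [← h2]
    exact (dvd_pow_self _ hk).mul_right _
  rcases hp.dvd_or_dvd h3 with ⟨R, rfl⟩ | ⟨R, rfl⟩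
  · rw [valueAt_mul, valueAt_X_zero, zero_mul] at hN'
    exact mul_ne_zero hd hM' hN'.symm
  · rw [valueAt_mul, valueAt_X_zero, zero_mul] at hM
    exact hM rfl

/-- The numerator `A` vanishes at the point but not along the whole line `u = 0`, as the comparison
point `b'` shows. So `u` does not cancel from `A / u ^ k`, and both numerator and denominator
vanish. The pole order `k` is arbitrary, which serves the early blow-ups, where the poles are
multiple. -/
theorem IsChart.isIndeterminateAt {u v f A : RatFun K} (h : IsChart u v) {k : ℕ} (hk : k ≠ 0)
    {b b' d : AlgebraicClosure K} (hfA : f * u ^ k = A) (hA : HasValue u v (0, b) A 0)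
    (hd : d ≠ 0) (hA' : HasValue u v (0, b') A d) : IsIndeterminateAt u v f (0, b) := by
  rw [isIndeterminateAt_iff h]
  refine ⟨fun c => h.not_hasValue hk hfA hd hA' c, ?_⟩
  have hA0 := hA'.ne_zero h hd
  rintro c ⟨N, M, h1, hM, -⟩
  have hu := h.ne_zero_fst
  have hf0 : f ≠ 0 := by
    rintro rfl
    exact hA0 (by rw [← hfA, zero_mul])
  obtain ⟨N₁, M₁, h₁, hM₁, hN₁⟩ := hA
  obtain ⟨N', M', h1', hM', hN'⟩ := hA'
  rw [zero_mul] at hN₁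
  have h2 : X 0 ^ k * (M₁ * M) = N₁ * N := h.injective (by
    simp only [map_mul, map_pow, aeval_X, Matrix.cons_val_zero, ← h1, ← h₁, ← hfA]
    field_simp)
  have h3 : N₁ * M' = N' * M₁ := h.injective (by
    rw [map_mul, map_mul, ← h₁, ← h1']
    ring)
  have hp : Prime (X 0 : MvPolynomial (Fin 2) K) := MvPolynomial.X_prime
  have h4 : ¬ (X 0 : MvPolynomial (Fin 2) K) ∣ N₁ := by
    intro h4
    have h5 : (X 0 : MvPolynomial (Fin 2) K) ∣ N' * M₁ := h3 ▸ h4.mul_right _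
    rcases hp.dvd_or_dvd h5 with ⟨R, rfl⟩ | ⟨R, rfl⟩
    · rw [valueAt_mul, valueAt_X_zero, zero_mul] at hN'
      exact mul_ne_zero hd hM' hN'.symm
    · rw [valueAt_mul, valueAt_X_zero, zero_mul] at hM₁
      exact hM₁ rfl
  obtain ⟨R, rfl⟩ : X 0 ^ k ∣ N :=
    hp.pow_dvd_of_dvd_mul_left k h4 ⟨_, h2.symm⟩
  have h6 : M₁ * M = N₁ * R := by
    apply mul_left_cancel₀ (pow_ne_zero k hp.ne_zero)
    rw [h2]
    ring
  have h7 := congrArg (fun A => valueAt A (0, b)) h6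
  simp only [valueAt_mul, hN₁, zero_mul] at h7
  exact mul_ne_zero hM₁ hM h7

end Values

set_option linter.unusedSectionVars false

/-! ### Regular, polar and indeterminate places of a derivation. -/

section Places

variable {K : Type} [Field K] [Algebra ℂ K]

/-- The derivation `D` preserves the field of coefficients. -/
def PreservesConstants (D : Derivation ℂ (RatFun K) (RatFun K)) : Prop :=
  ∀ k : K, ∃ k' : K, D (algebraMap K _ k) = algebraMap K _ k'

/-- All regular functions at a place have regular derivatives. -/
def RegularPlace (D : Derivation ℂ (RatFun K) (RatFun K))
    (V : RatFun K → AlgebraicClosure K → Prop) : Prop :=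
  ∀ f c, V f c → ∃ d, V (D f) d

/-- The derivation has a pole at the place, in every system of coordinates. -/
def PolarPlace (D : Derivation ℂ (RatFun K) (RatFun K))
    (V : RatFun K → AlgebraicClosure K → Prop) : Prop :=
  ∃ g, V g 0 ∧ (∀ f c, V f c → ∃ d, V (g * D f) d) ∧
    ∃ f c, V f c ∧ ∃ d, d ≠ 0 ∧ V (g * D f) d

/-- The derivative of `f` has a pole at the place, also after `f` is multiplied by a unit. -/
def PolarAlong (D : Derivation ℂ (RatFun K) (RatFun K))
    (V : RatFun K → AlgebraicClosure K → Prop) (f : RatFun K) : Prop :=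
  ∃ g, V g 0 ∧ (∃ d, d ≠ 0 ∧ V (g * D f) d) ∧ ∀ h c, V h c → V (f * g * D h) 0

/-- The derivation is indeterminate at the place, in every system of coordinates. -/
def BasePlace (D : Derivation ℂ (RatFun K) (RatFun K))
    (V : RatFun K → AlgebraicClosure K → Prop) : Prop :=
  ∃ e, (∀ f g, V f 0 → V g 0 → f * g ≠ e) ∧ (∀ f c, V f c → V (e * D f) 0) ∧
    ∃ f c, V f c ∧ ∀ d, ¬ V (D f) d

variable {D : Derivation ℂ (RatFun K) (RatFun K)} {u v : RatFun K}
  {p : AlgebraicClosure K × AlgebraicClosure K}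

/-- If `I` is closed under addition and under multiplication by the local ring, the product rule
settles polynomials in `u, v` and the quotient rule settles fractions. The choices of `I` used below
are the local ring and its maximal ideal. -/
theorem deriv_mem_of_coordinates (hD : PreservesConstants D) (h : IsChart u v)
    {I : RatFun K → Prop} (hadd : ∀ f g, I f → I g → I (f + g))
    (hmul : ∀ f g c, HasValue u v p f c → I g → I (f * g)) {g : RatFun K} (hg : I g)
    (hu : I (g * D u)) (hv : I (g * D v)) {f : RatFun K} {c} (hf : HasValue u v p f c) :
    I (g * D f) := by
  have key : ∀ A : MvPolynomial (Fin 2) K, I (g * D (aeval ![u, v] A)) := by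
    intro A
    induction A using MvPolynomial.induction_on with
    | C k =>
      obtain ⟨k', hk⟩ := hD k
      have h1 : aeval ![u, v] (C k) = algebraMap K (RatFun K) k := by simp
      rw [h1, hk, mul_comm]
      exact hmul _ _ _ (HasValue.const u v p k') hg
    | add A B hA hB =>
      rw [map_add, map_add, mul_add]
      exact hadd _ _ hA hB
    | mul_X A i hA =>
      have hX : I (g * D (![u, v] i)) := by
        fin_cases i
        · exact hu
        · exact hv
      rw [map_mul, aeval_X, Derivation.leibniz, smul_eq_mul, smul_eq_mul, mul_add]
      refine hadd _ _ ?_ ?_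
      · rw [mul_left_comm]
        exact hmul _ _ _ (HasValue.aeval u v p A) hX
      · rw [mul_left_comm, ← aeval_X (R := K) ![u, v] i]
        exact hmul _ _ _ (HasValue.aeval u v p (X i)) hA
  obtain ⟨N, M, h1, hM, -⟩ := id hf
  have hM1 := HasValue.aeval u v p M
  have hM0 := hM1.ne_zero h hM
  have h2 : g * D f = (aeval ![u, v] M)⁻¹ * (g * D (aeval ![u, v] N))
      + (-(aeval ![u, v] M)⁻¹ * f) * (g * D (aeval ![u, v] M)) := by
    have h3 := congrArg D h1
    rw [Derivation.leibniz, smul_eq_mul, smul_eq_mul] at h3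
    rw [← h3]
    field_simp
    ring
  rw [h2]
  exact hadd _ _ (hmul _ _ _ (hM1.inv h hM) (key N))
    (hmul _ _ _ ((hM1.inv h hM).neg.mul hf) (key M))

theorem deriv_regular (hD : PreservesConstants D) (h : IsChart u v) {g : RatFun K} {γ a b}
    (hg : HasValue u v p g γ) (hu : HasValue u v p (g * D u) a)
    (hv : HasValue u v p (g * D v) b) {f : RatFun K} {c} (hf : HasValue u v p f c) :
    ∃ d, HasValue u v p (g * D f) d :=
  deriv_mem_of_coordinates hD h (I := fun f => ∃ d, HasValue u v p f d)
    (fun _ _ ⟨_, h₁⟩ ⟨_, h₂⟩ => ⟨_, h₁.add h₂⟩) (fun _ _ _ h₁ ⟨_, h₂⟩ => ⟨_, h₁.mul h₂⟩)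
    ⟨_, hg⟩ ⟨_, hu⟩ ⟨_, hv⟩ hf

theorem deriv_vanishes (hD : PreservesConstants D) (h : IsChart u v) {g : RatFun K}
    (hg : HasValue u v p g 0) (hu : HasValue u v p (g * D u) 0)
    (hv : HasValue u v p (g * D v) 0) {f : RatFun K} {c} (hf : HasValue u v p f c) :
    HasValue u v p (g * D f) 0 :=
  deriv_mem_of_coordinates hD h (I := fun f => HasValue u v p f 0)
    (fun _ _ h₁ h₂ => (h₁.add h₂).congr_value (add_zero 0))
    (fun _ _ _ h₁ h₂ => (h₁.mul h₂).congr_value (mul_zero _))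
    hg hu hv hf

theorem regularPlace_of (hD : PreservesConstants D) (h : IsChart u v) {a b}
    (hu : HasValue u v p (D u) a) (hv : HasValue u v p (D v) b) :
    RegularPlace D (HasValue u v p) := by
  intro f c hf
  simpa using deriv_regular hD h (g := 1) (HasValue.one u v p) (by simpa using hu)
    (by simpa using hv) hf

theorem RegularPlace.isRegularSystemAt (hV : RegularPlace D (HasValue u v p)) :
    IsRegularSystemAt D u v p :=
  ⟨isRegularAt_iff.2 (hV _ _ (HasValue.fst u v p)), isRegularAt_iff.2 (hV _ _ (HasValue.snd u v p))⟩

theorem polarPlace_of_snd (hD : PreservesConstants D) (h : IsChart u v) {g : RatFun K} {a b}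
    (hg : HasValue u v p g 0) (hu : HasValue u v p (g * D u) a)
    (hv : HasValue u v p (g * D v) b) (hb : b ≠ 0) : PolarPlace D (HasValue u v p) :=
  ⟨g, hg, fun _ _ hf => deriv_regular hD h hg hu hv hf, v, p.2, HasValue.snd u v p, b, hb, hv⟩

/-- A vanishing multiplier with nonzero product exhibits `f` as `c/0`: the inverse of `f` is regular
with value zero, which excludes both regularity and indeterminacy. -/
theorem not_hasValue_of_pole (h : IsChart u v) {f g : RatFun K} {d}
    (hg : HasValue u v p g 0) (hd : d ≠ 0) (hf : HasValue u v p (g * f) d) :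
    (∀ c, ¬ HasValue u v p f c) ∧ HasValue u v p f⁻¹ 0 := by
  refine ⟨fun c hc => hd (hf.unique h ((hg.mul hc).congr_value (zero_mul c))), ?_⟩
  have h1 := (hg.div h hf hd).congr_value (zero_div d)
  have h2 : g / (g * f) = f⁻¹ := by
    have h3 := hf.ne_zero h hd
    have h4 := left_ne_zero_of_mul h3
    field_simp
  rwa [h2] at h1

theorem not_isRegularAt_or_isIndeterminateAt (h : IsChart u v) {f g : RatFun K} {d}
    (hg : HasValue u v p g 0) (hd : d ≠ 0) (hf : HasValue u v p (g * f) d) :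
    ¬ (IsRegularAt u v f p ∨ IsIndeterminateAt u v f p) := by
  obtain ⟨h1, h2⟩ := not_hasValue_of_pole h hg hd hf
  rintro (h3 | h3)
  · obtain ⟨c, hc⟩ := isRegularAt_iff.1 h3
    exact h1 c hc
  · exact ((isIndeterminateAt_iff h).1 h3).2 0 h2

theorem not_isBasePoint_of_fst (h : IsChart u v) {g : RatFun K} {d}
    (hg : HasValue u v p g 0) (hd : d ≠ 0) (hf : HasValue u v p (g * D u) d) :
    ¬ IsBasePoint D u v p :=
  fun hb => not_isRegularAt_or_isIndeterminateAt h hg hd hf hb.2.1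

theorem not_isBasePoint_of_snd (h : IsChart u v) {g : RatFun K} {d}
    (hg : HasValue u v p g 0) (hd : d ≠ 0) (hf : HasValue u v p (g * D v) d) :
    ¬ IsBasePoint D u v p :=
  fun hb => not_isRegularAt_or_isIndeterminateAt h hg hd hf hb.2.2

theorem IsRegularAt.not_isIndeterminateAt (h : IsChart u v) {f : RatFun K}
    (hf : IsRegularAt u v f p) : ¬ IsIndeterminateAt u v f p := by
  obtain ⟨c, hc⟩ := isRegularAt_iff.1 hf
  exact fun h1 => ((isIndeterminateAt_iff h).1 h1).1 c hc

theorem IsRegularSystemAt.not_isBasePoint (h : IsChart u v) (hr : IsRegularSystemAt D u v p) :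
    ¬ IsBasePoint D u v p := by
  rintro ⟨h1 | h1, -⟩
  exacts [hr.1.not_isIndeterminateAt h h1, hr.2.not_isIndeterminateAt h h1]

theorem RegularPlace.not_isBasePoint (h : IsChart u v) (hV : RegularPlace D (HasValue u v p)) :
    ¬ IsBasePoint D u v p := hV.isRegularSystemAt.not_isBasePoint h

/-- If `g * D u` and `g * D v` both vanished at the place, then `g * D f` would vanish for every
regular `f`. So the pole is visible in at least one coordinate of any chart. -/
theorem PolarPlace.exists_coordinate (hD : PreservesConstants D) (h : IsChart u v)
    (hV : PolarPlace D (HasValue u v p)) : ∃ g, HasValue u v p g 0 ∧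
      ((∃ d, d ≠ 0 ∧ HasValue u v p (g * D u) d) ∨ ∃ d, d ≠ 0 ∧ HasValue u v p (g * D v) d) := by
  obtain ⟨g, hg, hreg, f, c, hf, d, hd, hfd⟩ := hV
  refine ⟨g, hg, ?_⟩
  obtain ⟨a, ha⟩ := hreg _ _ (HasValue.fst u v p)
  obtain ⟨b, hb⟩ := hreg _ _ (HasValue.snd u v p)
  by_cases ha0 : a = 0
  · by_cases hb0 : b = 0
    · subst ha0 hb0
      exact (hd (hfd.unique h (deriv_vanishes hD h hg ha hb hf))).elim
    · exact Or.inr ⟨b, hb0, hb⟩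
  · exact Or.inl ⟨a, ha0, ha⟩

theorem PolarPlace.not_isBasePoint (hD : PreservesConstants D) (h : IsChart u v)
    (hV : PolarPlace D (HasValue u v p)) : ¬ IsBasePoint D u v p := by
  obtain ⟨g, hg, ⟨d, hd, h1⟩ | ⟨d, hd, h1⟩⟩ := hV.exists_coordinate hD h
  exacts [not_isBasePoint_of_fst h hg hd h1, not_isBasePoint_of_snd h hg hd h1]

theorem PolarPlace.not_isRegularSystemAt (hD : PreservesConstants D) (h : IsChart u v)
    (hV : PolarPlace D (HasValue u v p)) : ¬ IsRegularSystemAt D u v p := by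
  obtain ⟨g, hg, ⟨d, hd, h1⟩ | ⟨d, hd, h1⟩⟩ := hV.exists_coordinate hD h
  · exact fun h2 => not_isRegularAt_or_isIndeterminateAt h hg hd h1 (Or.inl h2.1)
  · exact fun h2 => not_isRegularAt_or_isIndeterminateAt h hg hd h1 (Or.inl h2.2)

/-- The function `e` is not a product of two functions vanishing at the place, and `e * D t` always
vanishes. If `D t` were `c/0`, then `e = (e * D t) * (D t)⁻¹` would be such a product; so each
component is regular or `0/0`. Both cannot be regular, since some `D f` is not. -/
theorem BasePlace.isBasePoint (hD : PreservesConstants D) (h : IsChart u v)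
    (hV : BasePlace D (HasValue u v p)) : IsBasePoint D u v p := by
  obtain ⟨e, he, hvan, f, c, hf, hnot⟩ := hV
  have key : ∀ t c, HasValue u v p t c → IsRegularAt u v (D t) p ∨
      IsIndeterminateAt u v (D t) p := by
    intro t c ht
    by_cases h1 : IsRegularAt u v (D t) p
    · exact Or.inl h1
    · refine Or.inr ((isIndeterminateAt_iff h).2 ⟨fun d hd => h1 (isRegularAt_iff.2 ⟨d, hd⟩), ?_⟩)
      intro d hd
      have hDt : D t ≠ 0 := fun h0 => h1 (isRegularAt_iff.2 ⟨0, h0 ▸ HasValue.zero u v p⟩)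
      by_cases hd0 : d = 0
      · subst hd0
        exact he _ _ (hvan _ _ ht) hd (by field_simp)
      · exact h1 (isRegularAt_iff.2 ⟨_, by simpa using hd.inv h hd0⟩)
  have hu := key _ _ (HasValue.fst u v p)
  have hv := key _ _ (HasValue.snd u v p)
  refine ⟨?_, hu, hv⟩
  by_contra hc
  rw [not_or] at hc
  obtain ⟨a, ha⟩ := isRegularAt_iff.1 (hu.resolve_right hc.1)
  obtain ⟨b, hb⟩ := isRegularAt_iff.1 (hv.resolve_right hc.2)
  obtain ⟨d, hd⟩ := regularPlace_of hD h ha hb f c hf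
  exact hnot d hd

/-- A pole of order one along `u = 0` with vanishing numerators, one of them not identically zero
along `u = 0`. -/
theorem basePlace_of (hD : PreservesConstants D) (h : IsChart u v) {b b' d : AlgebraicClosure K}
    (hu : HasValue u v (0, b) (u * D u) 0) (hv : HasValue u v (0, b) (u * D v) 0) (hd : d ≠ 0)
    (hv' : HasValue u v (0, b') (u * D v) d) : BasePlace D (HasValue u v (0, b)) :=
  ⟨u, fun _ _ hf hg => h.fst_irreducible b hf hg,
    fun _ _ hf => deriv_vanishes hD h (HasValue.fst u v _) hu hv hf, v, b, HasValue.snd u v _,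
    fun d' => h.not_hasValue one_ne_zero (by rw [pow_one, mul_comm]) hd hv' d'⟩

theorem polarAlong_of_fst (hD : PreservesConstants D) (h : IsChart u v) {g : RatFun K} {a}
    {b : AlgebraicClosure K} (hg : HasValue u v (0, b) g 0)
    (hu : HasValue u v (0, b) (g * D u) a) (ha : a ≠ 0)
    (hv : HasValue u v (0, b) (u * g * D v) 0) :
    PolarAlong D (HasValue u v (0, b)) u := by
  have h0 := HasValue.fst u v (0, b)
  refine ⟨g, hg, ⟨a, ha, hu⟩, fun f c hf => deriv_vanishes hD h ?_ ?_ hv hf⟩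
  · exact (h0.mul hg).congr_value (mul_zero _)
  · rw [mul_assoc]
    exact (h0.mul hu).congr_value (zero_mul _)

/-- In `g * D (η * f) = η * (g * D f) + f * g * D η` the last term vanishes at the place, so the
pole survives with leading value multiplied by that of `η`. -/
theorem PolarAlong.unit_mul {f η : RatFun K} {c}
    (hV : PolarAlong D (HasValue u v p) f) (hη : HasValue u v p η c) (hc : c ≠ 0) :
    ∃ g, HasValue u v p g 0 ∧ ∃ d, d ≠ 0 ∧ HasValue u v p (g * D (η * f)) d := by
  obtain ⟨g, hg, ⟨d, hd, h1⟩, h2⟩ := hV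
  refine ⟨g, hg, c * d, mul_ne_zero hc hd, ?_⟩
  have h3 : g * D (η * f) = η * (g * D f) + f * g * D η := by
    rw [Derivation.leibniz, smul_eq_mul, smul_eq_mul]
    ring
  rw [h3]
  exact ((hη.mul h1).add (h2 _ _ hη)).congr_value (add_zero _)

theorem IsRegularAt.swap (h : IsChart u v) {f : RatFun K} {a b} :
    IsRegularAt u v f (a, b) ↔ IsRegularAt v u f (b, a) := by
  rw [isRegularAt_iff, isRegularAt_iff, HasValue.place_swap h]

theorem IsIndeterminateAt.swap (h : IsChart u v) {f : RatFun K} {a b} :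
    IsIndeterminateAt u v f (a, b) ↔ IsIndeterminateAt v u f (b, a) := by
  rw [isIndeterminateAt_iff h, isIndeterminateAt_iff h.symm, HasValue.place_swap h]

theorem IsBasePoint.swap (h : IsChart u v) {a b} :
    IsBasePoint D u v (a, b) ↔ IsBasePoint D v u (b, a) := by
  unfold IsBasePoint
  rw [IsRegularAt.swap h, IsRegularAt.swap h, IsIndeterminateAt.swap h, IsIndeterminateAt.swap h]
  tauto

theorem IsRegularSystemAt.swap (h : IsChart u v) {a b} :
    IsRegularSystemAt D u v (a, b) ↔ IsRegularSystemAt D v u (b, a) := by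
  unfold IsRegularSystemAt
  rw [IsRegularAt.swap h, IsRegularAt.swap h]
  tauto

theorem IsChart.blowup_fst (h : IsChart u v) (a b : K) :
    IsChart (blowupFst u v a b).1 (blowupFst u v a b).2 := by
  have h0 : u - algebraMap K _ a ≠ 0 := sub_ne_zero.2 (h.fst_ne_const a)
  set F := IntermediateField.adjoin K {(blowupFst u v a b).1, (blowupFst u v a b).2} with hF
  have h1 : u - algebraMap K _ a ∈ F := IntermediateField.subset_adjoin _ _ (Or.inl rfl)
  have h2 : (v - algebraMap K _ b) / (u - algebraMap K _ a) ∈ F :=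
    IntermediateField.subset_adjoin _ _ (Or.inr rfl)
  have h3 : v - algebraMap K _ b ∈ F := by
    have h3 := mul_mem h2 h1
    rwa [div_mul_cancel₀ _ h0] at h3
  refine h.of_mem ?_ ?_
  · simpa using add_mem h1 (F.algebraMap_mem a)
  · simpa using add_mem h3 (F.algebraMap_mem b)

theorem IsChart.blowup_snd (h : IsChart u v) (a b : K) :
    IsChart (blowupSnd u v a b).1 (blowupSnd u v a b).2 :=
  (h.symm.blowup_fst b a).symm

/-- Exchanging the coordinates exchanges the two charts of every blow-up. This matters because
computations keep the exceptional curve as the first coordinate, whereas the second charts have it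
as the second. -/
theorem CascadesRegularised.swap {a b : K} (hc : CascadesRegularised D u v a b)
    (h : IsChart u v) : CascadesRegularised D v u b a := by
  induction hc with
  | blowup u v a b rf rs nf ns fin ihf ihs =>
    have hf := h.blowup_fst a b
    have hs := h.blowup_snd a b
    refine CascadesRegularised.blowup v u b a (fun t ht => rs t ?_) (fun t ht => rf t ?_)
      (fun s hs' => ihs s ?_ hs) (fun s hs' => ihf s ?_ hf) ?_
    · exact (IsBasePoint.swap hs).2 ht
    · exact (IsBasePoint.swap hf).2 ht
    · exact (IsBasePoint.swap hs).2 hs'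
    · exact (IsBasePoint.swap hf).2 hs'
    · rintro ⟨h1, h2⟩
      rcases fin ⟨fun t ht => h2 t ((IsBasePoint.swap hf).1 ht),
        fun t ht => h1 t ((IsBasePoint.swap hs).1 ht)⟩ with h3 | h3
      · exact Or.inr fun t => (IsRegularSystemAt.swap hf).1 (h3 t)
      · exact Or.inl fun t => (IsRegularSystemAt.swap hs).1 (h3 t)

end Places

set_option linter.unusedSectionVars false

/-! ### Blow-ups of rational places and their independence of coordinates. -/

section BlowUps

variable {K : Type} [Field K] [Algebra ℂ K]

theorem exists_expansion (A : MvPolynomial (Fin 2) K) (b : K) :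
    ∃ P Q, A = C (aeval ![0, b] A) + X 0 * P + (X 1 - C b) * Q := by
  induction A using MvPolynomial.induction_on with
  | C k => exact ⟨0, 0, by simp⟩
  | add A B hA hB =>
    obtain ⟨P, Q, h⟩ := hA
    obtain ⟨P', Q', h'⟩ := hB
    refine ⟨P + P', Q + Q', ?_⟩
    rw [map_add, map_add]
    linear_combination h + h'
  | mul_X A i hA =>
    obtain ⟨P, Q, h⟩ := hA
    fin_cases i
    · refine ⟨A, 0, ?_⟩
      simp [mul_comm]
    · refine ⟨P * X 1, C (aeval ![0, b] A) + Q * X 1, ?_⟩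
      simp only [Fin.mk_one, map_mul, aeval_X, Matrix.cons_val_one, Matrix.cons_val_zero]
      linear_combination X 1 * h

variable {e v e' v' η : RatFun K} {b b' : K}

/-- A regular function vanishing at a rational point is a combination of the coordinates. -/
theorem HasValue.exists_combination (h : IsChart e v) {f : RatFun K}
    (hf : HasValue e v (0, algebraMap K _ b) f 0) : ∃ α β a c,
      HasValue e v (0, algebraMap K _ b) α a ∧ HasValue e v (0, algebraMap K _ b) β c ∧
      f = α * e + β * (v - algebraMap K _ b) := by
  obtain ⟨N, M, h1, hM, hN⟩ := hf
  rw [zero_mul, show (0 : AlgebraicClosure K) = algebraMap K _ 0 from (map_zero _).symm,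
    valueAt_rational] at hN
  replace hN := (algebraMap K (AlgebraicClosure K)).injective hN
  obtain ⟨P, Q, hPQ⟩ := exists_expansion N b
  rw [hN, C_0, zero_add] at hPQ
  have hM1 := HasValue.aeval e v (0, algebraMap K _ b) M
  have hM0 := hM1.ne_zero h hM
  refine ⟨_, _, _, _, (HasValue.aeval e v _ P).div h hM1 hM, (HasValue.aeval e v _ Q).div h hM1 hM,
    ?_⟩
  rw [hPQ] at h1
  simp only [map_add, map_mul, map_sub, aeval_X, aeval_C, Matrix.cons_val_zero,
    Matrix.cons_val_one] at h1
  field_simp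
  rw [h1]
  ring

/-- Differentiation in the second coordinate at the point kills every multiple of the first
coordinate, but not `v - b`. -/
theorem IsChart.snd_not_multiple (h : IsChart e v) {g : RatFun K} {c : AlgebraicClosure K}
    (hg : HasValue e v (0, algebraMap K _ b) g c) : g * e ≠ v - algebraMap K _ b := by
  intro h0
  obtain ⟨N, M, h1, hM, -⟩ := hg
  have h2 : N * X 0 = (X 1 - C b) * M := h.injective (by
    simp only [map_mul, map_sub, aeval_X, aeval_C, Matrix.cons_val_zero, Matrix.cons_val_one,
      ← h1, ← h0]
    ring)
  have h3 := congrArg (fun A => valueAt (pderiv 1 A) (0, algebraMap K _ b)) h2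
  have h4 : ∀ k : K, valueAt (pderiv 1 (C k : MvPolynomial (Fin 2) K)) (0, algebraMap K _ b) = 0 := by
    intro k
    rw [pderiv_C, valueAt_zero]
  have h5 : pderiv 1 (X 0 : MvPolynomial (Fin 2) K) = 0 := pderiv_X_of_ne (by decide)
  simp only [Derivation.leibniz, pderiv_X_self, smul_eq_mul, valueAt_add, valueAt_mul,
    sub_eq_add_neg, valueAt_neg, valueAt_X_zero, valueAt_X_one, valueAt_C, pderiv_C, h5,
    valueAt_zero, valueAt_one, map_add, map_neg, neg_zero] at h3
  simp at h3
  exact hM h3.symm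

theorem IsChart.fst_div (h : IsChart e v) (b : K) : IsChart e ((v - algebraMap K _ b) / e) := by
  simpa [blowupFst] using h.blowup_fst 0 b

theorem IsChart.div_snd (h : IsChart e v) (b : K) :
    IsChart (e / (v - algebraMap K _ b)) (v - algebraMap K _ b) := by
  simpa [blowupSnd] using h.blowup_snd 0 b

/-- The places on an exceptional curve dominate the place that is blown up. -/
theorem HasValue.lift_fst (h : IsChart e v) {f : RatFun K} {c}
    (hf : HasValue e v (0, algebraMap K _ b) f c) (t : AlgebraicClosure K) :
    HasValue e ((v - algebraMap K _ b) / e) (0, t) f c := by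
  have he := HasValue.fst e ((v - algebraMap K _ b) / e) (0, t)
  refine hf.trans (h.fst_div b) he ?_
  have h1 := (he.mul (HasValue.snd e ((v - algebraMap K _ b) / e) (0, t))).add
    (HasValue.const _ _ _ b)
  have h0 := h.ne_zero_fst
  have h2 : e * ((v - algebraMap K _ b) / e) + algebraMap K _ b = v := by
    field_simp
    ring
  rw [h2] at h1
  exact h1.congr_value (by simp)

theorem HasValue.lift_snd (h : IsChart e v) {f : RatFun K} {c}
    (hf : HasValue e v (0, algebraMap K _ b) f c) (t : AlgebraicClosure K) :
    HasValue (e / (v - algebraMap K _ b)) (v - algebraMap K _ b) (t, 0) f c := by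
  have hv := HasValue.snd (e / (v - algebraMap K _ b)) (v - algebraMap K _ b) (t, 0)
  have h0 := sub_ne_zero.2 (h.snd_ne_const b)
  refine hf.trans (h.div_snd b) ?_ ?_
  · have h1 := (HasValue.fst (e / (v - algebraMap K _ b)) (v - algebraMap K _ b) (t, 0)).mul hv
    rw [div_mul_cancel₀ _ h0] at h1
    exact h1.congr_value (by simp)
  · have h1 := hv.add (HasValue.const _ _ _ b)
    rw [sub_add_cancel] at h1
    exact h1.congr_value (by simp)

/-- The two charts of a blow-up overlap off their origins through `t ↦ t⁻¹`; hence only the origin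
of the second chart needs separate treatment. -/
theorem place_overlap (h : IsChart e v) (b : K) {t : AlgebraicClosure K} (ht : t ≠ 0) :
    HasValue (e / (v - algebraMap K _ b)) (v - algebraMap K _ b) (t, 0) =
      HasValue e ((v - algebraMap K _ b) / e) (0, t⁻¹) := by
  have h0 := sub_ne_zero.2 (h.snd_ne_const b)
  have he := h.ne_zero_fst
  have hs := h.div_snd b
  have hf := h.fst_div b
  refine HasValue.place_eq hs hf ?_ ?_ ?_ ?_
  · have h1 := (HasValue.fst _ _ (t, 0)).mul
      (HasValue.snd (e / (v - algebraMap K _ b)) (v - algebraMap K _ b) (t, 0))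
    rw [div_mul_cancel₀ _ h0] at h1
    exact h1.congr_value (by simp)
  · have h1 := (HasValue.fst (e / (v - algebraMap K _ b)) (v - algebraMap K _ b) (t, 0)).inv hs ht
    rwa [inv_div] at h1
  · have h1 := (HasValue.snd e ((v - algebraMap K _ b) / e) (0, t⁻¹)).inv hf (inv_ne_zero ht)
    rwa [inv_div, inv_inv] at h1
  · have h1 := (HasValue.fst _ _ (0, t⁻¹)).mul
      (HasValue.snd e ((v - algebraMap K _ b) / e) (0, t⁻¹))
    rw [mul_div_cancel₀ _ he] at h1
    exact h1.congr_value (by simp)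

/-- Blowing up a rational place in two systems of coordinates which share their first coordinate
up to a unit: the places on the exceptional curve correspond to each other. -/
theorem blowup_change (h : IsChart e v) (h' : IsChart e' v')
    (hV : HasValue e' v' (0, algebraMap K _ b') = HasValue e v (0, algebraMap K _ b))
    (he : e' = η * e) {c : AlgebraicClosure K} (hη : HasValue e v (0, algebraMap K _ b) η c)
    (hc : c ≠ 0) :
    (∃ k l : K, l ≠ 0 ∧ ∀ t, HasValue e' ((v' - algebraMap K _ b') / e')
        (0, algebraMap K _ k + algebraMap K _ l * t) =
      HasValue e ((v - algebraMap K _ b) / e) (0, t)) ∧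
    HasValue (e' / (v' - algebraMap K _ b')) (v' - algebraMap K _ b') (0, 0) =
      HasValue (e / (v - algebraMap K _ b)) (v - algebraMap K _ b) (0, 0) ∧
    (∃ g d, d ≠ 0 ∧ HasValue (e / (v - algebraMap K _ b)) (v - algebraMap K _ b) (0, 0) g d ∧
      e' / (v' - algebraMap K _ b') = g * (e / (v - algebraMap K _ b))) ∧
    ∃ g d, d ≠ 0 ∧ HasValue (e / (v - algebraMap K _ b)) (v - algebraMap K _ b) (0, 0) g d ∧
      v' - algebraMap K _ b' = g * (v - algebraMap K _ b) := by
  have hz : ∀ {f c}, HasValue e v (0, algebraMap K _ b) f c →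
      ∃ k : K, c = algebraMap K _ k := by
    intro f c hf
    refine HasValue.rational (a := 0) (b := b) (u := e) (v := v) (f := f) ?_
    rwa [map_zero]
  have hw : HasValue e v (0, algebraMap K _ b) (v' - algebraMap K _ b') 0 := by
    rw [← hV]
    exact ((HasValue.snd _ _ _).sub (HasValue.const _ _ _ b')).congr_value (sub_self _)
  obtain ⟨α, β, α₀, β₀, hα, hβ, hαβ⟩ := hw.exists_combination h
  -- If `β` vanished at the place, expressing `v - b` back through `e'` and `v' - b'` would give `(1
  -- - β' β) (v - b)` as a multiple of `e`; as `1 - β' β` is a unit, `v - b` itself would be one.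
  have hβ0 : β₀ ≠ 0 := by
    rintro rfl
    have hw' : HasValue e' v' (0, algebraMap K _ b') (v - algebraMap K _ b) 0 := by
      rw [hV]
      exact ((HasValue.snd _ _ _).sub (HasValue.const _ _ _ b)).congr_value (sub_self _)
    obtain ⟨α', β', α₁, β₁, hα', hβ', hαβ'⟩ := hw'.exists_combination h'
    rw [hV] at hα' hβ'
    have h1 := ((HasValue.one e v (0, algebraMap K _ b)).sub (hβ'.mul hβ)).congr_value
      (show (1 : AlgebraicClosure K) - β₁ * 0 = 1 by ring)
    have h2 := ((hα'.mul hη).add (hβ'.mul hα)).div h h1 one_ne_zero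
    refine h.snd_not_multiple h2 ?_
    have h3 := h1.ne_zero h one_ne_zero
    rw [hαβ, he] at hαβ'
    field_simp
    linear_combination -hαβ'
  obtain ⟨a₀, rfl⟩ := hz hα
  obtain ⟨l₀, rfl⟩ := hz hβ
  obtain ⟨c₀, rfl⟩ := hz hη
  have hl0 : l₀ ≠ 0 := fun h0 => hβ0 (by rw [h0, map_zero])
  have hc0 : c₀ ≠ 0 := fun h0 => hc (by rw [h0, map_zero])
  have hη0 := hη.ne_zero h hc
  have hβn := hβ.ne_zero h hβ0
  have he0 := h.ne_zero_fst
  have hv0 := sub_ne_zero.2 (h.snd_ne_const b)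
  have he0' := h'.ne_zero_fst
  have hv0' := sub_ne_zero.2 (h'.snd_ne_const b')
  have hf := h.fst_div b
  have hf' := h'.fst_div b'
  have hs := h.div_snd b
  have hs' := h'.div_snd b'
  have hα' := hα
  have hβ' := hβ
  have hη' := hη
  rw [← hV] at hα' hβ' hη'
  -- On the exceptional curve `(v' - b') / e' = (α + β (v - b) / e) / η`, so its parameter changes
  -- by the affine map with these coefficients, and infinity stays at infinity.
  refine ⟨⟨a₀ / c₀, l₀ / c₀, div_ne_zero hl0 hc0, fun t => ?_⟩, ?_, ?_, ?_⟩
  · refine HasValue.place_eq hf' hf ?_ ?_ ?_ ?_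
    · have h1 := (HasValue.fst e' ((v' - algebraMap K _ b') / e')
        (0, algebraMap K _ (a₀ / c₀) + algebraMap K _ (l₀ / c₀) * t)).mul
        ((hη'.lift_fst h' _).inv hf' hc)
      have h2 : e' * η⁻¹ = e := by
        rw [he]
        field_simp
      rw [h2] at h1
      exact h1.congr_value (zero_mul _)
    · have h1 := (((HasValue.snd e' ((v' - algebraMap K _ b') / e')
        (0, algebraMap K _ (a₀ / c₀) + algebraMap K _ (l₀ / c₀) * t)).mul (hη'.lift_fst h' _)).sub
        (hα'.lift_fst h' _)).div hf' (hβ'.lift_fst h' _) hβ0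
      have h2 : ((v' - algebraMap K _ b') / e' * η - α) / β = (v - algebraMap K _ b) / e := by
        rw [hαβ, he]
        field_simp
        ring
      rw [h2] at h1
      refine h1.congr_value ?_
      simp only [map_div₀]
      field_simp
      ring
    · have h1 := (hη.lift_fst h t).mul (HasValue.fst e ((v - algebraMap K _ b) / e) (0, t))
      rw [← he] at h1
      exact h1.congr_value (mul_zero _)
    · have h1 := ((hα.lift_fst h t).add ((hβ.lift_fst h t).mul
        (HasValue.snd e ((v - algebraMap K _ b) / e) (0, t)))).div hf (hη.lift_fst h t) hc
      have h2 : (α + β * ((v - algebraMap K _ b) / e)) / η = (v' - algebraMap K _ b') / e' := by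
        rw [hαβ, he]
        field_simp
      rw [h2] at h1
      refine h1.congr_value ?_
      simp only [map_div₀]
      field_simp
  all_goals
    have hα₁ := hα.lift_snd h 0
    have hβ₁ := hβ.lift_snd h 0
    have hη₁ := hη.lift_snd h 0
    have hα₂ := hα'.lift_snd h' 0
    have hβ₂ := hβ'.lift_snd h' 0
    have hη₂ := hη'.lift_snd h' 0
    have hσ := HasValue.fst (e / (v - algebraMap K _ b)) (v - algebraMap K _ b) (0, 0)
    have hr := HasValue.snd (e / (v - algebraMap K _ b)) (v - algebraMap K _ b) (0, 0)
    have hσ' := HasValue.fst (e' / (v' - algebraMap K _ b')) (v' - algebraMap K _ b') (0, 0)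
    have hr' := HasValue.snd (e' / (v' - algebraMap K _ b')) (v' - algebraMap K _ b') (0, 0)
    have hδ := ((hα₁.mul hσ).add hβ₁).congr_value
      (show algebraMap K _ a₀ * 0 + algebraMap K _ l₀ = algebraMap K (AlgebraicClosure K) l₀ by ring)
    have hδ0 := hδ.ne_zero hs hβ0
    have hv'eq : v' - algebraMap K _ b' =
        (α * (e / (v - algebraMap K _ b)) + β) * (v - algebraMap K _ b) := by
      rw [hαβ]
      field_simp
    have hσeq : e' / (v' - algebraMap K _ b') =
        η / (α * (e / (v - algebraMap K _ b)) + β) * (e / (v - algebraMap K _ b)) := by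
      rw [hv'eq, he]
      field_simp
  · have hδ' := (hη₂.sub (hα₂.mul hσ')).congr_value
      (show algebraMap K _ c₀ - algebraMap K _ a₀ * 0 = algebraMap K (AlgebraicClosure K) c₀ by ring)
    have hδ0' := hδ'.ne_zero hs' hc
    refine HasValue.place_eq hs' hs ?_ ?_ ?_ ?_
    · have h1 := (hβ₂.mul hσ').div hs' hδ' hc
      have h2 : β * (e' / (v' - algebraMap K _ b')) / (η - α * (e' / (v' - algebraMap K _ b'))) =
          e / (v - algebraMap K _ b) := by
        rw [div_eq_iff hδ0', hσeq]
        generalize e / (v - algebraMap K _ b) = σ at hδ0 ⊢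
        field_simp
        ring
      rw [h2] at h1
      exact h1.congr_value (by simp)
    · have h1 := (((hδ'.mul hr').div hs' hη₂ hc).div hs' hβ₂ hβ0)
      have h2 : (η - α * (e' / (v' - algebraMap K _ b'))) * (v' - algebraMap K _ b') / η / β =
          v - algebraMap K _ b := by
        have h3 : (η - α * (e' / (v' - algebraMap K _ b'))) * (v' - algebraMap K _ b') =
            η * (v' - algebraMap K _ b') - α * e' := by
          field_simp
        rw [h3, hαβ, he]
        field_simp
        ring
      rw [h2] at h1
      exact h1.congr_value (by simp)
    · rw [hσeq]
      exact ((hη₁.div hs hδ hβ0).mul hσ).congr_value (mul_zero _)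
    · rw [hv'eq]
      exact (hδ.mul hr).congr_value (mul_zero _)
  · exact ⟨_, _, div_ne_zero hc hβ0, hη₁.div hs hδ hβ0, hσeq⟩
  · exact ⟨_, _, hβ0, hδ, hv'eq⟩

/-- In all coordinates whose first one is the function `e`, up to a unit, the cascades issuing
from the rational place `V` end and are regularised. -/
def Resolved (D : Derivation ℂ (RatFun K) (RatFun K))
    (V : RatFun K → AlgebraicClosure K → Prop) (e : RatFun K) : Prop :=
  ∀ (e' v' g : RatFun K) (b : K) (c : AlgebraicClosure K), IsChart e' v' →
    HasValue e' v' (0, algebraMap K _ b) = V → e' = g * e → V g c → c ≠ 0 →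
    CascadesRegularised D e' v' 0 b

/-- In no coordinates whose first one is the function `e`, up to a unit, are the cascades issuing
from the rational place `V` regularised. -/
def Unresolved (D : Derivation ℂ (RatFun K) (RatFun K))
    (V : RatFun K → AlgebraicClosure K → Prop) (e : RatFun K) : Prop :=
  ∀ (e' v' g : RatFun K) (b : K) (c : AlgebraicClosure K), IsChart e' v' →
    HasValue e' v' (0, algebraMap K _ b) = V → e' = g * e → V g c → c ≠ 0 →
    ¬ CascadesRegularised D e' v' 0 b

variable {D : Derivation ℂ (RatFun K) (RatFun K)}

theorem Resolved.cascades {V} (hV : Resolved D V e) (h : IsChart e v)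
    (hVe : HasValue e v (0, algebraMap K _ b) = V) : CascadesRegularised D e v 0 b :=
  hV e v 1 b 1 h hVe (one_mul e).symm (hVe ▸ HasValue.one _ _ _) one_ne_zero

theorem Resolved.unit_mul {V : RatFun K → AlgebraicClosure K → Prop} {g : RatFun K}
    {c : AlgebraicClosure K} {u w : RatFun K} {p} (hV : Resolved D V e)
    (hu : HasValue u w p = V) (hg : V g c) (hc : c ≠ 0) : Resolved D V (g * e) := by
  subst hu
  rintro e' v' g' b c' h' hV' rfl hg' hc'
  exact hV _ v' (g' * g) b (c' * c) h' hV' (by ring) (hg'.mul hg) (mul_ne_zero hc' hc)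

theorem Unresolved.unit_mul {V : RatFun K → AlgebraicClosure K → Prop} {g : RatFun K}
    {c : AlgebraicClosure K} {u w : RatFun K} {p} (hV : Unresolved D V e)
    (hu : HasValue u w p = V) (hg : V g c) (hc : c ≠ 0) : Unresolved D V (g * e) := by
  subst hu
  rintro e' v' g' b c' h' hV' rfl hg' hc'
  exact hV _ v' (g' * g) b (c' * c) h' hV' (by ring) (hg'.mul hg) (mul_ne_zero hc' hc)

theorem Unresolved.not_cascades {V} (hV : Unresolved D V e) (h : IsChart e v)
    (hVe : HasValue e v (0, algebraMap K _ b) = V) : ¬ CascadesRegularised D e v 0 b :=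
  hV e v 1 b 1 h hVe (one_mul e).symm (hVe ▸ HasValue.one _ _ _) one_ne_zero

/-- Points of the second chart other than its origin are seen in the first chart, so a
coordinate-free resolution there serves both charts. The point `t = 0` of the first chart is
invisible in the second; hence for it a resolution in one fixed system of coordinates is enough. -/
theorem cascadesRegularised_of (hD : PreservesConstants D) (h : IsChart e v)
    (h1 : ∀ t, RegularPlace D (HasValue e ((v - algebraMap K _ b) / e) (0, t)) ∨
      PolarPlace D (HasValue e ((v - algebraMap K _ b) / e) (0, t)) ∨
      (∃ s : K, t = algebraMap K _ s ∧
        Resolved D (HasValue e ((v - algebraMap K _ b) / e) (0, t)) e) ∨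
      t = 0 ∧ CascadesRegularised D e ((v - algebraMap K _ b) / e) 0 0)
    (h2 : ¬ IsBasePoint D (e / (v - algebraMap K _ b)) (v - algebraMap K _ b) (0, 0) ∨
      Resolved D (HasValue (e / (v - algebraMap K _ b)) (v - algebraMap K _ b) (0, 0))
        (e / (v - algebraMap K _ b)))
    (h3 : (∃ t, IsBasePoint D e ((v - algebraMap K _ b) / e) (0, t)) ∨
      IsBasePoint D (e / (v - algebraMap K _ b)) (v - algebraMap K _ b) (0, 0) ∨
      ∀ t, RegularPlace D (HasValue e ((v - algebraMap K _ b) / e) (0, t))) :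
    CascadesRegularised D e v 0 b := by
  have hf := h.fst_div b
  have hs := h.div_snd b
  have he := h.ne_zero_fst
  have hv := sub_ne_zero.2 (h.snd_ne_const b)
  have key : ∀ t, IsBasePoint D e ((v - algebraMap K _ b) / e) (0, t) →
      (∃ s : K, t = algebraMap K _ s ∧
        Resolved D (HasValue e ((v - algebraMap K _ b) / e) (0, t)) e) ∨
      t = 0 ∧ CascadesRegularised D e ((v - algebraMap K _ b) / e) 0 0 := by
    intro t ht
    rcases h1 t with h4 | h4 | h4
    · exact (h4.not_isBasePoint hf ht).elim
    · exact (h4.not_isBasePoint hD hf ht).elim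
    · exact h4
  have key' : ∀ t, t ≠ 0 → IsBasePoint D (e / (v - algebraMap K _ b)) (v - algebraMap K _ b)
      (t, 0) → ∃ s : K, t⁻¹ = algebraMap K _ s ∧
        Resolved D (HasValue e ((v - algebraMap K _ b) / e) (0, t⁻¹)) e := by
    intro t ht hb
    rcases h1 t⁻¹ with h4 | h4 | h4 | h4
    · rw [← place_overlap h b ht] at h4
      exact (h4.not_isBasePoint hs hb).elim
    · rw [← place_overlap h b ht] at h4
      exact (h4.not_isBasePoint hD hs hb).elim
    · exact h4
    · exact (ht (inv_eq_zero.1 h4.1)).elim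
  have hfst : blowupFst e v 0 b = (e, (v - algebraMap K _ b) / e) := by simp [blowupFst]
  have hsnd : blowupSnd e v 0 b = (e / (v - algebraMap K _ b), v - algebraMap K _ b) := by
    simp [blowupSnd]
  refine CascadesRegularised.blowup e v 0 b ?_ ?_ ?_ ?_ ?_
  all_goals simp only [hfst, hsnd]
  · intro t ht
    obtain ⟨s, hs', -⟩ | ⟨rfl, -⟩ := key t ht
    · exact ⟨s, hs'.symm⟩
    · exact ⟨0, map_zero _⟩
  · intro t ht
    by_cases ht0 : t = 0
    · exact ⟨0, by rw [ht0, map_zero]⟩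
    · obtain ⟨s, hs', -⟩ := key' t ht0 ht
      exact ⟨s⁻¹, by rw [map_inv₀, ← hs', inv_inv]⟩
  · intro s hb
    obtain ⟨-, -, h4⟩ | ⟨h4, h5⟩ := key _ hb
    · exact h4.cascades hf rfl
    · obtain rfl : s = 0 := by simpa using h4
      exact h5
  · intro s hb
    by_cases hs0 : s = 0
    · subst hs0
      rw [map_zero] at hb
      refine (h2.resolve_left fun h4 => h4 hb).cascades hs ?_
      rw [map_zero]
    · have hs0' : algebraMap K (AlgebraicClosure K) s ≠ 0 := by simpa using hs0
      obtain ⟨-, -, h4⟩ := key' _ hs0' hb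
      rw [← place_overlap h b hs0', HasValue.place_swap hs] at h4
      -- In the second chart the exceptional curve has equation `v - b = 0`, and `v - b` is `e`
      -- times `(v - b) / e`, a unit at this point.
      refine CascadesRegularised.swap (h4 _ _ ((v - algebraMap K _ b) / e) s
        (algebraMap K _ s)⁻¹ hs.symm rfl (by field_simp) ?_ (inv_ne_zero hs0')) hs.symm
      have h5 := (HasValue.snd (v - algebraMap K _ b) (e / (v - algebraMap K _ b))
        (0, algebraMap K _ s)).inv hs.symm hs0'
      rwa [inv_div] at h5
  · rintro ⟨h4, h5⟩
    rcases h3 with ⟨t, ht⟩ | ht | ht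
    · exact (h4 t ht).elim
    · exact (h5 0 ht).elim
    · exact Or.inl fun t => (ht t).isRegularSystemAt

theorem PolarAlong.not_isBasePoint_fst {u w u' w' : RatFun K} {p q}
    (hp : PolarAlong D (HasValue u w p) u) (h' : IsChart u' w')
    (hV : HasValue u' w' q = HasValue u w p) {g : RatFun K} {c} (hu : u' = g * u)
    (hg : HasValue u w p g c) (hc : c ≠ 0) : ¬ IsBasePoint D u' w' q := by
  obtain ⟨l, hl, d, hd, h1⟩ := hp.unit_mul hg hc
  rw [← hV] at hl h1
  rw [← hu] at h1
  exact not_isBasePoint_of_fst h' hl hd h1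

theorem PolarAlong.not_isBasePoint_snd {u w u' w' : RatFun K} {p q}
    (hp : PolarAlong D (HasValue u w p) w) (h' : IsChart u' w')
    (hV : HasValue u' w' q = HasValue u w p) {g : RatFun K} {c} (hu : w' = g * w)
    (hg : HasValue u w p g c) (hc : c ≠ 0) : ¬ IsBasePoint D u' w' q := by
  obtain ⟨l, hl, d, hd, h1⟩ := hp.unit_mul hg hc
  rw [← hV] at hl h1
  rw [← hu] at h1
  exact not_isBasePoint_of_snd h' hl hd h1

/-- The hypotheses are all insensitive to a change of coordinates, so by `blowup_change` they may be
checked in one chart. At the origin of the second chart the first coordinate becomes `e / (v - b)`,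
which is well defined up to a unit there. -/
theorem resolved_of (hD : PreservesConstants D) (h : IsChart e v)
    (h1 : ∀ t, RegularPlace D (HasValue e ((v - algebraMap K _ b) / e) (0, t)) ∨
      PolarPlace D (HasValue e ((v - algebraMap K _ b) / e) (0, t)) ∨
      ∃ s : K, t = algebraMap K _ s ∧
        Resolved D (HasValue e ((v - algebraMap K _ b) / e) (0, t)) e)
    (h2 : PolarAlong D (HasValue (e / (v - algebraMap K _ b)) (v - algebraMap K _ b) (0, 0))
        (e / (v - algebraMap K _ b)) ∨
      PolarAlong D (HasValue (e / (v - algebraMap K _ b)) (v - algebraMap K _ b) (0, 0))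
        (v - algebraMap K _ b) ∨
      Resolved D (HasValue (e / (v - algebraMap K _ b)) (v - algebraMap K _ b) (0, 0))
        (e / (v - algebraMap K _ b)))
    (h3 : (∃ t, BasePlace D (HasValue e ((v - algebraMap K _ b) / e) (0, t))) ∨
      BasePlace D (HasValue (e / (v - algebraMap K _ b)) (v - algebraMap K _ b) (0, 0)) ∨
      ∀ t, RegularPlace D (HasValue e ((v - algebraMap K _ b) / e) (0, t))) :
    Resolved D (HasValue e v (0, algebraMap K _ b)) e := by
  intro e' v' η b' c h' hV he hη hc
  obtain ⟨⟨k, l, hl, hfst⟩, hsnd, ⟨g₁, d₁, hd₁, hg₁, heq₁⟩, ⟨g₂, d₂, hd₂, hg₂, heq₂⟩⟩ :=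
    blowup_change h h' hV he hη hc
  have hf' := h'.fst_div b'
  have hs := h.div_snd b
  have hs' := h'.div_snd b'
  have hl' : algebraMap K (AlgebraicClosure K) l ≠ 0 := by simpa using hl
  have hfst' : ∀ t, HasValue e' ((v' - algebraMap K _ b') / e') (0, t) =
      HasValue e ((v - algebraMap K _ b) / e)
        (0, (t - algebraMap K _ k) / algebraMap K _ l) := by
    intro t
    rw [← hfst]
    congr 2
    field_simp
    ring
  refine cascadesRegularised_of hD h' (fun t => ?_) ?_ ?_
  · rw [hfst' t]
    rcases h1 ((t - algebraMap K _ k) / algebraMap K _ l) with h4 | h4 | ⟨s, hs', h4⟩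
    · exact Or.inl h4
    · exact Or.inr (Or.inl h4)
    · refine Or.inr (Or.inr (Or.inl ⟨k + l * s, ?_, ?_⟩))
      · rw [map_add, map_mul, ← hs']
        field_simp
        ring
      · rw [he]
        exact h4.unit_mul rfl (hη.lift_fst h _) hc
  · rcases h2 with h4 | h4 | h4
    · exact Or.inl (h4.not_isBasePoint_fst hs' hsnd heq₁ hg₁ hd₁)
    · exact Or.inl (h4.not_isBasePoint_snd hs' hsnd heq₂ hg₂ hd₂)
    · rw [hsnd, heq₁]
      exact Or.inr (h4.unit_mul rfl hg₁ hd₁)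
  · rcases h3 with ⟨t, ht⟩ | ht | ht
    · exact Or.inl ⟨algebraMap K _ k + algebraMap K _ l * t,
        BasePlace.isBasePoint hD hf' (by rwa [hfst])⟩
    · exact Or.inr (Or.inl (BasePlace.isBasePoint hD hs' (by rwa [hsnd])))
    · refine Or.inr (Or.inr fun t => ?_)
      rw [hfst' t]
      exact ht _

/-- An affine change of parameter over `K` cannot make an irrational base point rational. -/
theorem unresolved_of_irrational (hD : PreservesConstants D) (h : IsChart e v)
    {t : AlgebraicClosure K} (ht : ∀ s : K, algebraMap K _ s ≠ t)
    (hbase : BasePlace D (HasValue e ((v - algebraMap K _ b) / e) (0, t))) :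
    Unresolved D (HasValue e v (0, algebraMap K _ b)) e := by
  intro e' v' η b' c h' hV he hη hc hcas
  obtain ⟨⟨k, l, hl, hfst⟩, -⟩ := blowup_change h h' hV he hη hc
  have hl' : algebraMap K (AlgebraicClosure K) l ≠ 0 := by simpa using hl
  cases hcas with
  | blowup _ _ _ _ rf =>
    have hb : blowupFst e' v' 0 b' = (e', (v' - algebraMap K _ b') / e') := by simp [blowupFst]
    rw [hb] at rf
    rw [← hfst] at hbase
    obtain ⟨s, hs⟩ := rf _ (hbase.isBasePoint hD (h'.fst_div b'))
    refine ht ((s - k) / l) ?_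
    rw [map_div₀, map_sub, hs]
    field_simp
    ring

theorem unresolved_of_next (hD : PreservesConstants D) (h : IsChart e v) {s : K}
    (hbase : BasePlace D (HasValue e ((v - algebraMap K _ b) / e) (0, algebraMap K _ s)))
    (hnext : Unresolved D (HasValue e ((v - algebraMap K _ b) / e) (0, algebraMap K _ s)) e) :
    Unresolved D (HasValue e v (0, algebraMap K _ b)) e := by
  intro e' v' η b' c h' hV he hη hc hcas
  obtain ⟨⟨k, l, hl, hfst⟩, -⟩ := blowup_change h h' hV he hη hc
  cases hcas with
  | blowup _ _ _ _ _ _ nf =>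
    have hb : blowupFst e' v' 0 b' = (e', (v' - algebraMap K _ b') / e') := by simp [blowupFst]
    rw [hb] at nf
    have h1 := hfst (algebraMap K _ s)
    rw [← map_mul, ← map_add] at h1
    refine hnext _ _ η (k + l * s) c (h'.fst_div b') h1 he (hη.lift_fst h _) hc (nf _ ?_)
    rw [← h1] at hbase
    exact hbase.isBasePoint hD (h'.fst_div b')

/-- A pole at every point of the exceptional curve leaves no base point on it, yet neither chart is
regular along the curve: the last requirement on a cascade fails. -/
theorem unresolved_of_polar (hD : PreservesConstants D) (h : IsChart e v)
    (h1 : ∀ t, PolarPlace D (HasValue e ((v - algebraMap K _ b) / e) (0, t)))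
    (h2 : PolarAlong D (HasValue (e / (v - algebraMap K _ b)) (v - algebraMap K _ b) (0, 0))
        (v - algebraMap K _ b)) :
    Unresolved D (HasValue e v (0, algebraMap K _ b)) e := by
  intro e' v' η b' c h' hV he hη hc hcas
  obtain ⟨⟨k, l, hl, hfst⟩, hsnd, -, ⟨g₂, d₂, hd₂, hg₂, heq₂⟩⟩ :=
    blowup_change h h' hV he hη hc
  have hl' : algebraMap K (AlgebraicClosure K) l ≠ 0 := by simpa using hl
  have hf' := h'.fst_div b'
  have hs := h.div_snd b
  have hs' := h'.div_snd b'
  have hpol : ∀ t, PolarPlace D (HasValue e' ((v' - algebraMap K _ b') / e') (0, t)) := by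
    intro t
    have h3 := h1 ((t - algebraMap K _ k) / algebraMap K _ l)
    rw [← hfst] at h3
    convert h3 using 3
    field_simp
    ring
  obtain ⟨g, hg, d, hd, hgd⟩ := h2.unit_mul hg₂ hd₂
  rw [← hsnd] at hg hgd
  rw [← heq₂] at hgd
  cases hcas with
  | blowup _ _ _ _ _ _ _ _ fin =>
    have hb : blowupFst e' v' 0 b' = (e', (v' - algebraMap K _ b') / e') := by simp [blowupFst]
    have hb' : blowupSnd e' v' 0 b' =
        (e' / (v' - algebraMap K _ b'), v' - algebraMap K _ b') := by simp [blowupSnd]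
    rw [hb, hb'] at fin
    have hnb : ∀ t, ¬ IsBasePoint D (e' / (v' - algebraMap K _ b')) (v' - algebraMap K _ b')
        (t, 0) := by
      intro t
      by_cases ht : t = 0
      · subst ht
        exact not_isBasePoint_of_snd hs' hg hd hgd
      · have h4 := hpol t⁻¹
        rw [← place_overlap h' b' ht] at h4
        exact h4.not_isBasePoint hD hs'
    rcases fin ⟨fun t => (hpol t).not_isBasePoint hD hf', hnb⟩ with h3 | h3
    · exact (hpol 0).not_isRegularSystemAt hD hf' (h3 0)
    · exact not_isRegularAt_or_isIndeterminateAt hs' hg hd hgd (Or.inl (h3 0).2)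

end BlowUps

/-! ### Simple poles with resonant linear part: the last blow-up of a cascade. -/

section Resonance

set_option linter.unusedSectionVars false

variable {K : Type} [Field K] [Algebra ℂ K] {D : Derivation ℂ (RatFun K) (RatFun K)}
  {e v τ σ n : RatFun K} {b : K}

theorem deriv_factor (D : Derivation ℂ (RatFun K) (RatFun K)) (h : τ * e = n) :
    e * D τ = D n - τ * D e := by
  rw [← h, Derivation.leibniz, smul_eq_mul, smul_eq_mul]
  ring

theorem IsChart.of_factor_fst (h : IsChart e v) (hn : n = v - algebraMap K _ b)
    (hτ : τ * e = n) : IsChart e τ := by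
  have h1 := h.fst_div b
  rwa [← hn, ← hτ, mul_div_cancel_right₀ _ h.ne_zero_fst] at h1

theorem IsChart.of_factor_snd (h : IsChart e v) (hn : n = v - algebraMap K _ b)
    (hσ : σ * n = e) : IsChart σ n := by
  have h1 := h.div_snd b
  have h2 := sub_ne_zero.2 (h.snd_ne_const b)
  rwa [← hn, ← hσ, mul_div_cancel_right₀ _ (hn ▸ h2)] at h1

theorem HasValue.lift_factor_fst (h : IsChart e v) (hn : n = v - algebraMap K _ b)
    (hτ : τ * e = n) {f c} (hf : HasValue e v (0, algebraMap K _ b) f c) (t) :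
    HasValue e τ (0, t) f c := by
  have h1 := hf.lift_fst h t
  rwa [← hn, ← hτ, mul_div_cancel_right₀ _ h.ne_zero_fst] at h1

theorem HasValue.lift_factor_snd (h : IsChart e v) (hn : n = v - algebraMap K _ b)
    (hσ : σ * n = e) {f c} (hf : HasValue e v (0, algebraMap K _ b) f c) (t) :
    HasValue σ n (t, 0) f c := by
  have h1 := hf.lift_snd h t
  have h2 := sub_ne_zero.2 (h.snd_ne_const b)
  rwa [← hn, ← hσ, mul_div_cancel_right₀ _ (hn ▸ h2)] at h1

theorem resolved_of_blowup (hD : PreservesConstants D) (h : IsChart e v)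
    (hn : n = v - algebraMap K _ b) (hτ : τ * e = n) (hσ : σ * n = e)
    (h1 : ∀ t, RegularPlace D (HasValue e τ (0, t)) ∨ PolarPlace D (HasValue e τ (0, t)) ∨
      ∃ s : K, t = algebraMap K _ s ∧ Resolved D (HasValue e τ (0, t)) e)
    (h2 : PolarAlong D (HasValue σ n (0, 0)) σ ∨ PolarAlong D (HasValue σ n (0, 0)) n ∨
      Resolved D (HasValue σ n (0, 0)) σ)
    (h3 : (∃ t, BasePlace D (HasValue e τ (0, t))) ∨ BasePlace D (HasValue σ n (0, 0)) ∨
      ∀ t, RegularPlace D (HasValue e τ (0, t))) :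
    Resolved D (HasValue e v (0, algebraMap K _ b)) e := by
  have he := h.ne_zero_fst
  have hn0 := hn ▸ sub_ne_zero.2 (h.snd_ne_const b)
  obtain rfl : τ = n / e := by rw [← hτ, mul_div_cancel_right₀ _ he]
  obtain rfl : σ = e / n := by rw [← hσ, mul_div_cancel_right₀ _ hn0]
  subst hn
  exact resolved_of hD h h1 h2 h3

theorem cascadesRegularised_of_blowup (hD : PreservesConstants D) (h : IsChart e v)
    (hn : n = v - algebraMap K _ b) (hτ : τ * e = n) (hσ : σ * n = e)
    (h1 : ∀ t, RegularPlace D (HasValue e τ (0, t)) ∨ PolarPlace D (HasValue e τ (0, t)) ∨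
      (∃ s : K, t = algebraMap K _ s ∧ Resolved D (HasValue e τ (0, t)) e) ∨
      t = 0 ∧ CascadesRegularised D e τ 0 0)
    (h2 : ¬ IsBasePoint D σ n (0, 0) ∨ Resolved D (HasValue σ n (0, 0)) σ)
    (h3 : (∃ t, IsBasePoint D e τ (0, t)) ∨ IsBasePoint D σ n (0, 0) ∨
      ∀ t, RegularPlace D (HasValue e τ (0, t))) :
    CascadesRegularised D e v 0 b := by
  have he := h.ne_zero_fst
  have hn0 := hn ▸ sub_ne_zero.2 (h.snd_ne_const b)
  obtain rfl : τ = n / e := by rw [← hτ, mul_div_cancel_right₀ _ he]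
  obtain rfl : σ = e / n := by rw [← hσ, mul_div_cancel_right₀ _ hn0]
  subst hn
  exact cascadesRegularised_of hD h h1 h2 h3

/-- The last blow-up of a cascade: if the linear part of the system at a simple pole is in
resonance without a logarithmic term, the system becomes regular. If the linear part vanishes, a
further blow-up is needed. -/
theorem resolved_of_resonance (hD : PreservesConstants D) (h : IsChart e v)
    (hn : n = v - algebraMap K _ b) {a c : K} {S R : RatFun K} {S₀ R₀}
    (hS : HasValue e v (0, algebraMap K _ b) S S₀) (hR : HasValue e v (0, algebraMap K _ b) R R₀)
    (hDn : e * D n = algebraMap K _ a * n + algebraMap K _ c * n ^ 2 + e ^ 2 * S)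
    (hDe : D e = algebraMap K _ a + 2 * algebraMap K _ c * n + e * R) (hac : a ≠ 0 ∨ c ≠ 0) :
    Resolved D (HasValue e v (0, algebraMap K _ b)) e := by
  have he := h.ne_zero_fst
  have hn0 : n ≠ 0 := hn ▸ sub_ne_zero.2 (h.snd_ne_const b)
  obtain ⟨τ, hτ⟩ : ∃ τ, τ * e = n := ⟨n / e, div_mul_cancel₀ _ he⟩
  obtain ⟨σ, hσ⟩ : ∃ σ, σ * n = e := ⟨e / n, div_mul_cancel₀ _ hn0⟩
  have hf := h.of_factor_fst hn hτ
  have hs := h.of_factor_snd hn hσ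
  have hσ0 := hs.ne_zero_fst
  -- Resonance: the term `a n` in `e * D n` and the term `a` in `D e` cancel in `D (n / e)`, and the
  -- remaining terms are divisible by `e ^ 2` once `n = τ * e`.
  have hDτ : D τ = S - algebraMap K _ c * τ ^ 2 - τ * R := by
    apply mul_left_cancel₀ (pow_ne_zero 2 he)
    have h1 := deriv_factor D hτ
    rw [pow_two, mul_assoc, h1, mul_sub, hDn, hDe, ← hτ]
    ring
  have hreg : ∀ t, RegularPlace D (HasValue e τ (0, t)) := by
    intro t
    have hS' := hS.lift_factor_fst h hn hτ t
    have hR' := hR.lift_factor_fst h hn hτ t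
    have h0 := HasValue.fst e τ (0, t)
    have h1 := HasValue.snd e τ (0, t)
    refine regularPlace_of hD hf ?_ ?_ (a := algebraMap K _ a) (b := S₀ - algebraMap K _ c * t ^ 2 -
      t * R₀)
    · rw [hDe, ← hτ]
      exact (((HasValue.const _ _ _ a).add (((HasValue.ofNat _ _ _ 2).mul
        (HasValue.const _ _ _ c)).mul (h1.mul h0))).add (h0.mul hR')).congr_value (by simp)
    · rw [hDτ]
      exact (hS'.sub ((HasValue.const _ _ _ c).mul (h1.pow 2))).sub (h1.mul hR')
  have hS' := hS.lift_factor_snd h hn hσ 0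
  have hR' := hR.lift_factor_snd h hn hσ 0
  have h0 := HasValue.fst σ n (0, 0)
  have h1 := HasValue.snd σ n (0, 0)
  have hσDn : σ * D n = algebraMap K _ a + algebraMap K _ c * n + σ * (σ * n) * S := by
    apply mul_left_cancel₀ hn0
    have h2 : n * (σ * D n) = e * D n := by rw [← hσ]; ring
    rw [h2, hDn, ← hσ]
    ring
  have hnDσ : n * D σ = algebraMap K _ c * n + σ * n * R - σ * (σ * n) * S := by
    rw [deriv_factor D hσ, hDe, hσDn, ← hσ]
    ring
  have hDσ : D σ = algebraMap K _ c + σ * R - σ ^ 2 * S := by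
    apply mul_left_cancel₀ hn0
    rw [hnDσ]
    ring
  have hDσv : HasValue σ n (0, 0) (D σ) (algebraMap K _ c) := by
    rw [hDσ]
    exact (((HasValue.const _ _ _ c).add (h0.mul hR')).sub ((h0.pow 2).mul hS')).congr_value
      (by simp)
  -- For `a ≠ 0` the far point of the exceptional curve is a pole of `D n`. For `a = 0` (a double
  -- root in the application) it is a new base point, and one more blow-up is needed.
  by_cases ha : a = 0
  · subst ha
    replace hac := hac.resolve_left fun h => h rfl
    have hcv : algebraMap K (AlgebraicClosure K) c ≠ 0 := by simpa using hac
    rw [map_zero, zero_add] at hσDn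
    have hunit := ((HasValue.const σ n (0, 0) c).add ((h0.pow 2).mul hS')).congr_value
      (show algebraMap K _ c + (0, (0 : AlgebraicClosure K)).1 ^ 2 * S₀ = algebraMap K _ c by simp)
    have hbase : BasePlace D (HasValue σ n (0, 0)) := by
      refine ⟨σ, fun _ _ hf hg => hs.fst_irreducible 0 hf hg, fun f d hf =>
        deriv_vanishes hD hs h0 ((h0.mul hDσv).congr_value (by simp)) ?_ hf,
        n, 0, h1, fun d hd => ?_⟩
      · rw [hσDn]
        exact (((HasValue.const _ _ _ c).mul h1).add ((h0.mul (h0.mul h1)).mul hS')).congr_value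
          (by simp)
      -- Here `σ * D n = n * (c + σ ^ 2 * S)` with the bracket a unit, so regularity of `D n` would
      -- make `n` a multiple of `σ`.
      · refine hs.snd_not_multiple (b := 0) (g := D n / (algebraMap K _ c + σ ^ 2 * S))
          (c := d / algebraMap K _ c) ?_ ?_
        · rw [map_zero]
          exact hd.div hs hunit hcv
        · have h2 := hunit.ne_zero hs hcv
          rw [map_zero, sub_zero, div_mul_eq_mul_div, div_eq_iff h2, mul_comm (D n), hσDn]
          ring
    obtain ⟨l, hl⟩ : ∃ l, l * σ = n := ⟨n / σ, div_mul_cancel₀ _ hσ0⟩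
    obtain ⟨j, hj⟩ : ∃ j, j * n = σ := ⟨σ / n, div_mul_cancel₀ _ hn0⟩
    have hn' : n = n - algebraMap K _ 0 := by simp
    have hf' := hs.of_factor_fst hn' hl
    have hs' := hs.of_factor_snd hn' hj
    have hnext : Resolved D (HasValue σ n (0, 0)) σ := by
      have hpt : HasValue σ n (0, algebraMap K _ 0) = HasValue σ n (0, 0) := by rw [map_zero]
      have hreg' : ∀ t, RegularPlace D (HasValue σ l (0, t)) := by
        intro t
        have hS₁ := HasValue.lift_factor_fst hs hn' hl (hpt ▸ hS') t
        have hR₁ := HasValue.lift_factor_fst hs hn' hl (hpt ▸ hR') t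
        have h2 := HasValue.fst σ l (0, t)
        have h3 := HasValue.snd σ l (0, t)
        -- A second resonance: both `σ * D n / n` and `D σ` have leading value `c`. For the latter
        -- this uses that the coefficient of `n` in `D e` is `2 c`, twice that of `n ^ 2` in `e * D
        -- n`.
        have hDl : D l = l * (2 * σ * S - R) := by
          apply mul_left_cancel₀ (mul_ne_zero hσ0 hσ0)
          have h4 := deriv_factor D hl
          rw [mul_assoc, h4, mul_sub, hσDn, hDσ, ← hl]
          ring
        refine regularPlace_of hD hf' ?_ ?_ (a := algebraMap K _ c) (b := t * (-R₀))
        · rw [hDσ]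
          exact (((HasValue.const _ _ _ c).add (h2.mul hR₁)).sub ((h2.pow 2).mul hS₁)).congr_value
            (by simp)
        · rw [hDl]
          exact (h3.mul ((((HasValue.ofNat _ _ _ 2).mul h2).mul hS₁).sub hR₁)).congr_value
            (by simp)
      rw [← hpt]
      refine resolved_of_blowup hD hs hn' hl hj (fun t => Or.inl (hreg' t))
        (Or.inr (Or.inl ?_)) (Or.inr (Or.inr hreg'))
      have hS₁ := HasValue.lift_factor_snd hs hn' hj (hpt ▸ hS') 0
      have hR₁ := HasValue.lift_factor_snd hs hn' hj (hpt ▸ hR') 0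
      have h2 := HasValue.fst j n (0, 0)
      have h3 := HasValue.snd j n (0, 0)
      have hjDn : j * D n = algebraMap K _ c + (j * n) ^ 2 * S := by
        apply mul_left_cancel₀ hn0
        have h4 : n * (j * D n) = σ * D n := by rw [← hj]; ring
        rw [h4, hσDn, ← hj]
        ring
      have hnDj : n * D j = j * n * R - 2 * (j * n) ^ 2 * S := by
        rw [deriv_factor D hj, hDσ, hjDn, ← hj]
        ring
      refine ⟨j, h2, ⟨algebraMap K _ c, hcv, ?_⟩, fun f d hf => deriv_vanishes hD hs'
        ((h3.mul h2).congr_value (by simp)) ?_ ?_ hf⟩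
      · rw [hjDn]
        exact ((HasValue.const _ _ _ c).add (((h2.mul h3).pow 2).mul hS₁)).congr_value (by simp)
      · have h4 : n * j * D j = j * (n * D j) := by ring
        rw [h4, hnDj]
        exact (h2.mul (((h2.mul h3).mul hR₁).sub (((HasValue.ofNat _ _ _ 2).mul
          ((h2.mul h3).pow 2)).mul hS₁))).congr_value (by simp)
      · have h4 : n * j * D n = n * (j * D n) := by ring
        rw [h4, hjDn]
        exact (h3.mul ((HasValue.const _ _ _ c).add (((h2.mul h3).pow 2).mul hS₁))).congr_value
          (by simp)
    exact resolved_of_blowup hD h hn hτ hσ (fun t => Or.inl (hreg t)) (Or.inr (Or.inr hnext))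
      (Or.inr (Or.inl hbase))
  · have hav : algebraMap K (AlgebraicClosure K) a ≠ 0 := by simpa using ha
    have hσDnv : HasValue σ n (0, 0) (σ * D n) (algebraMap K _ a) := by
      rw [hσDn]
      exact (((HasValue.const _ _ _ a).add ((HasValue.const _ _ _ c).mul h1)).add
        ((h0.mul (h0.mul h1)).mul hS')).congr_value (by simp)
    refine resolved_of_blowup hD h hn hτ hσ (fun t => Or.inl (hreg t)) (Or.inr (Or.inl ?_))
      (Or.inr (Or.inr hreg))
    refine ⟨σ, h0, ⟨_, hav, hσDnv⟩, fun f d hf => deriv_vanishes hD hs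
        ((h1.mul h0).congr_value (by simp)) ?_ ?_ hf⟩
    · exact ((h1.mul h0).mul hDσv).congr_value (by simp)
    · rw [mul_assoc]
      exact (h1.mul hσDnv).congr_value (by simp)

/-- The term `d * e` is the one which resonance cannot remove: it leaves `e * D τ = d + ...`, a pole
at every point of the exceptional curve, which corresponds to a logarithm in the solutions. -/
theorem unresolved_of_resonance (hD : PreservesConstants D) (h : IsChart e v)
    (hn : n = v - algebraMap K _ b) {a c d : K} {S R : RatFun K} {S₀ R₀}
    (hS : HasValue e v (0, algebraMap K _ b) S S₀) (hR : HasValue e v (0, algebraMap K _ b) R R₀)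
    (hDn : e * D n = algebraMap K _ a * n + algebraMap K _ c * n ^ 2 + algebraMap K _ d * e +
      e ^ 2 * S)
    (hDe : D e = algebraMap K _ a + 2 * algebraMap K _ c * n + e * R) (ha : a ≠ 0) (hd : d ≠ 0) :
    Unresolved D (HasValue e v (0, algebraMap K _ b)) e := by
  have he := h.ne_zero_fst
  have hn0 : n ≠ 0 := hn ▸ sub_ne_zero.2 (h.snd_ne_const b)
  obtain ⟨τ, hτ⟩ : ∃ τ, τ * e = n := ⟨n / e, div_mul_cancel₀ _ he⟩
  obtain ⟨σ, hσ⟩ : ∃ σ, σ * n = e := ⟨e / n, div_mul_cancel₀ _ hn0⟩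
  have hf := h.of_factor_fst hn hτ
  have hs := h.of_factor_snd hn hσ
  have hσ0 := hs.ne_zero_fst
  have hav : algebraMap K (AlgebraicClosure K) a ≠ 0 := by simpa using ha
  have hdv : algebraMap K (AlgebraicClosure K) d ≠ 0 := by simpa using hd
  have hDτ : e * D τ = algebraMap K _ d + e * (S - algebraMap K _ c * τ ^ 2 - τ * R) := by
    apply mul_left_cancel₀ he
    have h1 := deriv_factor D hτ
    rw [h1, mul_sub, hDn, hDe, ← hτ]
    ring
  have hpol : ∀ t, PolarPlace D (HasValue e τ (0, t)) := by
    intro t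
    have hS' := hS.lift_factor_fst h hn hτ t
    have hR' := hR.lift_factor_fst h hn hτ t
    have h0 := HasValue.fst e τ (0, t)
    have h1 := HasValue.snd e τ (0, t)
    refine polarPlace_of_snd hD hf h0 ?_ ?_ hdv (a := 0)
    · rw [hDe, ← hτ]
      exact (h0.mul (((HasValue.const _ _ _ a).add (((HasValue.ofNat _ _ _ 2).mul
        (HasValue.const _ _ _ c)).mul (h1.mul h0))).add (h0.mul hR'))).congr_value (by simp)
    · rw [hDτ]
      exact ((HasValue.const _ _ _ d).add (h0.mul ((hS'.sub ((HasValue.const _ _ _ c).mul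
        (h1.pow 2))).sub (h1.mul hR')))).congr_value (by simp)
  have hS' := hS.lift_factor_snd h hn hσ 0
  have hR' := hR.lift_factor_snd h hn hσ 0
  have h0 := HasValue.fst σ n (0, 0)
  have h1 := HasValue.snd σ n (0, 0)
  have hσDn : σ * D n = algebraMap K _ a + algebraMap K _ c * n + algebraMap K _ d * σ +
      σ * (σ * n) * S := by
    apply mul_left_cancel₀ hn0
    have h2 : n * (σ * D n) = e * D n := by rw [← hσ]; ring
    rw [h2, hDn, ← hσ]
    ring
  have hnDσ : n * D σ = algebraMap K _ c * n + σ * n * R - algebraMap K _ d * σ -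
      σ * (σ * n) * S := by
    rw [deriv_factor D hσ, hDe, hσDn, ← hσ]
    ring
  have hσDnv : HasValue σ n (0, 0) (σ * D n) (algebraMap K _ a) := by
    rw [hσDn]
    exact ((((HasValue.const _ _ _ a).add ((HasValue.const _ _ _ c).mul h1)).add
      ((HasValue.const _ _ _ d).mul h0)).add ((h0.mul (h0.mul h1)).mul hS')).congr_value (by simp)
  have hpolar : PolarAlong D (HasValue σ n (0, 0)) n := by
    refine ⟨σ, h0, ⟨_, hav, hσDnv⟩, fun f d hf => deriv_vanishes hD hs
        ((h1.mul h0).congr_value (by simp)) ?_ ?_ hf⟩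
    · have h4 : n * σ * D σ = σ * (n * D σ) := by ring
      rw [h4, hnDσ]
      exact (h0.mul (((((HasValue.const _ _ _ c).mul h1).add ((h0.mul h1).mul hR')).sub
        ((HasValue.const _ _ _ _).mul h0)).sub ((h0.mul (h0.mul h1)).mul hS'))).congr_value
        (by simp)
    · rw [mul_assoc]
      exact (h1.mul hσDnv).congr_value (by simp)
  obtain rfl : τ = n / e := by rw [← hτ, mul_div_cancel_right₀ _ he]
  obtain rfl : σ = e / n := by rw [← hσ, mul_div_cancel_right₀ _ hn0]
  subst hn
  exact unresolved_of_polar hD h hpol hpolar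

end Resonance

/-! ### The Okamoto system with arbitrary parameter `k`, at the points `Z = ∞`, `Y = 0, 1, x`. -/

section OkamotoSystem

set_option linter.unusedSectionVars false

local notation "ι" => algebraMap _ (RatFun _)
local notation "κ" => algebraMap _ (AlgebraicClosure _)

/-- Functions `Y`, `Z` on the plane which satisfy the Okamoto system, in which the constant
parameter `k` is replaced by an arbitrary element of the coefficient field, and the linear terms
`l2 * Y ^ 2 + l1 * Y + l0` are not specified. -/
structure OkamotoPair (K : Type) [Field K] [Algebra ℂ K] where
  δ : Derivation ℂ K K
  D : Derivation ℂ (RatFun K) (RatFun K)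
  D_const : ∀ a, D (ι a) = ι (δ a)
  x : K
  s : K
  k : K
  l0 : K
  l1 : K
  l2 : K
  Y : RatFun K
  Z : RatFun K
  chart : IsChart Y Z
  s_ne_zero : s ≠ 0
  D_Y : D Y = ι s * (2 * (Y * (Y - 1) * (Y - ι x)) * Z - (ι l2 * Y ^ 2 + ι l1 * Y + ι l0))
  D_Z : D Z = -(ι s * ((3 * Y ^ 2 - 2 * (1 + ι x) * Y + ι x) * Z ^ 2 -
    (2 * ι l2 * Y + ι l1) * Z + ι k))

namespace OkamotoPair

variable {K : Type} [Field K] [Algebra ℂ K] (O : OkamotoPair K)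

theorem preservesConstants : PreservesConstants O.D := fun a => ⟨_, O.D_const a⟩

theorem algebraMap_ne_zero {a : K} (h : a ≠ 0) : κ a ≠ (0 : AlgebraicClosure K) := by
  simpa using h

section Finite

variable {a θ τ : K}

theorem chart_finite (a : K) : IsChart O.Z⁻¹ (O.Y - ι a) := by
  set F := IntermediateField.adjoin K {O.Z⁻¹, O.Y - ι a}
  have h1 : O.Z⁻¹ ∈ F := IntermediateField.subset_adjoin _ _ (Or.inl rfl)
  have h2 : O.Y - ι a ∈ F := IntermediateField.subset_adjoin _ _ (Or.inr rfl)
  refine O.chart.of_mem ?_ ?_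
  · simpa using add_mem h2 (F.algebraMap_mem a)
  · simpa using inv_mem h1

/-- Taylor expansion at `Y = a`: the cubic `Y (Y - 1) (Y - x)` vanishes at `a` with derivative `τ`,
and the constant term of the equation, including the motion of `a` itself, is written as `-s θ τ`.
-/
theorem deriv_finite_fst (ha : a * (a - 1) * (a - O.x) = 0)
    (hθ : O.s * (O.l2 * a ^ 2 + O.l1 * a + O.l0) + O.δ a = O.s * θ * τ)
    (hτ : τ = 3 * a ^ 2 - 2 * (1 + O.x) * a + O.x) :
    O.D (O.Y - ι a) = ι O.s * (2 * (O.Y - ι a) * (ι τ + (3 * ι a - (1 + ι O.x)) * (O.Y - ι a) +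
      (O.Y - ι a) ^ 2) * O.Z - (ι O.l2 * (O.Y - ι a) ^ 2 + (2 * ι O.l2 * ι a + ι O.l1) *
      (O.Y - ι a)) - ι θ * ι τ) := by
  have h1 := congrArg (ι : K → RatFun K) ha
  have h2 := congrArg (ι : K → RatFun K) hθ
  have h3 := congrArg (ι : K → RatFun K) hτ
  simp only [map_mul, map_add, map_sub, map_pow, map_one, map_zero, map_ofNat] at h1 h2 h3
  rw [map_sub, O.D_const, O.D_Y]
  linear_combination (2 * ι O.s * O.Z) * h1 - h2 -
    2 * ι O.s * O.Z * (O.Y - ι a) * h3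

theorem deriv_finite_snd (hτ : τ = 3 * a ^ 2 - 2 * (1 + O.x) * a + O.x) :
    O.D O.Z⁻¹ = ι O.s * (ι τ + 2 * (3 * ι a - (1 + ι O.x)) * (O.Y - ι a) + 3 * (O.Y - ι a) ^ 2 -
      (2 * ι O.l2 * (O.Y - ι a + ι a) + ι O.l1) * O.Z⁻¹ + ι O.k * O.Z⁻¹ ^ 2) := by
  have h3 := congrArg (ι : K → RatFun K) hτ
  simp only [map_mul, map_add, map_sub, map_pow, map_one, map_ofNat] at h3
  have hZ := O.chart.ne_zero_snd
  rw [Derivation.leibniz_inv, O.D_Z, smul_eq_mul, h3]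
  field_simp
  ring

/-- The place where `Z = ∞` and `Y = a` is one of the singular points `0, 1, x` is a base point. -/
theorem basePlace_finite (ha : a * (a - 1) * (a - O.x) = 0)
    (hθ : O.s * (O.l2 * a ^ 2 + O.l1 * a + O.l0) + O.δ a = O.s * θ * τ)
    (hτ : τ = 3 * a ^ 2 - 2 * (1 + O.x) * a + O.x) (h2 : (2 : K) ≠ 0) {q : K}
    (hq : q * (q - 1) * (q - O.x) ≠ 0) :
    BasePlace O.D (HasValue O.Z⁻¹ (O.Y - ι a) (0, 0)) := by
  have hch := O.chart_finite a
  have hDc := O.deriv_finite_fst ha hθ hτ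
  have hDp := O.deriv_finite_snd hτ
  have hZ := O.chart.ne_zero_snd
  set c := O.Y - ι a with hc
  set p := O.Z⁻¹ with hp
  have hpDc : p * O.D c = ι O.s * (2 * c * (ι τ + (3 * ι a - (1 + ι O.x)) * c + c ^ 2) -
      p * (ι O.l2 * c ^ 2 + (2 * ι O.l2 * ι a + ι O.l1) * c) - p * ι θ * ι τ) := by
    have hpZ : p * O.Z = 1 := inv_mul_cancel₀ hZ
    rw [hDc]
    linear_combination ι O.s * 2 * c * (ι τ + (3 * ι a - (1 + ι O.x)) * c + c ^ 2) * hpZ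
  have h3 : κ O.s * (2 * (κ (q * (q - 1) * (q - O.x)))) ≠ (0 : AlgebraicClosure K) := by
    have h4 := algebraMap_ne_zero h2
    rw [map_ofNat] at h4
    exact mul_ne_zero (algebraMap_ne_zero O.s_ne_zero) (mul_ne_zero h4 (algebraMap_ne_zero hq))
  -- On the line `p = 0` the numerator is `2 s` times the cubic at `a + c`; it is nonzero at `c = q
  -- - a`, where `Y = q`.
  refine basePlace_of O.preservesConstants hch ?_ ?_ h3 (b' := κ (q - a)) ?_
  · rw [hDp]
    refine HasValue.congr_value (by
          repeat (with_reducible first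
            | assumption | apply HasValue.fst | apply HasValue.snd | apply HasValue.const
            | apply HasValue.add | apply HasValue.sub | apply HasValue.mul | apply HasValue.neg
            | apply HasValue.pow | apply HasValue.ofNat | apply HasValue.one)) (zero_mul _)
  · rw [hpDc]
    refine HasValue.congr_value (by
          repeat (with_reducible first
            | assumption | apply HasValue.fst | apply HasValue.snd | apply HasValue.const
            | apply HasValue.add | apply HasValue.sub | apply HasValue.mul | apply HasValue.neg
            | apply HasValue.pow | apply HasValue.ofNat | apply HasValue.one)) ?_
    simp
  · rw [hpDc]
    refine HasValue.congr_value (by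
          repeat (with_reducible first
            | assumption | apply HasValue.fst | apply HasValue.snd | apply HasValue.const
            | apply HasValue.add | apply HasValue.sub | apply HasValue.mul | apply HasValue.neg
            | apply HasValue.pow | apply HasValue.ofNat | apply HasValue.one)) ?_
    have h1 := congrArg (κ : K → AlgebraicClosure K) ha
    have h3 := congrArg (κ : K → AlgebraicClosure K) hτ
    simp only [map_mul, map_add, map_sub, map_pow, map_one, map_zero, map_ofNat] at h1 h3 ⊢
    linear_combination -2 * κ O.s * h1 + 2 * κ O.s * (κ q - κ a) * h3

set_option maxHeartbeats 1000000 in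
/-- The cascades over the place where `Z = ∞` and `Y = a` is one of the points `0, 1, x`. -/
theorem resolved_finite (ha : a * (a - 1) * (a - O.x) = 0)
    (hθ : O.s * (O.l2 * a ^ 2 + O.l1 * a + O.l0) + O.δ a = O.s * θ * τ)
    (hτ : τ = 3 * a ^ 2 - 2 * (1 + O.x) * a + O.x) (hτ0 : τ ≠ 0) (hδ : O.δ θ = 0) :
    Resolved O.D (HasValue O.Z⁻¹ (O.Y - ι a) (0, 0)) O.Z⁻¹ := by
  have hch := O.chart_finite a
  have hDc := O.deriv_finite_fst ha hθ hτ
  have hDp := O.deriv_finite_snd hτ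
  have hZ := O.chart.ne_zero_snd
  have hDZ := O.D_Z
  set c := O.Y - ι a with hc
  set p := O.Z⁻¹ with hp
  have hp0 : p ≠ 0 := hch.ne_zero_fst
  have hc0 : c ≠ 0 := hch.ne_zero_snd
  have hpZ : p * O.Z = 1 := inv_mul_cancel₀ hZ
  obtain ⟨m, hm⟩ : ∃ m, m * p = c := ⟨c / p, div_mul_cancel₀ _ hp0⟩
  obtain ⟨σ, hσ⟩ : ∃ σ, σ * c = p := ⟨p / c, div_mul_cancel₀ _ hc0⟩
  have hn : c = c - ι (0 : K) := by simp
  have hf := hch.of_factor_fst hn hm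
  have hs := hch.of_factor_snd hn hσ
  have hsτ : κ O.s * κ τ ≠ (0 : AlgebraicClosure K) :=
    mul_ne_zero (algebraMap_ne_zero O.s_ne_zero) (algebraMap_ne_zero hτ0)
  have hpDm : p * O.D m = ι O.s * (ι τ * (m - ι θ)) +
      p ^ 2 * (ι O.s * (-m ^ 3 + ι O.l2 * m ^ 2 - m * ι O.k)) := by
    rw [deriv_factor O.D hm, hDc, hDp, ← hm]
    linear_combination (ι O.s * 2 * m * (ι τ + (3 * ι a - (1 + ι O.x)) * (m * p) +
      (m * p) ^ 2)) * hpZ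
  have hDp' : O.D p = ι O.s * ι τ + p * (ι O.s * (2 * (3 * ι a - (1 + ι O.x)) * m +
      3 * (m ^ 2 * p) - (2 * ι O.l2 * (m * p + ι a) + ι O.l1) + ι O.k * p)) := by
    rw [hDp, ← hm]
    ring
  have hpt : HasValue p c (0, κ (0 : K)) = HasValue p c (0, 0) := by rw [map_zero]
  rw [← hpt]
  refine resolved_of_blowup O.preservesConstants hch hn hm hσ (fun t => ?_) (Or.inl ?_)
    (Or.inl ⟨κ θ, ?_⟩)
  · by_cases ht : t = κ θ
    · refine Or.inr (Or.inr ⟨θ, ht, ?_⟩)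
      rw [ht]
      -- Near `m = θ` both leading coefficients equal `s τ`. The logarithmic term is the derivative
      -- of `θ`, which is zero.
      refine resolved_of_resonance O.preservesConstants hf rfl (a := O.s * τ) (c := 0)
        (S := ι O.s * (-m ^ 3 + ι O.l2 * m ^ 2 - m * ι O.k))
        (R := ι O.s * (2 * (3 * ι a - (1 + ι O.x)) * m +
          3 * (m ^ 2 * p) - (2 * ι O.l2 * (m * p + ι a) + ι O.l1) + ι O.k * p)) (by
          repeat (with_reducible first
            | assumption | apply HasValue.fst | apply HasValue.snd | apply HasValue.const
            | apply HasValue.add | apply HasValue.sub | apply HasValue.mul | apply HasValue.neg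
            | apply HasValue.pow | apply HasValue.ofNat | apply HasValue.one)) (by
          repeat (with_reducible first
            | assumption | apply HasValue.fst | apply HasValue.snd | apply HasValue.const
            | apply HasValue.add | apply HasValue.sub | apply HasValue.mul | apply HasValue.neg
            | apply HasValue.pow | apply HasValue.ofNat | apply HasValue.one)) ?_ ?_
        (Or.inl (mul_ne_zero O.s_ne_zero hτ0))
      · rw [map_sub, O.D_const, hδ, map_zero, sub_zero, hpDm, map_mul]
        ring
      · rw [hDp', map_mul, map_zero]
        ring
    · refine Or.inr (Or.inl (polarPlace_of_snd O.preservesConstants hf (HasValue.fst _ _ _)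
        (a := 0) (b := κ O.s * κ τ * (t - κ θ)) ?_ ?_ (mul_ne_zero hsτ (sub_ne_zero.2 ht))))
      · rw [hDp']
        refine HasValue.congr_value (by
          repeat (with_reducible first
            | assumption | apply HasValue.fst | apply HasValue.snd | apply HasValue.const
            | apply HasValue.add | apply HasValue.sub | apply HasValue.mul | apply HasValue.neg
            | apply HasValue.pow | apply HasValue.ofNat | apply HasValue.one)) (zero_mul _)
      · rw [hpDm]
        refine HasValue.congr_value (by
          repeat (with_reducible first
            | assumption | apply HasValue.fst | apply HasValue.snd | apply HasValue.const
            | apply HasValue.add | apply HasValue.sub | apply HasValue.mul | apply HasValue.neg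
            | apply HasValue.pow | apply HasValue.ofNat | apply HasValue.one)) ?_
        simp
        ring
  · have hσDc : σ * O.D c = ι O.s * (2 * (ι τ + (3 * ι a - (1 + ι O.x)) * c + c ^ 2) -
        σ * (ι O.l2 * c ^ 2 + (2 * ι O.l2 * ι a + ι O.l1) * c) - σ * ι θ * ι τ) := by
      rw [hDc]
      linear_combination ι O.s * 2 * (ι τ + (3 * ι a - (1 + ι O.x)) * c + c ^ 2) *
        (O.Z * hσ + hpZ)
    have hcDσ : c * O.D σ = ι O.s * (ι τ + 2 * (3 * ι a - (1 + ι O.x)) * c + 3 * c ^ 2 -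
        (2 * ι O.l2 * (c + ι a) + ι O.l1) * (σ * c) + ι O.k * (σ * c) ^ 2) -
        ι O.s * (2 * (ι τ + (3 * ι a - (1 + ι O.x)) * c + c ^ 2) -
        σ * (ι O.l2 * c ^ 2 + (2 * ι O.l2 * ι a + ι O.l1) * c) - σ * ι θ * ι τ) := by
      rw [deriv_factor O.D hσ, hDp, hσDc, ← hσ]
    -- At this corner `D σ` has its pole along `c = 0` but `D c` has its pole along `σ = 0`, so no
    -- common multiplier exhibits the pole and `PolarAlong` replaces `PolarPlace`.
    refine polarAlong_of_fst O.preservesConstants hs (g := c) (a := -(κ O.s * κ τ))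
      (HasValue.snd _ _ _) ?_ (neg_ne_zero.2 hsτ) ?_
    · rw [hcDσ]
      refine HasValue.congr_value (by
          repeat (with_reducible first
            | assumption | apply HasValue.fst | apply HasValue.snd | apply HasValue.const
            | apply HasValue.add | apply HasValue.sub | apply HasValue.mul | apply HasValue.neg
            | apply HasValue.pow | apply HasValue.ofNat | apply HasValue.one)) ?_
      simp
      ring
    · have h1 : σ * c * O.D c = c * (σ * O.D c) := by ring
      rw [h1, hσDc]
      refine HasValue.congr_value (by
          repeat (with_reducible first
            | assumption | apply HasValue.fst | apply HasValue.snd | apply HasValue.const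
            | apply HasValue.add | apply HasValue.sub | apply HasValue.mul | apply HasValue.neg
            | apply HasValue.pow | apply HasValue.ofNat | apply HasValue.one)) (zero_mul _)
  · refine basePlace_of O.preservesConstants hf (b' := κ (θ + 1)) ?_ ?_ hsτ ?_
    · rw [hDp']
      refine HasValue.congr_value (by
          repeat (with_reducible first
            | assumption | apply HasValue.fst | apply HasValue.snd | apply HasValue.const
            | apply HasValue.add | apply HasValue.sub | apply HasValue.mul | apply HasValue.neg
            | apply HasValue.pow | apply HasValue.ofNat | apply HasValue.one)) (zero_mul _)
    · rw [hpDm]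
      refine HasValue.congr_value (by
          repeat (with_reducible first
            | assumption | apply HasValue.fst | apply HasValue.snd | apply HasValue.const
            | apply HasValue.add | apply HasValue.sub | apply HasValue.mul | apply HasValue.neg
            | apply HasValue.pow | apply HasValue.ofNat | apply HasValue.one)) ?_
      simp
    · rw [hpDm]
      refine HasValue.congr_value (by
          repeat (with_reducible first
            | assumption | apply HasValue.fst | apply HasValue.snd | apply HasValue.const
            | apply HasValue.add | apply HasValue.sub | apply HasValue.mul | apply HasValue.neg
            | apply HasValue.pow | apply HasValue.ofNat | apply HasValue.one)) ?_
      simp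

end Finite

end OkamotoPair

end OkamotoSystem

/-! ### Coordinates centred at an orbit, and the contracted line `Y = q`. -/

section Charts

set_option linter.unusedSectionVars false

local notation "ι" => algebraMap _ (RatFun _)
local notation "κ" => algebraMap _ (AlgebraicClosure _)

theorem regularPlace_of_eq {K : Type} [Field K] [Algebra ℂ K]
    {D : Derivation ℂ (RatFun K) (RatFun K)} (hD : PreservesConstants D) {u v f g : RatFun K} {p}
    (h : IsChart u v) (hu : D u = f) (hv : D v = g) {a b} (hf : HasValue u v p f a)
    (hg : HasValue u v p g b) : RegularPlace D (HasValue u v p) := by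
  subst hu hv
  exact regularPlace_of hD h hf hg

namespace OkamotoPair

variable {K : Type} [Field K] [Algebra ℂ K] (O : OkamotoPair K)

/-- The point `(q, h)` moves along an orbit of the system. -/
structure IsOrbit (q h : K) : Prop where
  deriv_fst : O.δ q = O.s * (2 * (q * (q - 1) * (q - O.x)) * h - (O.l2 * q ^ 2 + O.l1 * q + O.l0))
  deriv_snd : O.δ h = -(O.s * ((3 * q ^ 2 - 2 * (1 + O.x) * q + O.x) * h ^ 2 -
    (2 * O.l2 * q + O.l1) * h + O.k))
  ne_zero : q * (q - 1) * (q - O.x) ≠ 0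

variable {O} {q h : K} (hO : O.IsOrbit q h)

include hO

theorem IsOrbit.deriv_w : O.D (O.Y - ι q) = ι O.s * (2 * ι (q * (q - 1) * (q - O.x)) * (O.Z - ι h) +
    (O.Y - ι q) * (2 * (ι (3 * q ^ 2 - 2 * (1 + O.x) * q + O.x) + (3 * ι q - (1 + ι O.x)) *
      (O.Y - ι q) + (O.Y - ι q) ^ 2) * (O.Z - ι h + ι h) - (2 * ι O.l2 * ι q + ι O.l1) -
      ι O.l2 * (O.Y - ι q))) := by
  rw [map_sub, O.D_const, O.D_Y, hO.deriv_fst]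
  simp only [map_mul, map_add, map_sub, map_pow, map_one, map_ofNat]
  ring

theorem IsOrbit.deriv_ζ : O.D (O.Z - ι h) = -(ι O.s * (ι (3 * q ^ 2 - 2 * (1 + O.x) * q + O.x) *
    ((O.Z - ι h) ^ 2 + 2 * ι h * (O.Z - ι h)) + (2 * (3 * ι q - (1 + ι O.x)) * (O.Y - ι q) +
    3 * (O.Y - ι q) ^ 2) * (O.Z - ι h + ι h) ^ 2 - (2 * ι O.l2 * ι q + ι O.l1) * (O.Z - ι h) -
    2 * ι O.l2 * (O.Y - ι q) * (O.Z - ι h + ι h))) := by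
  rw [map_sub, O.D_const, O.D_Z, hO.deriv_snd]
  simp only [map_mul, map_add, map_sub, map_pow, map_one, map_ofNat, map_neg]
  ring

end OkamotoPair

namespace OkamotoPair

variable {K : Type} [Field K] [Algebra ℂ K] (O : OkamotoPair K)

theorem chart_shift (q h : K) : IsChart (O.Y - ι q) (O.Z - ι h) := by
  set F := IntermediateField.adjoin K {O.Y - ι q, O.Z - ι h}
  have h1 : O.Y - ι q ∈ F := IntermediateField.subset_adjoin _ _ (Or.inl rfl)
  have h2 : O.Z - ι h ∈ F := IntermediateField.subset_adjoin _ _ (Or.inr rfl)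
  refine O.chart.of_mem ?_ ?_
  · simpa using add_mem h1 (F.algebraMap_mem q)
  · simpa using add_mem h2 (F.algebraMap_mem h)

theorem _root_.IsChart.of_mul_eq {u v r : RatFun K} (h : IsChart u v) (hr : r * v = u) :
    IsChart r v := by
  set F := IntermediateField.adjoin K {r, v}
  have h1 : r ∈ F := IntermediateField.subset_adjoin _ _ (Or.inl rfl)
  have h2 : v ∈ F := IntermediateField.subset_adjoin _ _ (Or.inr rfl)
  exact h.of_mem (hr ▸ mul_mem h1 h2) h2

theorem _root_.IsChart.of_eq_mul {u v r : RatFun K} (h : IsChart u v) (hr : r * v = u) :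
    IsChart r u := by
  have hv := h.ne_zero_snd
  have hr0 : r ≠ 0 := by
    rintro rfl
    exact h.ne_zero_fst (by rw [← hr, zero_mul])
  set F := IntermediateField.adjoin K {r, u}
  have h1 : r ∈ F := IntermediateField.subset_adjoin _ _ (Or.inl rfl)
  have h2 : u ∈ F := IntermediateField.subset_adjoin _ _ (Or.inr rfl)
  refine h.of_mem h2 ?_
  have h3 : v = u / r := by rw [← hr, mul_div_cancel_left₀ _ hr0]
  exact h3 ▸ div_mem h2 h1

variable {O} {q h : K}

set_option maxHeartbeats 1000000 in
/-- The cascades over the place `r = w = 0`, where `r` is the quotient of `w = Y - q` by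
`ζ = Z - h`. -/
theorem IsOrbit.resolved_orbit (hO : O.IsOrbit q h) (h2 : (2 : K) ≠ 0) {r : RatFun K}
    (hr : r * (O.Z - ι h) = O.Y - ι q) :
    Resolved O.D (HasValue r (O.Y - ι q) (0, 0)) r := by
  have hDw := hO.deriv_w
  have hDζ := hO.deriv_ζ
  have hch := O.chart_shift q h
  set w := O.Y - ι q with hw
  set ζ := O.Z - ι h with hζ
  set Tq := q * (q - 1) * (q - O.x) with hTq
  set Tq' := 3 * q ^ 2 - 2 * (1 + O.x) * q + O.x with hTq'
  have hr1 := hch.of_mul_eq hr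
  have hr2 := hch.of_eq_mul hr
  have hζ0 := hch.ne_zero_snd
  have hw0 := hch.ne_zero_fst
  obtain ⟨σ, hσ⟩ : ∃ σ, σ * w = r := ⟨r / w, div_mul_cancel₀ _ hw0⟩
  have hσζ : σ * ζ = 1 := by
    apply mul_left_cancel₀ hw0
    linear_combination hr + ζ * hσ
  have hn : w = w - ι (0 : K) := by simp
  have hs := hr2.of_factor_snd hn hσ
  have hsT : κ O.s * (2 * κ Tq) ≠ (0 : AlgebraicClosure K) := by
    have h4 := algebraMap_ne_zero h2
    rw [map_ofNat] at h4
    exact mul_ne_zero (algebraMap_ne_zero O.s_ne_zero)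
      (mul_ne_zero h4 (algebraMap_ne_zero hO.ne_zero))
  -- The exceptional curve is the line `Y = q`, contracted in the coordinates `r`, `w` and
  -- parametrised here by `ζ`. Division by `ζ` succeeds because the expansions at the orbit have no
  -- constant terms.
  have hreg : ∀ t, RegularPlace O.D (HasValue r ζ (0, t)) := by
    intro t
    have hDr : O.D r = ι O.s * (2 * ι Tq + r * (2 * (ι Tq' + (3 * ι q - (1 + ι O.x)) * (r * ζ) +
        (r * ζ) ^ 2) * (ζ + ι h) - (2 * ι O.l2 * ι q + ι O.l1) - ι O.l2 * (r * ζ))) +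
        r * (ι O.s * (ι Tq' * (ζ + 2 * ι h) + (2 * (3 * ι q - (1 + ι O.x)) * r + 3 * r ^ 2 * ζ) *
        (ζ + ι h) ^ 2 - (2 * ι O.l2 * ι q + ι O.l1) - 2 * ι O.l2 * r * (ζ + ι h))) := by
      apply mul_left_cancel₀ hζ0
      rw [deriv_factor O.D hr, hDw, hDζ, ← hr]
      ring
    rw [← hr] at hDζ
    exact regularPlace_of_eq O.preservesConstants hr1 hDr hDζ (by
          repeat (with_reducible first
            | assumption | apply HasValue.fst | apply HasValue.snd | apply HasValue.const
            | apply HasValue.add | apply HasValue.sub | apply HasValue.mul | apply HasValue.neg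
            | apply HasValue.pow | apply HasValue.ofNat | apply HasValue.one)) (by
          repeat (with_reducible first
            | assumption | apply HasValue.fst | apply HasValue.snd | apply HasValue.const
            | apply HasValue.add | apply HasValue.sub | apply HasValue.mul | apply HasValue.neg
            | apply HasValue.pow | apply HasValue.ofNat | apply HasValue.one))
  have hpt : HasValue r w (0, κ (0 : K)) = HasValue r w (0, 0) := by rw [map_zero]
  rw [← hpt]
  refine resolved_of_blowup O.preservesConstants hr2 hn (by rw [mul_comm, hr]) hσ
    (fun t => Or.inl (hreg t)) (Or.inr (Or.inl ?_)) (Or.inr (Or.inr hreg))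
  have hσDw : σ * O.D w = ι O.s * (2 * ι Tq + w * (2 * (ι Tq' + (3 * ι q - (1 + ι O.x)) * w +
      w ^ 2) * (1 + ι h * σ) - σ * (2 * ι O.l2 * ι q + ι O.l1) - σ * (ι O.l2 * w))) := by
    rw [hDw]
    linear_combination ι O.s * (2 * ι Tq + w * (2 * (ι Tq' + (3 * ι q - (1 + ι O.x)) * w +
      w ^ 2))) * hσζ
  have hDσ : O.D σ = ι O.s * (ι Tq' * (1 + 2 * ι h * σ) + (2 * (3 * ι q - (1 + ι O.x)) * w +
      3 * w ^ 2) * (1 + ι h * σ) ^ 2 - (2 * ι O.l2 * ι q + ι O.l1) * σ -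
      2 * ι O.l2 * w * σ * (1 + ι h * σ)) := by
    have h1 := deriv_factor O.D hσζ
    rw [Derivation.map_one_eq_zero, hDζ] at h1
    apply mul_left_cancel₀ hζ0
    rw [h1]
    obtain rfl : σ = ζ⁻¹ := eq_inv_of_mul_eq_one_left hσζ
    field_simp
    ring
  refine ⟨σ, HasValue.fst _ _ _, ⟨_, hsT, ?_⟩, fun f c hf => deriv_vanishes O.preservesConstants hs
    ?_ ?_ ?_ hf⟩
  · rw [hσDw]
    refine HasValue.congr_value (by
          repeat (with_reducible first
            | assumption | apply HasValue.fst | apply HasValue.snd | apply HasValue.const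
            | apply HasValue.add | apply HasValue.sub | apply HasValue.mul | apply HasValue.neg
            | apply HasValue.pow | apply HasValue.ofNat | apply HasValue.one)) ?_
    simp
  · refine HasValue.congr_value (by
          repeat (with_reducible first
            | assumption | apply HasValue.fst | apply HasValue.snd | apply HasValue.const
            | apply HasValue.add | apply HasValue.sub | apply HasValue.mul | apply HasValue.neg
            | apply HasValue.pow | apply HasValue.ofNat | apply HasValue.one)) ?_
    simp
  · rw [hDσ]
    refine HasValue.congr_value (by
          repeat (with_reducible first
            | assumption | apply HasValue.fst | apply HasValue.snd | apply HasValue.const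
            | apply HasValue.add | apply HasValue.sub | apply HasValue.mul | apply HasValue.neg
            | apply HasValue.pow | apply HasValue.ofNat | apply HasValue.one)) ?_
    simp
  · have h1 : w * σ * O.D w = w * (σ * O.D w) := by ring
    rw [h1, hσDw]
    refine HasValue.congr_value (by
          repeat (with_reducible first
            | assumption | apply HasValue.fst | apply HasValue.snd | apply HasValue.const
            | apply HasValue.add | apply HasValue.sub | apply HasValue.mul | apply HasValue.neg
            | apply HasValue.pow | apply HasValue.ofNat | apply HasValue.one)) ?_
    simp

/-- The place `Z = ∞`, `Y = a` in the coordinates `r`, `w`. -/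
theorem place_finite {r : RatFun K} (hr : r * (O.Z - ι h) = O.Y - ι q) {a : K} (ha : a ≠ q) :
    HasValue r (O.Y - ι q) (0, κ (a - q)) = HasValue O.Z⁻¹ (O.Y - ι a) (0, 0) ∧
      ∃ g c, c ≠ 0 ∧ HasValue O.Z⁻¹ (O.Y - ι a) (0, 0) g c ∧ r = g * O.Z⁻¹ := by
  have hch := O.chart_shift q h
  have h1 := hch.of_eq_mul hr
  have h2 := O.chart_finite a
  have hr0 := h1.ne_zero_fst
  have hZ := O.chart.ne_zero_snd
  have hw0 := hch.ne_zero_fst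
  have hζ0 := hch.ne_zero_snd
  have haq : κ (a - q) ≠ (0 : AlgebraicClosure K) := algebraMap_ne_zero (sub_ne_zero.2 ha)
  have hp := HasValue.fst O.Z⁻¹ (O.Y - ι a) (0, 0)
  have hc := HasValue.snd O.Z⁻¹ (O.Y - ι a) (0, 0)
  have hw : HasValue O.Z⁻¹ (O.Y - ι a) (0, 0) (O.Y - ι q) (κ (a - q)) := by
    have h3 := hc.add (HasValue.const _ _ _ (a - q))
    rw [map_sub, sub_add_sub_cancel] at h3
    exact h3.congr_value (zero_add _)
  have hden : HasValue O.Z⁻¹ (O.Y - ι a) (0, 0) (1 - ι h * O.Z⁻¹) 1 :=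
    ((HasValue.one _ _ _).sub ((HasValue.const _ _ _ h).mul hp)).congr_value (by simp)
  have hg := hw.div h2 hden one_ne_zero
  have hden0 := hden.ne_zero h2 one_ne_zero
  -- Near `Z = ∞`, `Y = a` the factor relating `r` to `1/Z` is a unit with value `a - q`.
  have hrg : r = (O.Y - ι q) / (1 - ι h * O.Z⁻¹) * O.Z⁻¹ := by
    rw [div_mul_eq_mul_div, eq_div_iff hden0, ← hr]
    field_simp
  refine ⟨HasValue.place_eq h1 h2 ?_ ?_ ?_ hw, _, _, ?_, hg, hrg⟩
  · have hr' := HasValue.fst r (O.Y - ι q) (0, κ (a - q))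
    have hw' := HasValue.snd r (O.Y - ι q) (0, κ (a - q))
    have h3 := (hw'.add ((HasValue.const _ _ _ h).mul hr')).congr_value
      (show _ = κ (a - q) by simp)
    have h4 := (hr'.div h1 h3 haq).congr_value (zero_div _)
    have h5 : r / (O.Y - ι q + ι h * r) = O.Z⁻¹ := by
      have h6 : O.Y - ι q + ι h * r = r * O.Z := by rw [← hr]; ring
      rw [h6]
      field_simp
    rwa [h5] at h4
  · have hw' := HasValue.snd r (O.Y - ι q) (0, κ (a - q))
    have h3 := hw'.sub (HasValue.const _ _ _ (a - q))
    have h4 : O.Y - ι q - ι (a - q) = O.Y - ι a := by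
      rw [map_sub]
      ring
    rw [h4] at h3
    exact h3.congr_value (sub_self _)
  · rw [hrg]
    exact (hg.mul hp).congr_value (mul_zero _)
  · rwa [div_one]

end OkamotoPair

end Charts

/-! ### The affine chart and the chart `(1/y, w/y)`. -/

section OrbitCharts

set_option linter.unusedSectionVars false

local notation "ι" => algebraMap _ (RatFun _)
local notation "κ" => algebraMap _ (AlgebraicClosure _)

namespace OkamotoPair

variable {K : Type} [Field K] [Algebra ℂ K] {O : OkamotoPair K} {q h : K}

set_option maxHeartbeats 1000000 in
/-- The system in the coordinates `Y - q`, `Z - h` centred at the orbit. -/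
theorem IsOrbit.exists_expansion (hO : O.IsOrbit q h) : ∃ τ₁ τ₂ l₁ l₂ : K,
    (O.D (O.Y - ι q) = ι O.s * (2 * ι (q * (q - 1) * (q - O.x)) * (O.Z - ι h) +
      (O.Y - ι q) * (2 * (ι τ₁ + ι τ₂ * (O.Y - ι q) + (O.Y - ι q) ^ 2) * (O.Z - ι h + ι h) -
        ι l₁ - ι l₂ * (O.Y - ι q)))) ∧
    (O.D (O.Z - ι h) = -(ι O.s * (ι τ₁ * ((O.Z - ι h) ^ 2 + 2 * ι h * (O.Z - ι h)) +
      (2 * ι τ₂ * (O.Y - ι q) + 3 * (O.Y - ι q) ^ 2) * (O.Z - ι h + ι h) ^ 2 -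
      ι l₁ * (O.Z - ι h) - 2 * ι l₂ * (O.Y - ι q) * (O.Z - ι h + ι h)))) ∧
    ∀ t : AlgebraicClosure K, κ (q * (q - 1) * (q - O.x)) + κ τ₁ * t + κ τ₂ * t ^ 2 + t ^ 3 =
      (t + κ q) * (t + κ q - 1) * (t + κ q - κ O.x) := by
  have h1 : (ι (3 * q - (1 + O.x)) : RatFun K) = 3 * ι q - (1 + ι O.x) := by
    simp only [map_mul, map_add, map_sub, map_one, map_ofNat]
  have h2 : (ι (2 * O.l2 * q + O.l1) : RatFun K) = 2 * ι O.l2 * ι q + ι O.l1 := by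
    simp only [map_mul, map_add, map_ofNat]
  -- Taylor coefficients at `q`: the first derivative and half the second derivative of the cubic,
  -- then the slope and the leading coefficient of the quadratic.
  refine ⟨3 * q ^ 2 - 2 * (1 + O.x) * q + O.x, 3 * q - (1 + O.x), 2 * O.l2 * q + O.l1, O.l2,
    ?_, ?_, fun t => ?_⟩
  · rw [hO.deriv_w, h1, h2]
  · rw [hO.deriv_ζ, h1, h2]
  · simp only [map_mul, map_add, map_sub, map_pow, map_one, map_ofNat]
    ring

/-- The coordinate `y`, the quotient of `Z - h` by `Y - q`, satisfies a polynomial equation. -/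
theorem deriv_quotient {D : Derivation ℂ (RatFun K) (RatFun K)} {y w ζ : RatFun K}
    {s h T τ₁ τ₂ l₁ l₂ : RatFun K} (hw0 : w ≠ 0) (hy : y * w = ζ)
    (hw : D w = s * (2 * T * ζ + w * (2 * (τ₁ + τ₂ * w + w ^ 2) * (ζ + h) - l₁ - l₂ * w)))
    (hζ : D ζ = -(s * (τ₁ * (ζ ^ 2 + 2 * h * ζ) + (2 * τ₂ * w + 3 * w ^ 2) * (ζ + h) ^ 2 -
      l₁ * ζ - 2 * l₂ * w * (ζ + h)))) :
    D y = -(s * (τ₁ * (y ^ 2 * w + 2 * h * y) + (2 * τ₂ + 3 * w) * (y * w + h) ^ 2 -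
      l₁ * y - 2 * l₂ * (y * w + h))) -
      y * s * (2 * T * y + 2 * (τ₁ + τ₂ * w + w ^ 2) * (y * w + h) - l₁ - l₂ * w) := by
  apply mul_left_cancel₀ hw0
  rw [deriv_factor D hy, hζ, hw, ← hy]
  ring

theorem chart_quotient {y : RatFun K} (hy : y * (O.Y - ι q) = O.Z - ι h) :
    IsChart y (O.Y - ι q) :=
  (O.chart_shift q h).symm.of_mul_eq hy

/-- The system is regular at every finite point in the coordinates `y`, `Y - q`. -/
theorem IsOrbit.regularPlace_affine (hO : O.IsOrbit q h) {y : RatFun K}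
    (hy : y * (O.Y - ι q) = O.Z - ι h) (p) :
    RegularPlace O.D (HasValue y (O.Y - ι q) p) := by
  obtain ⟨τ₁, τ₂, l₁, l₂, hDw, hDζ, -⟩ := hO.exists_expansion
  have hDy := deriv_quotient (O.chart_shift q h).ne_zero_fst hy hDw hDζ
  have hch := chart_quotient hy
  set w := O.Y - ι q
  rw [← hy] at hDw
  exact regularPlace_of_eq O.preservesConstants hch hDy hDw (by
          repeat (with_reducible first
            | assumption | apply HasValue.fst | apply HasValue.snd | apply HasValue.const
            | apply HasValue.add | apply HasValue.sub | apply HasValue.mul | apply HasValue.neg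
            | apply HasValue.pow | apply HasValue.ofNat | apply HasValue.one)) (by
          repeat (with_reducible first
            | assumption | apply HasValue.fst | apply HasValue.snd | apply HasValue.const
            | apply HasValue.add | apply HasValue.sub | apply HasValue.mul | apply HasValue.neg
            | apply HasValue.pow | apply HasValue.ofNat | apply HasValue.one))

set_option maxHeartbeats 1000000 in
-- On the line at infinity the cleared numerators reduce to `5 s t ^ 3` and `7 s t ^ 4`: a true pole
-- for `t ≠ 0`, and simultaneous vanishing only at the origin.
theorem IsOrbit.deriv_chart_fst (hO : O.IsOrbit q h) {y r v : RatFun K}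
    (hy : y * (O.Y - ι q) = O.Z - ι h) (hr : r * y = 1) (hv : v = r * (O.Y - ι q)) :
    IsChart r v ∧ ∃ F G : RatFun K, O.D r * r ^ 3 = F ∧ O.D v * r ^ 4 = G ∧
      ∀ t, HasValue r v (0, t) F (5 * κ O.s * t ^ 3) ∧
        HasValue r v (0, t) G (7 * κ O.s * t ^ 4) := by
  obtain ⟨τ₁, τ₂, l₁, l₂, hDw, hDζ, -⟩ := hO.exists_expansion
  have hDy := deriv_quotient (O.chart_shift q h).ne_zero_fst hy hDw hDζ
  have hch := chart_quotient hy
  have hr0 : r ≠ 0 := left_ne_zero_of_mul_eq_one hr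
  set w := O.Y - ι q
  set T := q * (q - 1) * (q - O.x)
  obtain rfl : y = r⁻¹ := eq_inv_of_mul_eq_one_right hr
  have hw : w = v * r⁻¹ := by rw [hv]; field_simp
  have hchart : IsChart r v := by
    set F := IntermediateField.adjoin K {r, v}
    have h1 : r ∈ F := IntermediateField.subset_adjoin _ _ (Or.inl rfl)
    have h2 : v ∈ F := IntermediateField.subset_adjoin _ _ (Or.inr rfl)
    exact hch.of_mem (inv_mem h1) (hw ▸ mul_mem h2 (inv_mem h1))
  have h5w : O.D w * r ^ 5 = ι O.s * (2 * ι T * v * r ^ 3 + v * (2 * (ι τ₁ * r ^ 2 +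
      ι τ₂ * v * r + v ^ 2) * (v + ι h * r ^ 2) - ι l₁ * r ^ 4 - ι l₂ * v * r ^ 3)) := by
    rw [hDw, ← hy, hw]
    field_simp
  have h5y : O.D r⁻¹ * r ^ 5 = -(ι O.s * (ι τ₁ * (v * r ^ 2 + 2 * ι h * r ^ 4) +
      (2 * ι τ₂ * r + 3 * v) * (v + ι h * r ^ 2) ^ 2 - ι l₁ * r ^ 4 -
      2 * ι l₂ * r ^ 3 * (v + ι h * r ^ 2))) - ι O.s * (2 * ι T * r ^ 3 +
      2 * (ι τ₁ * r ^ 2 + ι τ₂ * v * r + v ^ 2) * (v + ι h * r ^ 2) - ι l₁ * r ^ 4 -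
      ι l₂ * v * r ^ 3) := by
    rw [hDy, hw]
    field_simp
  have h3r : O.D r * r ^ 3 = -(O.D r⁻¹ * r ^ 5) := by
    rw [Derivation.leibniz_inv, smul_eq_mul]
    field_simp
  have h4v : O.D v * r ^ 4 = O.D w * r ^ 5 + v * (O.D r * r ^ 3) := by
    rw [hv, Derivation.leibniz, smul_eq_mul, smul_eq_mul]
    ring
  rw [h3r] at h4v
  refine ⟨hchart, _, _, h3r, h4v, fun t => ⟨?_, ?_⟩⟩
  · rw [h5y]
    refine HasValue.congr_value (by
          repeat (with_reducible first
            | assumption | apply HasValue.fst | apply HasValue.snd | apply HasValue.const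
            | apply HasValue.add | apply HasValue.sub | apply HasValue.mul | apply HasValue.neg
            | apply HasValue.pow | apply HasValue.ofNat | apply HasValue.one)) ?_
    simp
    ring
  · rw [h5w, h5y]
    refine HasValue.congr_value (by
          repeat (with_reducible first
            | assumption | apply HasValue.fst | apply HasValue.snd | apply HasValue.const
            | apply HasValue.add | apply HasValue.sub | apply HasValue.mul | apply HasValue.neg
            | apply HasValue.pow | apply HasValue.ofNat | apply HasValue.one)) ?_
    simp
    ring

theorem ofNat_mul_ne_zero (n : ℕ) [n.AtLeastTwo] {a : K} (ha : a ≠ 0) :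
    (OfNat.ofNat n : AlgebraicClosure K) * κ a ≠ 0 := by
  have : CharZero K := charZero_of_injective_algebraMap (algebraMap ℂ K).injective
  refine mul_ne_zero ?_ (algebraMap_ne_zero ha)
  exact OfNat.ofNat_ne_zero n

/-- In the chart `(1/y, w/y)` the only base point is the origin. -/
theorem IsOrbit.isBasePoint_fst_iff (hO : O.IsOrbit q h) {y r v : RatFun K}
    (hy : y * (O.Y - ι q) = O.Z - ι h) (hr : r * y = 1) (hv : v = r * (O.Y - ι q)) (p) :
    IsBasePoint O.D r v p ↔ p = (0, 0) := by
  obtain ⟨hch, F, G, hF, hG, hval⟩ := hO.deriv_chart_fst hy hr hv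
  obtain ⟨a, b⟩ := p
  constructor
  · intro hb
    by_cases ha : a = 0
    · subst ha
      by_cases hb0 : b = 0
      · rw [hb0]
      · refine absurd hb (not_isBasePoint_of_fst hch (g := r ^ 3)
          (((HasValue.fst r v (0, b)).pow 3).congr_value (zero_pow three_ne_zero))
          (mul_ne_zero (ofNat_mul_ne_zero 5 O.s_ne_zero) (pow_ne_zero 3 hb0)) ?_)
        rw [mul_comm, hF]
        exact (hval b).1
    · refine absurd hb (RegularPlace.not_isBasePoint hch ?_)
      have hch' := chart_quotient hy
      have hr0 : r ≠ 0 := left_ne_zero_of_mul_eq_one hr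
      have hyr : y = r⁻¹ := eq_inv_of_mul_eq_one_right hr
      have h1 : HasValue r v (a, b) y a⁻¹ := by
        rw [hyr]
        exact (HasValue.fst r v (a, b)).inv hch ha
      have h2 : HasValue r v (a, b) (O.Y - ι q) (b / a) := by
        have h3 : O.Y - ι q = v / r := by rw [hv]; field_simp
        rw [h3]
        exact (HasValue.snd r v (a, b)).div hch (HasValue.fst r v (a, b)) ha
      have h3 : HasValue y (O.Y - ι q) (a⁻¹, b / a) r a := by
        have h4 := (HasValue.fst y (O.Y - ι q) (a⁻¹, b / a)).inv hch' (inv_ne_zero ha)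
        rw [hyr] at h4 ⊢
        simpa using h4
      have h4 : HasValue y (O.Y - ι q) (a⁻¹, b / a) v b := by
        rw [hv]
        exact (h3.mul (HasValue.snd _ _ _)).congr_value (mul_div_cancel₀ b ha)
      rw [HasValue.place_eq (p' := (a⁻¹, b / a)) hch hch' h1 h2 h3 h4]
      exact hO.regularPlace_affine hy _
  · intro hp
    obtain ⟨rfl, rfl⟩ := Prod.mk.inj hp
    have h1 : IsIndeterminateAt r v (O.D r) (0, 0) := hch.isIndeterminateAt three_ne_zero hF
      ((hval 0).1.congr_value (by simp)) (mul_ne_zero (ofNat_mul_ne_zero 5 O.s_ne_zero)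
      (pow_ne_zero 3 one_ne_zero)) (hval 1).1
    have h2 : IsIndeterminateAt r v (O.D v) (0, 0) := hch.isIndeterminateAt four_ne_zero hG
      ((hval 0).2.congr_value (by simp)) (mul_ne_zero (ofNat_mul_ne_zero 7 O.s_ne_zero)
      (pow_ne_zero 4 one_ne_zero)) (hval 1).2
    exact ⟨Or.inl h1, Or.inr h1, Or.inr h2⟩

/-- At the singular points `0, 1, x` the residues of the equation for `Y` are constants. -/
def IsFuchsian (O : OkamotoPair K) : Prop :=
  ∀ a, a * (a - 1) * (a - O.x) = 0 → ∃ θ τ, O.δ θ = 0 ∧ τ ≠ 0 ∧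
    τ = 3 * a ^ 2 - 2 * (1 + O.x) * a + O.x ∧
    O.s * (O.l2 * a ^ 2 + O.l1 * a + O.l0) + O.δ a = O.s * θ * τ

set_option maxHeartbeats 1000000 in
/-- The cascades over the origin of the chart `(1/y, w/y)` are regularised. -/
theorem IsOrbit.cascades_fst (hO : O.IsOrbit q h) (hF : O.IsFuchsian) {y r v : RatFun K}
    (hy : y * (O.Y - ι q) = O.Z - ι h) (hr : r * y = 1) (hv : v = r * (O.Y - ι q)) :
    CascadesRegularised O.D r v 0 0 := by
  have : CharZero K := charZero_of_injective_algebraMap (algebraMap ℂ K).injective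
  obtain ⟨hch, -⟩ := hO.deriv_chart_fst hy hr hv
  obtain ⟨τ₁, τ₂, l₁, l₂, hDw, hDζ, hT⟩ := hO.exists_expansion
  have hrζ : r * (O.Z - ι h) = O.Y - ι q := by
    rw [← hy]
    linear_combination (O.Y - ι q) * hr
  have hch1 := (O.chart_shift q h).of_eq_mul hrζ
  have hw0 := (O.chart_shift q h).ne_zero_fst
  have hq0 : q * (q - 1) * (q - O.x) ≠ 0 := hO.ne_zero
  have hne : ∀ a, a * (a - 1) * (a - O.x) = 0 → a ≠ q := by
    rintro a ha rfl
    exact hq0 ha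
  have hfinite : ∀ a, a * (a - 1) * (a - O.x) = 0 →
      Resolved O.D (HasValue r (O.Y - ι q) (0, κ (a - q))) r := by
    intro a ha
    obtain ⟨θ, τ, hδ, hτ0, hτ, hθ⟩ := hF a ha
    obtain ⟨hp, g, c, hc, hg, hrg⟩ := place_finite hrζ (hne a ha)
    rw [hp, hrg]
    exact (O.resolved_finite ha hθ hτ hτ0 hδ).unit_mul rfl hg hc
  -- A single base point on the exceptional curve makes the final regularity requirement void; the
  -- one over `Y = 0` serves.
  have hbase : IsBasePoint O.D r (O.Y - ι q) (0, κ (0 - q)) := by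
    have ha : (0 : K) * (0 - 1) * (0 - O.x) = 0 := by simp
    obtain ⟨θ, τ, hδ, hτ0, hτ, hθ⟩ := hF 0 ha
    refine BasePlace.isBasePoint O.preservesConstants hch1 ?_
    rw [(place_finite hrζ (hne 0 ha)).1]
    exact O.basePlace_finite ha hθ hτ two_ne_zero hq0
  have horbit := hO.resolved_orbit two_ne_zero hrζ
  clear hy
  set w := O.Y - ι q
  set ζ := O.Z - ι h
  set T := q * (q - 1) * (q - O.x)
  have hn : r * w = v - ι (0 : K) := by rw [map_zero, sub_zero, hv]
  have hr0 : r ≠ 0 := hch.ne_zero_fst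
  have hζ : ζ = w * r⁻¹ := by rw [← hrζ]; field_simp
  obtain ⟨σ, hσ⟩ : ∃ σ, σ * (r * w) = r := ⟨r / (r * w), div_mul_cancel₀ _ (mul_ne_zero hr0 hw0)⟩
  have hσw : σ * w = 1 := by
    apply mul_left_cancel₀ hr0
    linear_combination hσ
  have hrDw : r * O.D w = ι O.s * (2 * ι T * w + w * (2 * (ι τ₁ + ι τ₂ * w + w ^ 2) *
      (w + r * ι h) - r * ι l₁ - r * ι l₂ * w)) := by
    rw [hDw, hζ]
    field_simp
  have hrDζ : r ^ 2 * O.D ζ = -(ι O.s * (ι τ₁ * (w ^ 2 + 2 * ι h * w * r) +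
      (2 * ι τ₂ * w + 3 * w ^ 2) * (w + ι h * r) ^ 2 - ι l₁ * w * r -
      2 * ι l₂ * w * r * (w + ι h * r))) := by
    rw [hDζ, hζ]
    field_simp
  have hrDr : r * O.D r = (r * (r * O.D w) - r * (r ^ 2 * O.D ζ)) / w := by
    rw [eq_div_iff hw0]
    have h1 := deriv_factor O.D (mul_comm ζ r ▸ hrζ : ζ * r = w)
    have h2 : w = r * ζ := hrζ.symm
    rw [show r * O.D r * w = r ^ 2 * (ζ * O.D r) by rw [h2]; ring]
    linear_combination r ^ 2 * h1
  refine cascadesRegularised_of_blowup O.preservesConstants hch hn (mul_comm w r) hσ (fun t => ?_)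
    (Or.inl ?_) (Or.inl ⟨_, hbase⟩)
  -- On the exceptional curve `r * D w` takes the value `2 s t` times the cubic at `q + t`. Its
  -- zeros are the contracted line, `t = 0`, and the points `Y = 0, 1, x`; elsewhere there is a
  -- pole.
  · by_cases ht : t = 0
    · refine Or.inr (Or.inr (Or.inl ⟨0, ?_, ?_⟩))
      · rw [ht, map_zero]
      · rwa [ht]
    by_cases htT : (t + κ q) * (t + κ q - 1) * (t + κ q - κ O.x) = 0
    · refine Or.inr (Or.inr (Or.inl ?_))
      obtain ⟨a, ha, hta⟩ : ∃ a : K, a * (a - 1) * (a - O.x) = 0 ∧ t = κ (a - q) := by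
        rcases mul_eq_zero.1 htT with h1 | h1
        · rcases mul_eq_zero.1 h1 with h2 | h2
          · exact ⟨0, by simp, by rw [zero_sub, map_neg]; linear_combination h2⟩
          · exact ⟨1, by simp, by rw [map_sub, map_one]; linear_combination h2⟩
        · exact ⟨O.x, by simp, by rw [map_sub]; linear_combination h1⟩
      exact ⟨a - q, hta, hta ▸ hfinite a ha⟩
    · refine Or.inr (Or.inl (polarPlace_of_snd O.preservesConstants hch1 (HasValue.fst _ _ _)
        (a := 0) (b := 2 * κ O.s * (t * ((t + κ q) * (t + κ q - 1) * (t + κ q - κ O.x)))) ?_ ?_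
        (mul_ne_zero (ofNat_mul_ne_zero 2 O.s_ne_zero) (mul_ne_zero ht htT))))
      · rw [hrDr, hrDw, hrDζ]
        refine HasValue.congr_value (HasValue.div hch1 (by
          repeat (with_reducible first
            | assumption | apply HasValue.fst | apply HasValue.snd | apply HasValue.const
            | apply HasValue.add | apply HasValue.sub | apply HasValue.mul | apply HasValue.neg
            | apply HasValue.pow | apply HasValue.ofNat | apply HasValue.one)) (HasValue.snd _ _ _) ht) ?_
        simp
      · rw [hrDw]
        refine HasValue.congr_value (by
          repeat (with_reducible first
            | assumption | apply HasValue.fst | apply HasValue.snd | apply HasValue.const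
            | apply HasValue.add | apply HasValue.sub | apply HasValue.mul | apply HasValue.neg
            | apply HasValue.pow | apply HasValue.ofNat | apply HasValue.one)) ?_
        rw [← hT]
        simp
        ring
  · have hch2 := hch.of_factor_snd hn hσ
    set n := r * w with hn'
    -- At this corner `D σ` has leading term `-2 s / (σ ^ 3 n)`.
    refine not_isBasePoint_of_fst hch2 (g := σ ^ 3 * n) (d := -(2 * κ O.s))
      (HasValue.congr_value (by
          repeat (with_reducible first
            | assumption | apply HasValue.fst | apply HasValue.snd | apply HasValue.const
            | apply HasValue.add | apply HasValue.sub | apply HasValue.mul | apply HasValue.neg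
            | apply HasValue.pow | apply HasValue.ofNat | apply HasValue.one)) (mul_zero _)) (neg_ne_zero.2 (ofNat_mul_ne_zero 2 O.s_ne_zero)) ?_
    have h1 : σ ^ 3 * n * O.D σ = -(ι O.s * (2 * ι T * σ ^ 3 + 2 * (ι τ₁ * σ ^ 2 + ι τ₂ * σ + 1) *
        (1 + ι h * σ ^ 2 * n) - ι l₁ * σ ^ 4 * n - ι l₂ * σ ^ 3 * n)) := by
      obtain rfl : σ = w⁻¹ := eq_inv_of_mul_eq_one_left hσw
      rw [Derivation.leibniz_inv, smul_eq_mul, hDw, hζ, hn']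
      field_simp
      ring
    rw [h1]
    refine HasValue.congr_value (by
          repeat (with_reducible first
            | assumption | apply HasValue.fst | apply HasValue.snd | apply HasValue.const
            | apply HasValue.add | apply HasValue.sub | apply HasValue.mul | apply HasValue.neg
            | apply HasValue.pow | apply HasValue.ofNat | apply HasValue.one)) ?_
    simp [mul_comm]

end OkamotoPair

end OrbitCharts

/-! ### The chart `(1/w, y/w)`: two blow-ups down to `Y = ∞`, `Z = 0`. -/

section VerticalChart

set_option linter.unusedSectionVars false

local notation "ι" => algebraMap _ (RatFun _)
local notation "κ" => algebraMap _ (AlgebraicClosure _)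

theorem CascadesRegularised.next_factor {K : Type} [Field K] [Algebra ℂ K]
    {D : Derivation ℂ (RatFun K) (RatFun K)} {e v n τ : RatFun K} {b s : K}
    (hc : CascadesRegularised D e v 0 b) (he : e ≠ 0) (hn : n = v - ι b) (hτ : τ * e = n)
    (hb : IsBasePoint D e τ (0, κ s)) : CascadesRegularised D e τ 0 s := by
  have h1 : (blowupFst e v 0 b).1 = e := by simp [blowupFst]
  have h2 : (blowupFst e v 0 b).2 = τ := by
    simp only [blowupFst, map_zero, sub_zero]
    rw [← hn, ← hτ, mul_div_cancel_right₀ _ he]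
  cases hc with
  | blowup _ _ _ _ _ _ next _ _ =>
    rw [h1, h2] at next
    exact next s hb

namespace OkamotoPair

variable {K : Type} [Field K] [Algebra ℂ K] {O : OkamotoPair K} {q h : K}

set_option maxHeartbeats 1000000 in
-- As in the other chart at infinity, the cleared numerators `-2 s t` and `-7 s t ^ 2` vanish on the
-- line at infinity only at the origin.
theorem IsOrbit.deriv_chart_snd (hO : O.IsOrbit q h) {y ω α : RatFun K}
    (hy : y * (O.Y - ι q) = O.Z - ι h) (hω : ω * (O.Y - ι q) = 1) (hα : y * ω = α) :
    IsChart ω α ∧ ∃ F G : RatFun K, O.D ω * ω ^ 3 = F ∧ O.D α * ω ^ 4 = G ∧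
      ∀ t, HasValue ω α (0, t) F (-(2 * κ O.s) * t) ∧
        HasValue ω α (0, t) G (-(7 * κ O.s) * t ^ 2) := by
  obtain ⟨τ₁, τ₂, l₁, l₂, hDw, hDζ, -⟩ := hO.exists_expansion
  have hDy := deriv_quotient (O.chart_shift q h).ne_zero_fst hy hDw hDζ
  have hch := chart_quotient hy
  have hω0 : ω ≠ 0 := left_ne_zero_of_mul_eq_one hω
  rw [← hy] at hDw
  set w := O.Y - ι q
  set T := q * (q - 1) * (q - O.x)
  have hw : w = ω⁻¹ := eq_inv_of_mul_eq_one_right hω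
  obtain rfl : y = α * ω⁻¹ := by rw [← hα]; field_simp
  have hchart : IsChart ω α := by
    set F := IntermediateField.adjoin K {ω, α}
    have h1 : ω ∈ F := IntermediateField.subset_adjoin _ _ (Or.inl rfl)
    have h2 : α ∈ F := IntermediateField.subset_adjoin _ _ (Or.inr rfl)
    exact hch.of_mem (mul_mem h2 (inv_mem h1)) (hw ▸ inv_mem h1)
  have h5w : O.D w * ω ^ 5 = ι O.s * (2 * ι T * α * ω ^ 3 + 2 * (ι τ₁ * ω ^ 2 +
      ι τ₂ * ω + 1) * (α + ι h * ω ^ 2) - ι l₁ * ω ^ 4 - ι l₂ * ω ^ 3) := by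
    rw [hDw, hw]
    field_simp
    ring
  have h5y : O.D (α * ω⁻¹) * ω ^ 5 = -(ι O.s * (ι τ₁ * (α ^ 2 * ω ^ 2 + 2 * ι h * α * ω ^ 4) +
      (2 * ι τ₂ * ω + 3) * (α + ι h * ω ^ 2) ^ 2 - ι l₁ * α * ω ^ 4 -
      2 * ι l₂ * ω ^ 3 * (α + ι h * ω ^ 2))) - α * ι O.s * (2 * ι T * α * ω ^ 3 +
      2 * (ι τ₁ * ω ^ 2 + ι τ₂ * ω + 1) * (α + ι h * ω ^ 2) - ι l₁ * ω ^ 4 - ι l₂ * ω ^ 3) := by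
    rw [hDy, hw]
    field_simp
  have h3ω : O.D ω * ω ^ 3 = -(O.D w * ω ^ 5) := by
    rw [hw, Derivation.leibniz_inv, smul_eq_mul]
    field_simp
  have h4α : O.D α * ω ^ 4 = O.D (α * ω⁻¹) * ω ^ 5 + α * (O.D ω * ω ^ 3) := by
    have h1 := deriv_factor O.D hα
    have h2 : O.D α = ω * O.D (α * ω⁻¹) + α * ω⁻¹ * O.D ω := by linear_combination -h1
    rw [h2]
    field_simp
  rw [h3ω] at h4α
  refine ⟨hchart, _, _, h3ω, h4α, fun t => ⟨?_, ?_⟩⟩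
  · rw [h5w]
    refine HasValue.congr_value (by
          repeat (with_reducible first
            | assumption | apply HasValue.fst | apply HasValue.snd | apply HasValue.const
            | apply HasValue.add | apply HasValue.sub | apply HasValue.mul | apply HasValue.neg
            | apply HasValue.pow | apply HasValue.ofNat | apply HasValue.one)) ?_
    simp
    ring
  · rw [h5w, h5y]
    refine HasValue.congr_value (by
          repeat (with_reducible first
            | assumption | apply HasValue.fst | apply HasValue.snd | apply HasValue.const
            | apply HasValue.add | apply HasValue.sub | apply HasValue.mul | apply HasValue.neg
            | apply HasValue.pow | apply HasValue.ofNat | apply HasValue.one)) ?_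
    simp
    ring

/-- In the chart `(1/w, y/w)` the only base point is the origin. -/
theorem IsOrbit.isBasePoint_snd_iff (hO : O.IsOrbit q h) {y ω α : RatFun K}
    (hy : y * (O.Y - ι q) = O.Z - ι h) (hω : ω * (O.Y - ι q) = 1) (hα : y * ω = α) (p) :
    IsBasePoint O.D ω α p ↔ p = (0, 0) := by
  obtain ⟨hch, F, G, hF, hG, hval⟩ := hO.deriv_chart_snd hy hω hα
  obtain ⟨a, b⟩ := p
  have h2s : -(2 * κ O.s) ≠ (0 : AlgebraicClosure K) :=
    neg_ne_zero.2 (ofNat_mul_ne_zero 2 O.s_ne_zero)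
  have h7s : -(7 * κ O.s) ≠ (0 : AlgebraicClosure K) :=
    neg_ne_zero.2 (ofNat_mul_ne_zero 7 O.s_ne_zero)
  constructor
  · intro hb
    by_cases ha : a = 0
    · subst ha
      by_cases hb0 : b = 0
      · rw [hb0]
      · refine absurd hb (not_isBasePoint_of_fst hch (g := ω ^ 3)
          (((HasValue.fst ω α (0, b)).pow 3).congr_value (zero_pow three_ne_zero))
          (mul_ne_zero h2s hb0) ?_)
        rw [mul_comm, hF]
        exact (hval b).1
    · refine absurd hb (RegularPlace.not_isBasePoint hch ?_)
      have hch' := chart_quotient hy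
      have hω0 : ω ≠ 0 := left_ne_zero_of_mul_eq_one hω
      have hωw : ω = (O.Y - ι q)⁻¹ := eq_inv_of_mul_eq_one_left hω
      have h1 : HasValue ω α (a, b) y (b / a) := by
        have h3 : y = α / ω := by rw [← hα]; field_simp
        rw [h3]
        exact (HasValue.snd ω α (a, b)).div hch (HasValue.fst ω α (a, b)) ha
      have h2 : HasValue ω α (a, b) (O.Y - ι q) a⁻¹ := by
        rw [eq_inv_of_mul_eq_one_right hω]
        exact (HasValue.fst ω α (a, b)).inv hch ha
      have h3 : HasValue y (O.Y - ι q) (b / a, a⁻¹) ω a := by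
        have h4 := (HasValue.snd y (O.Y - ι q) (b / a, a⁻¹)).inv hch' (inv_ne_zero ha)
        rw [hωw]
        simpa using h4
      have h4 : HasValue y (O.Y - ι q) (b / a, a⁻¹) α b := by
        rw [← hα]
        exact ((HasValue.fst _ _ _).mul h3).congr_value (div_mul_cancel₀ b ha)
      rw [HasValue.place_eq (p' := (b / a, a⁻¹)) hch hch' h1 h2 h3 h4]
      exact hO.regularPlace_affine hy _
  · intro hp
    obtain ⟨rfl, rfl⟩ := Prod.mk.inj hp
    have h1 : IsIndeterminateAt ω α (O.D ω) (0, 0) := hch.isIndeterminateAt three_ne_zero hF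
      ((hval 0).1.congr_value (mul_zero _)) (mul_ne_zero h2s one_ne_zero) (hval 1).1
    have h2 : IsIndeterminateAt ω α (O.D α) (0, 0) := hch.isIndeterminateAt four_ne_zero hG
      ((hval 0).2.congr_value (by simp)) (mul_ne_zero h7s (pow_ne_zero 2 one_ne_zero)) (hval 1).2
    exact ⟨Or.inl h1, Or.inr h1, Or.inr h2⟩

theorem chart_inv {ω : RatFun K} (hω : ω * (O.Y - ι q) = 1) : IsChart ω (O.Z - ι h) := by
  have hw : O.Y - ι q = ω⁻¹ := eq_inv_of_mul_eq_one_right hω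
  set F := IntermediateField.adjoin K {ω, O.Z - ι h}
  have h1 : ω ∈ F := IntermediateField.subset_adjoin _ _ (Or.inl rfl)
  have h2 : O.Z - ι h ∈ F := IntermediateField.subset_adjoin _ _ (Or.inr rfl)
  exact (O.chart_shift q h).of_mem (hw ▸ inv_mem h1) h2

set_option maxHeartbeats 1000000 in
/-- The second blow-up over the origin of the chart `(1/w, y/w)`, in the coordinates `1/w`, `y`. -/
theorem IsOrbit.cascades_second (hO : O.IsOrbit q h) {y ω : RatFun K}
    (hy : y * (O.Y - ι q) = O.Z - ι h) (hω : ω * (O.Y - ι q) = 1) :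
    IsBasePoint O.D ω (O.Z - ι h) (0, κ (-h)) ∧
      (Resolved O.D (HasValue ω (O.Z - ι h) (0, κ (-h))) ω →
        CascadesRegularised O.D ω y 0 0) := by
  obtain ⟨τ₁, τ₂, l₁, l₂, hDw, hDζ, -⟩ := hO.exists_expansion
  have hch1 : IsChart ω (O.Z - ι h) := chart_inv hω
  have hω0 : ω ≠ 0 := left_ne_zero_of_mul_eq_one hω
  have hζ0 := (O.chart_shift q h).ne_zero_snd
  set w := O.Y - ι q
  set T := q * (q - 1) * (q - O.x)
  have hw : w = ω⁻¹ := eq_inv_of_mul_eq_one_right hω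
  set ζ := O.Z - ι h
  have hζω : ζ * ω = y := by rw [← hy]; linear_combination y * hω
  have hDω : O.D ω * ω ^ 1 = -(ι O.s * (2 * ι T * ζ * ω ^ 3 + 2 * (ι τ₁ * ω ^ 2 + ι τ₂ * ω + 1) *
      (ζ + ι h) - ι l₁ * ω ^ 2 - ι l₂ * ω)) := by
    have h1 : O.D ω = -(ω ^ 2 * O.D w) := by
      rw [hw, Derivation.leibniz_inv, smul_eq_mul]
      field_simp
    rw [h1, hDw, hw]
    field_simp
    ring
  have hDζ' : O.D ζ * ω ^ 2 = -(ι O.s * (ι τ₁ * ω ^ 2 * (ζ ^ 2 + 2 * ι h * ζ) +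
      (2 * ι τ₂ * ω + 3) * (ζ + ι h) ^ 2 - ι l₁ * ζ * ω ^ 2 - 2 * ι l₂ * ω * (ζ + ι h))) := by
    rw [hDζ, hw]
    field_simp
  have h2s : -(2 * κ O.s) ≠ (0 : AlgebraicClosure K) :=
    neg_ne_zero.2 (ofNat_mul_ne_zero 2 O.s_ne_zero)
  have h3s : -(3 * κ O.s) ≠ (0 : AlgebraicClosure K) :=
    neg_ne_zero.2 (ofNat_mul_ne_zero 3 O.s_ne_zero)
  have hvω : ∀ t, HasValue ω ζ (0, t) (-(ι O.s * (2 * ι T * ζ * ω ^ 3 + 2 * (ι τ₁ * ω ^ 2 +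
      ι τ₂ * ω + 1) * (ζ + ι h) - ι l₁ * ω ^ 2 - ι l₂ * ω))) (-(2 * κ O.s) * (t + κ h)) := by
    intro t
    refine HasValue.congr_value (by
          repeat (with_reducible first
            | assumption | apply HasValue.fst | apply HasValue.snd | apply HasValue.const
            | apply HasValue.add | apply HasValue.sub | apply HasValue.mul | apply HasValue.neg
            | apply HasValue.pow | apply HasValue.ofNat | apply HasValue.one)) ?_
    simp
    ring
  have hvζ : ∀ t, HasValue ω ζ (0, t) (-(ι O.s * (ι τ₁ * ω ^ 2 * (ζ ^ 2 + 2 * ι h * ζ) +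
      (2 * ι τ₂ * ω + 3) * (ζ + ι h) ^ 2 - ι l₁ * ζ * ω ^ 2 - 2 * ι l₂ * ω * (ζ + ι h))))
      (-(3 * κ O.s) * (t + κ h) ^ 2) := by
    intro t
    refine HasValue.congr_value (by
          repeat (with_reducible first
            | assumption | apply HasValue.fst | apply HasValue.snd | apply HasValue.const
            | apply HasValue.add | apply HasValue.sub | apply HasValue.mul | apply HasValue.neg
            | apply HasValue.pow | apply HasValue.ofNat | apply HasValue.one)) ?_
    simp
    ring
  have hbase : IsBasePoint O.D ω ζ (0, κ (-h)) := by
    -- Both numerators are nonzero multiples of powers of `t + h`, the value of `Z`. They vanish at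
    -- `t = -h`, and `t = 1 - h` is a comparison point where they do not.
    have h1 : IsIndeterminateAt ω ζ (O.D ω) (0, κ (-h)) :=
      hch1.isIndeterminateAt one_ne_zero hDω ((hvω _).congr_value (by simp))
        (b' := κ (1 - h)) h2s ((hvω _).congr_value (by simp))
    have h2 : IsIndeterminateAt ω ζ (O.D ζ) (0, κ (-h)) :=
      hch1.isIndeterminateAt two_ne_zero hDζ' ((hvζ _).congr_value (by simp))
        (b' := κ (1 - h)) h3s ((hvζ _).congr_value (by simp))
    exact ⟨Or.inl h1, Or.inr h1, Or.inr h2⟩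
  refine ⟨hbase, fun hres => ?_⟩
  have hch0 : IsChart ω y := by
    set F := IntermediateField.adjoin K {ω, y}
    have h1 : ω ∈ F := IntermediateField.subset_adjoin _ _ (Or.inl rfl)
    have h2 : y ∈ F := IntermediateField.subset_adjoin _ _ (Or.inr rfl)
    refine hch1.of_mem h1 ?_
    rw [← hy, hw]
    exact mul_mem h2 (inv_mem h1)
  have hn : y = y - ι (0 : K) := by simp
  have hσ : ζ⁻¹ * y = ω := by rw [← hζω]; field_simp
  refine cascadesRegularised_of_blowup O.preservesConstants hch0 hn hζω hσ (fun t => ?_)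
    (Or.inl ?_) (Or.inl ⟨_, hbase⟩)
  · by_cases ht : t = κ (-h)
    · exact Or.inr (Or.inr (Or.inl ⟨-h, ht, ht ▸ hres⟩))
    have ht' : t + κ h ≠ 0 := by
      intro h0
      exact ht (by rw [map_neg]; linear_combination h0)
    refine Or.inr (Or.inl (polarPlace_of_snd O.preservesConstants hch1 (g := ω ^ 2) (a := 0)
      (b := -(3 * κ O.s) * (t + κ h) ^ 2) ?_ ?_ ?_ (mul_ne_zero h3s (pow_ne_zero 2 ht'))))
    · exact ((HasValue.fst ω ζ (0, t)).pow 2).congr_value (zero_pow two_ne_zero)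
    · have h1 : ω ^ 2 * O.D ω = ω * (O.D ω * ω ^ 1) := by ring
      rw [h1, hDω]
      exact ((HasValue.fst ω ζ (0, t)).mul (hvω t)).congr_value (zero_mul _)
    · rw [mul_comm, hDζ']
      exact hvζ t
  · have hch2 := hch0.of_factor_snd hn hσ
    refine not_isBasePoint_of_fst hch2 (g := ζ⁻¹ ^ 2 * y ^ 2) (d := 3 * κ O.s)
      (HasValue.congr_value (by
          repeat (with_reducible first
            | assumption | apply HasValue.fst | apply HasValue.snd | apply HasValue.const
            | apply HasValue.add | apply HasValue.sub | apply HasValue.mul | apply HasValue.neg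
            | apply HasValue.pow | apply HasValue.ofNat | apply HasValue.one)) (by simp)) (ofNat_mul_ne_zero 3 O.s_ne_zero) ?_
    obtain ⟨σ, hσ0⟩ : ∃ σ, σ = ζ⁻¹ := ⟨_, rfl⟩
    have h1 : ζ⁻¹ ^ 2 * y ^ 2 * O.D ζ⁻¹ = -(σ ^ 2 * (O.D ζ * ω ^ 2)) := by
      rw [Derivation.leibniz_inv, smul_eq_mul, ← hσ, hσ0]
      ring
    have h2 : σ ^ 2 * (O.D ζ * ω ^ 2) = -(ι O.s * (ι τ₁ * (σ * y) ^ 2 * (1 + 2 * ι h * σ) +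
      (2 * ι τ₂ * (σ * y) + 3) * (1 + ι h * σ) ^ 2 - ι l₁ * σ * (σ * y) ^ 2 -
        2 * ι l₂ * (σ * y) * σ * (1 + ι h * σ))) := by
      have hσ1 : σ ≠ 0 := hσ0 ▸ inv_ne_zero hζ0
      have hζσ : ζ = σ⁻¹ := by rw [hσ0, inv_inv]
      have hωσ : σ * y = ω := by rw [hσ0, hσ]
      rw [hDζ', hωσ, hζσ]
      field_simp
    rw [h1, h2, neg_neg, hσ0]
    refine HasValue.congr_value (by
          repeat (with_reducible first
            | assumption | apply HasValue.fst | apply HasValue.snd | apply HasValue.const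
            | apply HasValue.add | apply HasValue.sub | apply HasValue.mul | apply HasValue.neg
            | apply HasValue.pow | apply HasValue.ofNat | apply HasValue.one)) ?_
    simp [mul_comm]

set_option maxHeartbeats 1000000 in
/-- The cascades over the origin of the chart `(1/w, y/w)` are regularised or not according to what
happens at the point `1/w = 0`, `Z = 0` of the second exceptional curve. -/
theorem IsOrbit.cascades_snd (hO : O.IsOrbit q h) {y ω α : RatFun K}
    (hy : y * (O.Y - ι q) = O.Z - ι h) (hω : ω * (O.Y - ι q) = 1) (hα : y * ω = α) :
    (Resolved O.D (HasValue ω (O.Z - ι h) (0, κ (-h))) ω →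
      CascadesRegularised O.D ω α 0 0) ∧
    (Unresolved O.D (HasValue ω (O.Z - ι h) (0, κ (-h))) ω →
      ¬ CascadesRegularised O.D ω α 0 0) := by
  obtain ⟨hbase1, hsecond⟩ := hO.cascades_second hy hω
  obtain ⟨hch, -⟩ := hO.deriv_chart_snd hy hω hα
  have hch1 : IsChart ω (O.Z - ι h) := chart_inv hω
  obtain ⟨τ₁, τ₂, l₁, l₂, hDw, hDζ, -⟩ := hO.exists_expansion
  have hDy := deriv_quotient (O.chart_shift q h).ne_zero_fst hy hDw hDζ
  have hω0 : ω ≠ 0 := left_ne_zero_of_mul_eq_one hω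
  have hy0 := (chart_quotient hy).ne_zero_fst
  rw [← hy] at hDw
  set w := O.Y - ι q
  set T := q * (q - 1) * (q - O.x)
  have hw : w = ω⁻¹ := eq_inv_of_mul_eq_one_right hω
  have hn : α = α - ι (0 : K) := by simp
  have hch0 := hch.of_factor_fst hn hα
  have hDω : O.D ω * ω ^ 2 = -(ι O.s * (2 * ι T * y * ω ^ 3 + 2 * (ι τ₁ * ω ^ 2 + ι τ₂ * ω + 1) *
      (y + ι h * ω) - ι l₁ * ω ^ 3 - ι l₂ * ω ^ 2)) := by
    have h1 : O.D ω = -(ω ^ 2 * O.D w) := by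
      rw [hw, Derivation.leibniz_inv, smul_eq_mul]
      field_simp
    rw [h1, hDw, hw]
    field_simp
    ring
  have hDy' : O.D y * ω ^ 3 = -(ι O.s * (ι τ₁ * (y ^ 2 * ω ^ 2 + 2 * ι h * y * ω ^ 3) +
      (2 * ι τ₂ * ω + 3) * (y + ι h * ω) ^ 2 - ι l₁ * y * ω ^ 3 -
      2 * ι l₂ * ω ^ 2 * (y + ι h * ω))) - y * ι O.s * (2 * ι T * y * ω ^ 3 +
      2 * (ι τ₁ * ω ^ 2 + ι τ₂ * ω + 1) * (y + ι h * ω) - ι l₁ * ω ^ 3 - ι l₂ * ω ^ 2) := by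
    rw [hDy, hw]
    field_simp
  have h2s : -(2 * κ O.s) ≠ (0 : AlgebraicClosure K) :=
    neg_ne_zero.2 (ofNat_mul_ne_zero 2 O.s_ne_zero)
  have h5s : -(5 * κ O.s) ≠ (0 : AlgebraicClosure K) :=
    neg_ne_zero.2 (ofNat_mul_ne_zero 5 O.s_ne_zero)
  have hvω : ∀ t, HasValue ω y (0, t) (O.D ω * ω ^ 2) (-(2 * κ O.s) * t) := by
    intro t
    rw [hDω]
    refine HasValue.congr_value (by
          repeat (with_reducible first
            | assumption | apply HasValue.fst | apply HasValue.snd | apply HasValue.const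
            | apply HasValue.add | apply HasValue.sub | apply HasValue.mul | apply HasValue.neg
            | apply HasValue.pow | apply HasValue.ofNat | apply HasValue.one)) ?_
    simp
    ring
  have hvy : ∀ t, HasValue ω y (0, t) (O.D y * ω ^ 3) (-(5 * κ O.s) * t ^ 2) := by
    intro t
    rw [hDy']
    refine HasValue.congr_value (by
          repeat (with_reducible first
            | assumption | apply HasValue.fst | apply HasValue.snd | apply HasValue.const
            | apply HasValue.add | apply HasValue.sub | apply HasValue.mul | apply HasValue.neg
            | apply HasValue.pow | apply HasValue.ofNat | apply HasValue.one)) ?_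
    simp
    ring
  have hbase : IsBasePoint O.D ω y (0, κ (0 : K)) := by
    rw [map_zero]
    have h1 : IsIndeterminateAt ω y (O.D ω) (0, 0) :=
      hch0.isIndeterminateAt two_ne_zero rfl ((hvω 0).congr_value (mul_zero _))
        (mul_ne_zero h2s one_ne_zero) (hvω 1)
    have h2 : IsIndeterminateAt ω y (O.D y) (0, 0) :=
      hch0.isIndeterminateAt three_ne_zero rfl ((hvy 0).congr_value (by simp))
        (mul_ne_zero h5s (pow_ne_zero 2 one_ne_zero)) (hvy 1)
    exact ⟨Or.inl h1, Or.inr h1, Or.inr h2⟩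
  constructor
  · intro hres
    have hσ : y⁻¹ * α = ω := by rw [← hα]; field_simp
    refine cascadesRegularised_of_blowup O.preservesConstants hch hn hα hσ (fun t => ?_)
      (Or.inl ?_) (Or.inl ⟨_, hbase⟩)
    · by_cases ht : t = 0
      -- The only base point is the origin of the first chart, so its cascades are needed in these
      -- coordinates only.
      · exact Or.inr (Or.inr (Or.inr ⟨ht, hsecond hres⟩))
      refine Or.inr (Or.inl (polarPlace_of_snd O.preservesConstants hch0 (g := ω ^ 3) (a := 0)
        (b := -(5 * κ O.s) * t ^ 2) ?_ ?_ ?_ (mul_ne_zero h5s (pow_ne_zero 2 ht))))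
      · exact ((HasValue.fst ω y (0, t)).pow 3).congr_value (zero_pow three_ne_zero)
      · have h1 : ω ^ 3 * O.D ω = ω * (O.D ω * ω ^ 2) := by ring
        rw [h1]
        exact ((HasValue.fst ω y (0, t)).mul (hvω t)).congr_value (zero_mul _)
      · rw [mul_comm]
        exact hvy t
    · have hch2 := hch.of_factor_snd hn hσ
      refine not_isBasePoint_of_fst hch2 (g := y⁻¹ ^ 3 * α ^ 3) (d := 5 * κ O.s)
        (HasValue.congr_value (by
          repeat (with_reducible first
            | assumption | apply HasValue.fst | apply HasValue.snd | apply HasValue.const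
            | apply HasValue.add | apply HasValue.sub | apply HasValue.mul | apply HasValue.neg
            | apply HasValue.pow | apply HasValue.ofNat | apply HasValue.one)) (by simp)) (ofNat_mul_ne_zero 5 O.s_ne_zero) ?_
      obtain ⟨σ, hσ0⟩ : ∃ σ, σ = y⁻¹ := ⟨_, rfl⟩
      have h1 : y⁻¹ ^ 3 * α ^ 3 * O.D y⁻¹ = -(σ ^ 2 * (O.D y * ω ^ 3)) := by
        rw [Derivation.leibniz_inv, smul_eq_mul, ← hσ, hσ0]
        ring
      have h2 : σ ^ 2 * (O.D y * ω ^ 3) = -(ι O.s * (ι τ₁ * ((σ * α) ^ 2 +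
          2 * ι h * σ * (σ * α) ^ 3) + (2 * ι τ₂ * (σ * α) + 3) * (1 + ι h * (σ * α) * σ) ^ 2 -
          ι l₁ * σ * (σ * α) ^ 3 - 2 * ι l₂ * (σ * α) ^ 2 * σ * (1 + ι h * (σ * α) * σ))) -
          ι O.s * (2 * ι T * (σ * α) ^ 3 + 2 * (ι τ₁ * (σ * α) ^ 2 + ι τ₂ * (σ * α) + 1) *
          (1 + ι h * (σ * α) * σ) - ι l₁ * σ * (σ * α) ^ 3 - ι l₂ * σ * (σ * α) ^ 2) := by
        have hσ1 : σ ≠ 0 := hσ0 ▸ inv_ne_zero hy0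
        have hyσ : y = σ⁻¹ := by rw [hσ0, inv_inv]
        have hωσ : σ * α = ω := by rw [hσ0, hσ]
        rw [hDy', hωσ, hyσ]
        field_simp
      rw [h1, h2, hσ0]
      refine HasValue.congr_value (by
          repeat (with_reducible first
            | assumption | apply HasValue.fst | apply HasValue.snd | apply HasValue.const
            | apply HasValue.add | apply HasValue.sub | apply HasValue.mul | apply HasValue.neg
            | apply HasValue.pow | apply HasValue.ofNat | apply HasValue.one)) ?_
      simp
      ring
  -- Regularised cascades pass to every base point met on the way; two forced base points lead to
  -- the place in question.
  · intro hres hc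
    have h1 := hc.next_factor hω0 hn hα hbase
    have hζω : (O.Z - ι h) * ω = y := by rw [← hy]; linear_combination y * hω
    exact hres.not_cascades hch1 rfl (h1.next_factor hω0 (by simp) hζω hbase1)

end OkamotoPair

end VerticalChart

/-! ### The point `Y = ∞`, `Z = 0`, where the condition on `k` arises. -/

section Infinity

set_option linter.unusedSectionVars false

local notation "ι" => algebraMap _ (RatFun _)
local notation "κ" => algebraMap _ (AlgebraicClosure _)

namespace OkamotoPair

variable {K : Type} [Field K] [Algebra ℂ K] {O : OkamotoPair K} {q h : K}

theorem chart_infinity (O : OkamotoPair K) : IsChart O.Y⁻¹ O.Z := by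
  set F := IntermediateField.adjoin K {O.Y⁻¹, O.Z}
  have h1 : O.Y⁻¹ ∈ F := IntermediateField.subset_adjoin _ _ (Or.inl rfl)
  have h2 : O.Z ∈ F := IntermediateField.subset_adjoin _ _ (Or.inr rfl)
  refine O.chart.of_mem ?_ h2
  simpa using inv_mem h1

/-- The place `Y = ∞`, `Z = 0` in the coordinates `1/(Y - q)`, `Z - h`. -/
theorem place_infinity {ω : RatFun K} (hω : ω * (O.Y - ι q) = 1) :
    HasValue ω (O.Z - ι h) (0, κ (-h)) = HasValue O.Y⁻¹ O.Z (0, κ (0 : K)) ∧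
      ∃ g c, c ≠ 0 ∧ HasValue O.Y⁻¹ O.Z (0, κ (0 : K)) g c ∧ ω = g * O.Y⁻¹ := by
  have h1 : IsChart ω (O.Z - ι h) := chart_inv hω
  have h2 := O.chart_infinity
  have hY := O.chart.ne_zero_fst
  have hω0 : ω ≠ 0 := left_ne_zero_of_mul_eq_one hω
  have hden : HasValue O.Y⁻¹ O.Z (0, κ (0 : K)) (1 - ι q * O.Y⁻¹) 1 :=
    ((HasValue.one _ _ _).sub ((HasValue.const _ _ _ q).mul
      (HasValue.fst O.Y⁻¹ O.Z (0, κ (0 : K))))).congr_value (by simp)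
  have hg := (HasValue.one _ _ _).div h2 hden one_ne_zero
  have hrg : ω = 1 / (1 - ι q * O.Y⁻¹) * O.Y⁻¹ := by
    rw [div_mul_eq_mul_div, eq_div_iff (hden.ne_zero h2 one_ne_zero)]
    have h3 : (1 - ι q * O.Y⁻¹) * O.Y = O.Y - ι q := by field_simp
    apply mul_right_cancel₀ hY
    rw [one_mul, inv_mul_cancel₀ hY, mul_assoc, h3, hω]
  refine ⟨HasValue.place_eq h1 h2 ?_ ?_ ?_ ?_, _, _, ?_, hg, hrg⟩
  · have hp := HasValue.fst ω (O.Z - ι h) (0, κ (-h))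
    have h3 := ((HasValue.one _ _ _).add ((HasValue.const _ _ _ q).mul hp)).congr_value
      (show _ = 1 by simp)
    have h4 := (hp.div h1 h3 one_ne_zero).congr_value (zero_div _)
    have h5 : ω / (1 + ι q * ω) = O.Y⁻¹ := by
      rw [div_eq_iff (h3.ne_zero h1 one_ne_zero)]
      apply mul_left_cancel₀ hY
      rw [mul_inv_cancel_left₀ hY]
      linear_combination hω
    rwa [h5] at h4
  · have h3 := (HasValue.snd ω (O.Z - ι h) (0, κ (-h))).add (HasValue.const _ _ _ h)
    rw [sub_add_cancel] at h3
    exact h3.congr_value (by simp)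
  · rw [hrg]
    exact (hg.mul (HasValue.fst O.Y⁻¹ O.Z (0, κ (0 : K)))).congr_value (mul_zero _)
  · exact ((HasValue.snd O.Y⁻¹ O.Z (0, κ (0 : K))).sub (HasValue.const _ _ _ h)).congr_value
      (by simp)
  · rw [div_one]
    exact one_ne_zero

/-- The system in the coordinates `ρ = 1/Y`, `m = Y Z` near the line `Y = ∞`. -/
theorem deriv_infinity (O : OkamotoPair K) {ρ m : RatFun K} (hρ : ρ = O.Y⁻¹) (hm : m * ρ = O.Z) :
    O.D ρ = -(ι O.s * (2 * (1 - (1 + ι O.x) * ρ + ι O.x * ρ ^ 2) * m -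
      (ι O.l0 * ρ ^ 2 + ι O.l1 * ρ + ι O.l2))) ∧
    ρ * O.D m = -(ι O.s * (m ^ 2 - ι O.l2 * m + ι O.k)) +
      ρ ^ 2 * (ι O.s * (ι O.x * m ^ 2 - ι O.l0 * m)) ∧
    O.D O.Z = -(ι O.s * ((3 - 2 * (1 + ι O.x) * ρ + ι O.x * ρ ^ 2) * m ^ 2 -
      (2 * ι O.l2 + ι O.l1 * ρ) * m + ι O.k)) := by
  have hY := O.chart.ne_zero_fst
  have hρ0 : ρ ≠ 0 := hρ ▸ inv_ne_zero hY
  have hDY := O.D_Y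
  have hDZ := O.D_Z
  have hYρ : O.Y = ρ⁻¹ := by rw [hρ, inv_inv]
  have h1 : O.D ρ = -(ι O.s * (2 * (1 - (1 + ι O.x) * ρ + ι O.x * ρ ^ 2) * m -
      (ι O.l0 * ρ ^ 2 + ι O.l1 * ρ + ι O.l2))) := by
    rw [hρ, Derivation.leibniz_inv, smul_eq_mul, hDY, ← hρ, hYρ, ← hm]
    field_simp
    ring
  have h2 : O.D O.Z = -(ι O.s * ((3 - 2 * (1 + ι O.x) * ρ + ι O.x * ρ ^ 2) * m ^ 2 -
      (2 * ι O.l2 + ι O.l1 * ρ) * m + ι O.k)) := by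
    rw [hDZ, hYρ, ← hm]
    field_simp
  refine ⟨h1, ?_, h2⟩
  rw [deriv_factor O.D hm, h2, h1]
  ring

theorem root_ne {K : Type} [Field K] [Algebra ℂ K] {t t' b : AlgebraicClosure K} (h1 : b ≠ t) (h2 : b ≠ t') (O : OkamotoPair K) :
    -(κ O.s * ((b - t) * (b - t'))) ≠ 0 :=
  neg_ne_zero.2 (mul_ne_zero (algebraMap_ne_zero O.s_ne_zero)
    (mul_ne_zero (sub_ne_zero.2 h1) (sub_ne_zero.2 h2)))

section Blowup

variable {ρ m : RatFun K} (hρ : ρ = O.Y⁻¹) (hm : m * ρ = O.Z)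

include hρ hm

theorem chart_infinity_fst : IsChart ρ m := by
  refine IsChart.of_factor_fst (b := 0) (hρ ▸ O.chart_infinity) ?_ hm
  rw [map_zero, sub_zero]

theorem hasValue_infinity {t t' : AlgebraicClosure K} (hsum : t + t' = κ O.l2)
    (hprod : t * t' = κ O.k) (b) :
    HasValue ρ m (0, b) (ρ * O.D ρ) 0 ∧
      HasValue ρ m (0, b) (ρ * O.D m) (-(κ O.s * ((b - t) * (b - t')))) := by
  obtain ⟨h1, h2, -⟩ := O.deriv_infinity hρ hm
  constructor
  · rw [h1]
    refine HasValue.congr_value (by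
          repeat (with_reducible first
            | assumption | apply HasValue.fst | apply HasValue.snd | apply HasValue.const
            | apply HasValue.add | apply HasValue.sub | apply HasValue.mul | apply HasValue.neg
            | apply HasValue.pow | apply HasValue.ofNat | apply HasValue.one)) ?_
    simp
  · rw [h2]
    refine HasValue.congr_value (by
          repeat (with_reducible first
            | assumption | apply HasValue.fst | apply HasValue.snd | apply HasValue.const
            | apply HasValue.add | apply HasValue.sub | apply HasValue.mul | apply HasValue.neg
            | apply HasValue.pow | apply HasValue.ofNat | apply HasValue.one)) ?_
    rw [← hsum, ← hprod]
    simp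
    left
    ring

/-- The points of the exceptional curve over `Y = ∞`, `Z = 0` where `Y Z` is a root of
`m ^ 2 - l2 * m + k` are base points. -/
theorem basePlace_infinity {t t' : AlgebraicClosure K} (hsum : t + t' = κ O.l2)
    (hprod : t * t' = κ O.k) : BasePlace O.D (HasValue ρ m (0, t)) := by
  have : CharZero K := charZero_of_injective_algebraMap (algebraMap ℂ K).injective
  classical
  -- A comparison point off both roots, where the numerator does not vanish.
  obtain ⟨b, hb⟩ := Infinite.exists_notMem_finset ({t, t'} : Finset (AlgebraicClosure K))
  simp only [Finset.mem_insert, Finset.mem_singleton, not_or] at hb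
  obtain ⟨h1, h2⟩ := hasValue_infinity hρ hm hsum hprod t
  refine basePlace_of O.preservesConstants (chart_infinity_fst hρ hm) h1
    (h2.congr_value (by simp)) (root_ne hb.1 hb.2 O) (hasValue_infinity hρ hm hsum hprod b).2

/-- Factoring `m² - l₂ m + k` at `m₁` brings the system into resonant form with `a = -s (m₁ - m₂)`
and `c = -s`; the logarithmic coefficient is minus the derivative of the root, because the centre of
the blow-up moves with it. -/
theorem resonance_infinity {m₁ m₂ : K} (hsum : m₁ + m₂ = O.l2) (hprod : m₁ * m₂ = O.k) :
    ρ * O.D (m - ι m₁) = ι (-(O.s * (m₁ - m₂))) * (m - ι m₁) + ι (-O.s) * (m - ι m₁) ^ 2 +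
      ι (-O.δ m₁) * ρ + ρ ^ 2 * (ι O.s * (ι O.x * m ^ 2 - ι O.l0 * m)) ∧
    O.D ρ = ι (-(O.s * (m₁ - m₂))) + 2 * ι (-O.s) * (m - ι m₁) + ρ * (ι O.s *
      (2 * (1 + ι O.x) * m - 2 * ι O.x * ρ * m + ι O.l0 * ρ + ι O.l1)) := by
  obtain ⟨h1, h2, -⟩ := O.deriv_infinity hρ hm
  rw [← hsum, ← hprod] at h2
  rw [← hsum] at h1
  constructor
  · rw [map_sub, O.D_const, mul_sub, h2]
    simp only [map_mul, map_add, map_sub, map_neg]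
    ring
  · rw [h1]
    simp only [map_mul, map_add, map_sub, map_neg]
    ring

/-- A constant root has no logarithmic term, and the quadratic coefficient `-s` never vanishes, so a
double root is covered as well. -/
theorem resolved_infinity_root {m₁ m₂ : K} (hsum : m₁ + m₂ = O.l2) (hprod : m₁ * m₂ = O.k)
    (hδ : O.δ m₁ = 0) : Resolved O.D (HasValue ρ m (0, κ m₁)) ρ := by
  obtain ⟨h1, h2⟩ := resonance_infinity hρ hm hsum hprod
  rw [hδ, neg_zero, map_zero, zero_mul, add_zero] at h1
  exact resolved_of_resonance O.preservesConstants (chart_infinity_fst hρ hm) rfl (by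
          repeat (with_reducible first
            | assumption | apply HasValue.fst | apply HasValue.snd | apply HasValue.const
            | apply HasValue.add | apply HasValue.sub | apply HasValue.mul | apply HasValue.neg
            | apply HasValue.pow | apply HasValue.ofNat | apply HasValue.one)) (by
          repeat (with_reducible first
            | assumption | apply HasValue.fst | apply HasValue.snd | apply HasValue.const
            | apply HasValue.add | apply HasValue.sub | apply HasValue.mul | apply HasValue.neg
            | apply HasValue.pow | apply HasValue.ofNat | apply HasValue.one))
    h1 h2 (Or.inr (neg_ne_zero.2 O.s_ne_zero))

theorem unresolved_infinity_root {m₁ m₂ : K} (hsum : m₁ + m₂ = O.l2) (hprod : m₁ * m₂ = O.k)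
    (hδ : O.δ m₁ ≠ 0) (hne : m₁ ≠ m₂) : Unresolved O.D (HasValue ρ m (0, κ m₁)) ρ := by
  obtain ⟨h1, h2⟩ := resonance_infinity hρ hm hsum hprod
  exact unresolved_of_resonance O.preservesConstants (chart_infinity_fst hρ hm) rfl (by
          repeat (with_reducible first
            | assumption | apply HasValue.fst | apply HasValue.snd | apply HasValue.const
            | apply HasValue.add | apply HasValue.sub | apply HasValue.mul | apply HasValue.neg
            | apply HasValue.pow | apply HasValue.ofNat | apply HasValue.one)) (by
          repeat (with_reducible first
            | assumption | apply HasValue.fst | apply HasValue.snd | apply HasValue.const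
            | apply HasValue.add | apply HasValue.sub | apply HasValue.mul | apply HasValue.neg
            | apply HasValue.pow | apply HasValue.ofNat | apply HasValue.one))
    h1 h2 (neg_ne_zero.2 (mul_ne_zero O.s_ne_zero (sub_ne_zero.2 hne))) (neg_ne_zero.2 hδ)

end Blowup

set_option maxHeartbeats 1000000 in
/-- The cascades over the place `Y = ∞`, `Z = 0` when the roots of `m ^ 2 - l2 * m + k` are
constants. -/
theorem resolved_infinity {m₁ m₂ : K} (hsum : m₁ + m₂ = O.l2) (hprod : m₁ * m₂ = O.k)
    (h1 : O.δ m₁ = 0) (h2 : O.δ m₂ = 0) :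
    Resolved O.D (HasValue O.Y⁻¹ O.Z (0, κ (0 : K))) O.Y⁻¹ := by
  have hch := O.chart_infinity
  have hY := O.chart.ne_zero_fst
  have hZ := O.chart.ne_zero_snd
  obtain ⟨ρ, hρ⟩ : ∃ ρ, ρ = O.Y⁻¹ := ⟨_, rfl⟩
  have hρ0 : ρ ≠ 0 := hρ ▸ inv_ne_zero hY
  obtain ⟨m, hm⟩ : ∃ m, m * ρ = O.Z := ⟨O.Z / ρ, div_mul_cancel₀ _ hρ0⟩
  have hsum' : κ m₁ + κ m₂ = (κ O.l2 : AlgebraicClosure K) := by rw [← hsum, map_add]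
  have hprod' : κ m₁ * κ m₂ = (κ O.k : AlgebraicClosure K) := by rw [← hprod, map_mul]
  have hbase := basePlace_infinity hρ hm hsum' hprod'
  have hval := hasValue_infinity hρ hm hsum' hprod'
  have hr1 := resolved_infinity_root hρ hm hsum hprod h1
  have hr2 := resolved_infinity_root hρ hm (add_comm m₁ m₂ ▸ hsum) (mul_comm m₁ m₂ ▸ hprod) h2
  have hch1 := chart_infinity_fst hρ hm
  obtain ⟨hDρ, hDm, hDZ⟩ := O.deriv_infinity hρ hm
  rw [← hρ] at hch ⊢
  have hn : O.Z = O.Z - ι (0 : K) := by simp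
  have hm0 := hch1.ne_zero_snd
  have hσ : m⁻¹ * O.Z = ρ := by rw [← hm]; field_simp
  have hch2 := hch.of_factor_snd hn hσ
  refine resolved_of_blowup O.preservesConstants hch hn hm hσ (fun t => ?_) (Or.inl ?_)
    (Or.inl ⟨_, hbase⟩)
  · by_cases ht1 : t = κ m₁
    · exact Or.inr (Or.inr ⟨m₁, ht1, ht1 ▸ hr1⟩)
    by_cases ht2 : t = κ m₂
    · exact Or.inr (Or.inr ⟨m₂, ht2, ht2 ▸ hr2⟩)
    exact Or.inr (Or.inl (polarPlace_of_snd O.preservesConstants hch1 (HasValue.fst _ _ _)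
      (hval t).1 (hval t).2 (root_ne ht1 ht2 O)))
  · obtain ⟨μ, hμ⟩ : ∃ μ, μ = m⁻¹ := ⟨_, rfl⟩
    have hmμ : m = μ⁻¹ := by rw [hμ, inv_inv]
    have hμ0 : μ ≠ 0 := hμ ▸ inv_ne_zero hm0
    have hρμ : μ * O.Z = ρ := by rw [hμ, hσ]
    have hgDμ : ρ * O.D μ = ι O.s * (1 - ι O.l2 * μ + ι O.k * μ ^ 2) -
        (μ * O.Z) ^ 2 * (ι O.s * (ι O.x - ι O.l0 * μ)) := by
      have h3 : ρ * O.D μ = -(μ ^ 2 * (ρ * O.D m)) := by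
        rw [hμ, Derivation.leibniz_inv, smul_eq_mul]
        ring
      rw [h3, hDm, hρμ, hmμ]
      field_simp
      ring
    have hgDZ : μ * ρ * O.D O.Z = -(O.Z * (ι O.s * (3 - 2 * (1 + ι O.x) * (μ * O.Z) +
        ι O.x * (μ * O.Z) ^ 2 - (2 * ι O.l2 + ι O.l1 * (μ * O.Z)) * μ + ι O.k * μ ^ 2))) := by
      have h3 : μ * ρ * O.D O.Z = O.Z * (μ ^ 2 * O.D O.Z) := by rw [← hρμ]; ring
      rw [h3, hDZ, hρμ, hmμ]
      field_simp
    rw [← hμ] at hch2 ⊢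
    refine polarAlong_of_fst O.preservesConstants hch2 (g := ρ) (a := κ O.s) ?_ ?_
      (algebraMap_ne_zero O.s_ne_zero) ?_
    · rw [← hρμ]
      exact HasValue.congr_value (by
          repeat (with_reducible first
            | assumption | apply HasValue.fst | apply HasValue.snd | apply HasValue.const
            | apply HasValue.add | apply HasValue.sub | apply HasValue.mul | apply HasValue.neg
            | apply HasValue.pow | apply HasValue.ofNat | apply HasValue.one)) (mul_zero _)
    · rw [hgDμ]
      refine HasValue.congr_value (by
          repeat (with_reducible first
            | assumption | apply HasValue.fst | apply HasValue.snd | apply HasValue.const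
            | apply HasValue.add | apply HasValue.sub | apply HasValue.mul | apply HasValue.neg
            | apply HasValue.pow | apply HasValue.ofNat | apply HasValue.one)) ?_
      simp
    · rw [hgDZ]
      refine HasValue.congr_value (by
          repeat (with_reducible first
            | assumption | apply HasValue.fst | apply HasValue.snd | apply HasValue.const
            | apply HasValue.add | apply HasValue.sub | apply HasValue.mul | apply HasValue.neg
            | apply HasValue.pow | apply HasValue.ofNat | apply HasValue.one)) ?_
      simp

/-- The cascades over the place `Y = ∞`, `Z = 0` when `k` is not a constant. -/
theorem unresolved_infinity (hl2 : O.δ O.l2 = 0) (hk : O.δ O.k ≠ 0) :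
    Unresolved O.D (HasValue O.Y⁻¹ O.Z (0, κ (0 : K))) O.Y⁻¹ := by
  have hch := O.chart_infinity
  have hY := O.chart.ne_zero_fst
  obtain ⟨ρ, hρ⟩ : ∃ ρ, ρ = O.Y⁻¹ := ⟨_, rfl⟩
  have hρ0 : ρ ≠ 0 := hρ ▸ inv_ne_zero hY
  obtain ⟨m, hm0⟩ : ∃ m, m = (O.Z - ι (0 : K)) / ρ := ⟨_, rfl⟩
  have hm : m * ρ = O.Z := by rw [hm0, map_zero, sub_zero, div_mul_cancel₀ _ hρ0]
  obtain ⟨t, ht⟩ : ∃ t : AlgebraicClosure K, t * (κ O.l2 - t) = κ O.k := by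
    obtain ⟨t, ht⟩ := IsAlgClosed.exists_root
      (Polynomial.X ^ 2 - Polynomial.C (κ O.l2) * Polynomial.X + Polynomial.C (κ O.k) :
        Polynomial (AlgebraicClosure K)) (by
      have : (Polynomial.X ^ 2 - Polynomial.C (κ O.l2) * Polynomial.X + Polynomial.C (κ O.k) :
        Polynomial (AlgebraicClosure K)).degree = 2 := by compute_degree!
      rw [this]
      decide)
    simp only [Polynomial.IsRoot, Polynomial.eval_add, Polynomial.eval_sub, Polynomial.eval_pow,
      Polynomial.eval_mul, Polynomial.eval_X, Polynomial.eval_C] at ht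
    exact ⟨t, by linear_combination -ht⟩
  have hbase := basePlace_infinity hρ hm (add_sub_cancel t _) ht
  rw [← hρ] at hch ⊢
  -- Either the root is not in `K`, and the cascade stops at an irrational base point, or it is, and
  -- the logarithmic term decides.
  by_cases hr : ∃ s : K, κ s = t
  · obtain ⟨s, rfl⟩ := hr
    have hk' : s * (O.l2 - s) = O.k := by
      apply (algebraMap K (AlgebraicClosure K)).injective
      rw [map_mul, map_sub, ht]
    -- Since `k = s (l₂ - s)` with `l₂` constant, `k' ≠ 0` forces the root to be both nonconstant
    -- and simple.
    have hδ : O.δ O.k = (O.l2 - s - s) * O.δ s := by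
      rw [← hk', Derivation.leibniz, map_sub, hl2, smul_eq_mul, smul_eq_mul]
      ring
    have hun := unresolved_infinity_root hρ hm (add_sub_cancel s _) hk'
      (fun h0 => hk (by rw [hδ, h0, mul_zero]))
      (fun h0 => hk (by rw [hδ, sub_eq_zero.2 h0.symm, zero_mul]))
    rw [hm0] at hbase hun
    exact unresolved_of_next O.preservesConstants hch hbase hun
  · rw [hm0] at hbase
    exact unresolved_of_irrational O.preservesConstants hch (fun s hs => hr ⟨s, hs⟩) hbase

/-- The cascades over the origin of the chart `(1/w, y/w)` are regularised if and only if `k` is a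
constant, provided that constants have roots. -/
theorem IsOrbit.cascades_snd_iff (hO : O.IsOrbit q h) {y ω α : RatFun K}
    (hy : y * (O.Y - ι q) = O.Z - ι h) (hω : ω * (O.Y - ι q) = 1) (hα : y * ω = α)
    (hl2 : O.δ O.l2 = 0)
    (hroots : O.δ O.k = 0 → ∃ m₁ m₂, m₁ + m₂ = O.l2 ∧ m₁ * m₂ = O.k ∧ O.δ m₁ = 0 ∧ O.δ m₂ = 0) :
    CascadesRegularised O.D ω α 0 0 ↔ O.δ O.k = 0 := by
  obtain ⟨h1, h2⟩ := hO.cascades_snd hy hω hα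
  obtain ⟨hp, g, c, hc, hg, hωg⟩ := place_infinity (h := h) hω
  constructor
  · intro hcas
    by_contra hk
    refine h2 ?_ hcas
    rw [hp, hωg]
    exact (unresolved_infinity hl2 hk).unit_mul rfl hg hc
  · intro hk
    obtain ⟨m₁, m₂, hsum, hprod, hm1, hm2⟩ := hroots hk
    refine h1 ?_
    rw [hp, hωg]
    exact (resolved_infinity hsum hprod hm1 hm2).unit_mul rfl hg hc

end OkamotoPair

end Infinity

/-! ### Constants of the field of meromorphic functions. -/

section MeromorphicFunctions

namespace Mero

variable {Ω : PlaneDomain}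

@[simp]
theorem ddx_coord : ddx Ω (coord Ω) = 1 := by
  rw [coord, ddx_mk]
  exact (mk_eq_mk (hg := MeromorphicOn.const 1)).2 (Eventually.of_forall deriv_id)

theorem coord_ne_algebraMap (c : ℂ) : coord Ω ≠ algebraMap ℂ (Mero Ω) c := by
  intro h
  have h1 := congrArg (ddx Ω) h
  rw [ddx_coord, Derivation.map_algebraMap] at h1
  exact one_ne_zero h1

theorem coord_ne_zero : coord Ω ≠ 0 := by
  simpa using coord_ne_algebraMap (Ω := Ω) 0

theorem coord_sub_one_ne_zero : coord Ω - 1 ≠ 0 := by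
  rw [sub_ne_zero]
  simpa using coord_ne_algebraMap (Ω := Ω) 1

/-- A meromorphic function on a domain whose derivative vanishes is a constant. -/
theorem exists_eq_algebraMap_of_ddx_eq_zero {a : Mero Ω} (ha : ddx Ω a = 0) :
    ∃ c : ℂ, a = algebraMap ℂ (Mero Ω) c := by
  obtain ⟨f, hf, rfl⟩ := exists_rep a
  rw [ddx_mk, mk_eq_zero] at ha
  have := neBot Ω
  obtain ⟨z, hz, hzΩ⟩ := ((MeromorphicOn.eventually_codiscreteWithin_analyticAt f hf).and
    (self_mem_codiscreteWithin Ω.carrier)).exists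
  refine ⟨f z, ?_⟩
  have hΩ : ∀ᶠ w in nhds z, w ∈ Ω.carrier := Ω.isOpen.mem_nhds hzΩ
  have hderiv : ∀ᶠ w in nhds z, deriv f w = 0 := by
    have h1 : ∀ᶠ w in nhdsWithin z {z}ᶜ, deriv f w = 0 := by
      have h2 := mem_codiscreteWithin_iff_forall_mem_nhdsNE.1 ha z hzΩ
      filter_upwards [h2, nhdsWithin_le_nhds hΩ] with w hw hwΩ
      exact hw.resolve_right fun h3 => h3 hwΩ
    -- Zeros of the analytic derivative accumulate at `z`, so it vanishes near `z`; the
    -- connectedness of `Ω`, through `eventually_ne_zero`, then spreads constancy from there to all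
    -- of `Ω`.
    rcases hz.deriv.eventually_eq_zero_or_eventually_ne_zero with h2 | h2
    · exact h2
    · obtain ⟨w, hw1, hw2⟩ := (h1.and h2).exists
      exact absurd hw1 hw2
  have hconst : ∀ᶠ w in nhds z, f w = f z := by
    obtain ⟨r, hr, hball⟩ := Metric.eventually_nhds_iff_ball.1
      (hderiv.and hz.eventually_analyticAt)
    filter_upwards [Metric.ball_mem_nhds z hr] with w hw
    exact Metric.isOpen_ball.is_const_of_deriv_eq_zero (convex_ball z r).isPreconnected
      (fun y hy => (hball y hy).2.differentiableAt.differentiableWithinAt)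
      (fun y hy => (hball y hy).1) hw (Metric.mem_ball_self hr)
  rw [← sub_eq_zero]
  by_contra hne
  have h1 : mk f hf - algebraMap ℂ (Mero Ω) (f z) =
      mk (f - fun _ => f z) (hf.sub (MeromorphicOn.const (f z))) := rfl
  rw [h1] at hne
  have h2 := mem_codiscreteWithin_iff_forall_mem_nhdsNE.1 (eventually_ne_zero hne) z hzΩ
  obtain ⟨w, hw1, hw2, hw3⟩ := ((Filter.Eventually.and h2 (nhdsWithin_le_nhds
    (hΩ.and hconst)) : ∀ᶠ w in nhdsWithin z {z}ᶜ, _)).exists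
  rcases hw1 with hw1 | hw1
  · exact hw1 (sub_eq_zero.2 hw3)
  · exact hw1 hw2

end Mero

end MeromorphicFunctions

/-! ### Explicit right-hand sides of the Okamoto system. -/

section Okamoto

variable {Ω : PlaneDomain} {A : Type*} [CommRing A] [Algebra (Mero Ω) A]

/-- The coefficients of the terms of the Okamoto Hamiltonian linear in `z₆`. -/
def linearCoeff (Ω : PlaneDomain) (c : PVIParams) : Fin 3 → Mero Ω :=
  ![algebraMap ℂ _ c.κ0 * Mero.coord Ω,
    -(algebraMap ℂ _ c.κ0 * (1 + Mero.coord Ω)) - algebraMap ℂ _ c.κ1 * Mero.coord Ω -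
      (algebraMap ℂ _ c.κt - 1),
    algebraMap ℂ _ (c.κ0 + c.κ1 + c.κt - 1)]

local notation "x" => Mero.coord Ω
local notation "ℓ" => linearCoeff Ω

theorem aeval_okamotoF (c : PVIParams) (Y Z : A) : aeval ![Y, Z] (okamotoF Ω c) =
    algebraMap _ A (1 / (x * (x - 1))) * (2 * (Y * (Y - 1) * (Y - algebraMap _ A x)) * Z -
      (algebraMap _ A (ℓ c 2) * Y ^ 2 + algebraMap _ A (ℓ c 1) * Y +
        algebraMap _ A (ℓ c 0))) := by
  simp only [okamotoF, okamotoHamiltonian, linearCoeff, Derivation.leibniz, map_add, map_sub,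
    map_mul, map_neg, map_one, Derivation.leibniz_pow, pderiv_C, pderiv_X_self,
    pderiv_X_of_ne (show (0 : Fin 2) ≠ 1 by decide), Derivation.map_one_eq_zero, smul_eq_mul,
    algHom_C, aeval_X, Matrix.cons_val_zero, Matrix.cons_val_one, Matrix.cons_val_two, Matrix.tail_cons, Matrix.head_cons,
    map_pow, map_zero, map_natCast, nsmul_eq_mul]
  push_cast
  ring

theorem aeval_okamotoG (c : PVIParams) (Y Z : A) : aeval ![Y, Z] (okamotoG Ω c) =
    -(algebraMap _ A (1 / (x * (x - 1))) * ((3 * Y ^ 2 - 2 * (1 + algebraMap _ A x) * Y +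
      algebraMap _ A x) * Z ^ 2 - (2 * algebraMap _ A (ℓ c 2) * Y +
        algebraMap _ A (ℓ c 1)) * Z + algebraMap _ A (algebraMap ℂ (Mero Ω) c.κ))) := by
  simp only [okamotoG, okamotoHamiltonian, linearCoeff, Derivation.leibniz, map_add, map_sub,
    map_mul, map_neg, map_one, Derivation.leibniz_pow, pderiv_C, pderiv_X_self,
    pderiv_X_of_ne (show (1 : Fin 2) ≠ 0 by decide), Derivation.map_one_eq_zero, smul_eq_mul,
    algHom_C, aeval_X, Matrix.cons_val_zero, Matrix.cons_val_one, Matrix.cons_val_two, Matrix.tail_cons, Matrix.head_cons,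
    map_pow, map_zero, map_natCast, nsmul_eq_mul]
  push_cast
  ring

end Okamoto

/-! ### The system in `(y, z)` as an Okamoto system with a moving parameter. -/

section NewSystem

variable {Ω : PlaneDomain}

local notation "ξ" => Mero.coord Ω
local notation "ℓ" => linearCoeff Ω
local notation "ι" => algebraMap (Mero Ω) (RatFun (Mero Ω))

theorem IsAdmissible.ne_zero {q : Mero Ω} (hq : IsAdmissible q) : q * (q - 1) * (q - ξ) ≠ 0 :=
  mul_ne_zero (mul_ne_zero hq.1 (sub_ne_zero.2 hq.2.1)) (sub_ne_zero.2 hq.2.2)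

theorem Mero.two_ne_zero : (2 : Mero Ω) ≠ 0 := by
  have : CharZero (Mero Ω) := charZero_of_injective_algebraMap (algebraMap ℂ _).injective
  exact _root_.two_ne_zero

theorem Mero.coord_mul_ne_zero : ξ * (ξ - 1) ≠ 0 :=
  mul_ne_zero Mero.coord_ne_zero Mero.coord_sub_one_ne_zero

theorem orbitH_mul (c : PVIParams) {q : Mero Ω} (hq : IsAdmissible q) :
    2 * (q * (q - 1) * (q - ξ)) * orbitH c q =
      ξ * (ξ - 1) * Mero.ddx Ω q + (ℓ c 2 * q ^ 2 + ℓ c 1 * q + ℓ c 0) := by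
  have h1 : 2 * q * (q - 1) * (q - ξ) = 2 * (q * (q - 1) * (q - ξ)) := by ring
  rw [orbitH, h1, mul_div_cancel₀ _ (mul_ne_zero Mero.two_ne_zero hq.ne_zero)]
  simp only [linearCoeff, map_add, map_sub, map_one, Matrix.cons_val_zero, Matrix.cons_val_one,
    Matrix.cons_val_two, Matrix.tail_cons, Matrix.head_cons]
  ring

theorem atOrbit_okamotoF (c : PVIParams) {q : Mero Ω} (hq : IsAdmissible q) :
    atOrbit c q (okamotoF Ω c) = Mero.ddx Ω q := by
  rw [atOrbit, aeval_okamotoF]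
  simp only [Algebra.algebraMap_self, RingHom.id_apply]
  rw [orbitH_mul c hq, add_sub_cancel_right, ← mul_assoc, one_div,
    inv_mul_cancel₀ Mero.coord_mul_ne_zero, one_mul]

theorem atOrbit_okamotoG (c : PVIParams) (q : Mero Ω) :
    atOrbit c q (okamotoG Ω c) = -(1 / (ξ * (ξ - 1)) *
      ((3 * q ^ 2 - 2 * (1 + ξ) * q + ξ) * orbitH c q ^ 2 -
        (2 * ℓ c 2 * q + ℓ c 1) * orbitH c q + algebraMap ℂ (Mero Ω) c.κ)) := by
  rw [atOrbit, aeval_okamotoG]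
  simp only [Algebra.algebraMap_self, RingHom.id_apply]

theorem isChart_sub (c : PVIParams) (q : Mero Ω) : IsChart (subY q) (subZ c q) := by
  set F := IntermediateField.adjoin (Mero Ω) {subY q, subZ c q}
  have h1 : subY q ∈ F := IntermediateField.subset_adjoin _ _ (Or.inl rfl)
  have h2 : subZ c q ∈ F := IntermediateField.subset_adjoin _ _ (Or.inr rfl)
  have h3 : RatFun.z (Mero Ω) ∈ F := by
    simpa [subY] using sub_mem h1 (F.algebraMap_mem q)
  refine (IsChart.coordinates (Mero Ω)).of_mem ?_ h3
  have h4 : RatFun.y (Mero Ω) = (subZ c q - ι (orbitH c q)) / RatFun.z (Mero Ω) := by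
    rw [subZ, add_sub_cancel_right,
      mul_div_cancel_right₀ _ (IsChart.coordinates (Mero Ω)).ne_zero_snd]
  rw [h4]
  exact div_mem (sub_mem h2 (F.algebraMap_mem _)) h3

/-- The parameter of the Okamoto system for which the system in `(y, z)` is its transform. -/
def movingParameter (c : PVIParams) (q : Mero Ω) : Mero Ω :=
  algebraMap ℂ _ c.κ -
    (Mero.ddx Ω (orbitH c q) - atOrbit c q (okamotoG Ω c)) * (ξ * (ξ - 1))

theorem totalDeriv_subY (c : PVIParams) (q : Mero Ω) :
    RatFun.totalDeriv (Mero.ddx Ω) (newSystem c q).1 (newSystem c q).2 (subY q) =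
      aeval ![subY q, subZ c q] (okamotoF Ω c) := by
  conv_lhs => rw [subY, map_add, RatFun.totalDeriv_z, RatFun.totalDeriv_algebraMap]
  exact sub_add_cancel _ _

/-- The total derivative produces the true `h'`, while the system was written with `G(q, h)` in its
place. Their difference is the only deviation from the second Okamoto equation, and it lies in the
coefficient field. -/
theorem totalDeriv_subZ (c : PVIParams) (q : Mero Ω) :
    RatFun.totalDeriv (Mero.ddx Ω) (newSystem c q).1 (newSystem c q).2 (subZ c q) =
      aeval ![subY q, subZ c q] (okamotoG Ω c) +
        ι (Mero.ddx Ω (orbitH c q) - atOrbit c q (okamotoG Ω c)) := by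
  have hz := (IsChart.coordinates (Mero Ω)).ne_zero_snd
  have h1 : newY' c q * RatFun.z (Mero Ω) = aeval ![subY q, subZ c q] (okamotoG Ω c) -
      ι (atOrbit c q (okamotoG Ω c)) - RatFun.y (Mero Ω) * newZ' c q :=
    div_mul_cancel₀ _ hz
  conv_lhs => rw [subZ, map_add, Derivation.leibniz, RatFun.totalDeriv_z, RatFun.totalDeriv_y,
    RatFun.totalDeriv_algebraMap]
  simp only [newSystem, smul_eq_mul, map_sub]
  linear_combination h1

/-- The system in `(y, z)` as a transform of the Okamoto system with a moving parameter. -/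
def okamotoPair (c : PVIParams) (q : Mero Ω) : OkamotoPair (Mero Ω) where
  δ := Mero.ddx Ω
  D := RatFun.totalDeriv (Mero.ddx Ω) (newSystem c q).1 (newSystem c q).2
  D_const := RatFun.totalDeriv_algebraMap _ _ _
  x := ξ
  s := 1 / (ξ * (ξ - 1))
  k := movingParameter c q
  l0 := ℓ c 0
  l1 := ℓ c 1
  l2 := ℓ c 2
  Y := subY q
  Z := subZ c q
  chart := isChart_sub c q
  s_ne_zero := one_div_ne_zero Mero.coord_mul_ne_zero
  D_Y := by rw [totalDeriv_subY, aeval_okamotoF]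
  D_Z := by
    have h1 : ι (1 / (ξ * (ξ - 1))) * (ι ξ * (ι ξ - 1)) = 1 := by
      rw [← map_one ι, ← map_sub, ← map_mul, ← map_mul, one_div,
        inv_mul_cancel₀ Mero.coord_mul_ne_zero]
    rw [totalDeriv_subZ, aeval_okamotoG, movingParameter]
    simp only [map_sub, map_mul, map_one]
    linear_combination -(ι (Mero.ddx Ω (orbitH c q)) - ι (atOrbit c q (okamotoG Ω c))) * h1

/-- The first equation holds by the definition of `h`, and the second because the moving parameter
is defined by solving it for `k`. No differential equation for `q` is used. -/
theorem okamotoPair_isOrbit (c : PVIParams) {q : Mero Ω} (hq : IsAdmissible q) :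
    (okamotoPair c q).IsOrbit q (orbitH c q) where
  deriv_fst := by
    change Mero.ddx Ω q = 1 / (ξ * (ξ - 1)) * (2 * (q * (q - 1) * (q - ξ)) * orbitH c q - _)
    rw [orbitH_mul c hq]
    change Mero.ddx Ω q = 1 / (ξ * (ξ - 1)) * (_ - (ℓ c 2 * q ^ 2 + ℓ c 1 * q + ℓ c 0))
    rw [add_sub_cancel_right, ← mul_assoc, one_div, inv_mul_cancel₀ Mero.coord_mul_ne_zero,
      one_mul]
  deriv_snd := by
    change Mero.ddx Ω (orbitH c q) = -(1 / (ξ * (ξ - 1)) *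
      ((3 * q ^ 2 - 2 * (1 + ξ) * q + ξ) * orbitH c q ^ 2 -
        (2 * ℓ c 2 * q + ℓ c 1) * orbitH c q + movingParameter c q))
    have h1 : 1 / (ξ * (ξ - 1)) * (ξ * (ξ - 1)) = 1 := by
      rw [one_div, inv_mul_cancel₀ Mero.coord_mul_ne_zero]
    rw [movingParameter]
    linear_combination
      -(Mero.ddx Ω (orbitH c q) - atOrbit c q (okamotoG Ω c)) * h1 + atOrbit_okamotoG c q
  ne_zero := hq.ne_zero

/-- The residues at `0, 1, x` are `κ₀, κ₁, κ_t`, and the derivatives of the cubic there, `x`, `1 -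
x` and `x (x - 1)`, are nonzero. -/
theorem okamotoPair_isFuchsian (c : PVIParams) (q : Mero Ω) : (okamotoPair c q).IsFuchsian := by
  intro a ha
  have hx := Mero.coord_ne_zero (Ω := Ω)
  have hx1 := Mero.coord_sub_one_ne_zero (Ω := Ω)
  change a * (a - 1) * (a - ξ) = 0 at ha
  change ∃ θ τ, Mero.ddx Ω θ = 0 ∧ τ ≠ 0 ∧ τ = 3 * a ^ 2 - 2 * (1 + ξ) * a + ξ ∧
    1 / (ξ * (ξ - 1)) * (ℓ c 2 * a ^ 2 + ℓ c 1 * a + ℓ c 0) + Mero.ddx Ω a =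
      1 / (ξ * (ξ - 1)) * θ * τ
  simp only [linearCoeff, map_add, map_sub, map_one, Matrix.cons_val_zero, Matrix.cons_val_one,
    Matrix.cons_val_two, Matrix.tail_cons, Matrix.head_cons]
  rcases mul_eq_zero.1 ha with h1 | h1
  · rcases mul_eq_zero.1 h1 with h2 | h2
    · refine ⟨algebraMap ℂ _ c.κ0, ξ, Derivation.map_algebraMap _ _, hx, ?_, ?_⟩
      · rw [h2]
        ring
      · rw [h2, map_zero]
        ring
    · obtain rfl := sub_eq_zero.1 h2
      refine ⟨algebraMap ℂ _ c.κ1, 1 - ξ, Derivation.map_algebraMap _ _, ?_, ?_, ?_⟩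
      · rw [← neg_sub]
        exact neg_ne_zero.2 hx1
      · ring
      · rw [Derivation.map_one_eq_zero]
        ring
  · obtain rfl := sub_eq_zero.1 h1
    refine ⟨algebraMap ℂ _ c.κt, ξ * (ξ - 1), Derivation.map_algebraMap _ _,
      mul_ne_zero hx hx1, ?_, ?_⟩
    · ring
    -- The singular point `x` moves with speed one, which turns the coefficient `κ_t - 1` of the
    -- Hamiltonian into the residue `κ_t`.
    · rw [Mero.ddx_coord]
      field_simp
      ring

end NewSystem

/-! ### The equation solved for `α` in terms of the moving parameter. -/

section Regularising

variable {Ω : PlaneDomain}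

local notation "ξ" => Mero.coord Ω
local notation "ℓ" => linearCoeff Ω
local notation "ι" => algebraMap (Mero Ω) (RatFun (Mero Ω))

/-- The derivative of `h(q, q'; x)`. -/
theorem ddx_orbitH_mul (c : PVIParams) {q : Mero Ω} (hq : IsAdmissible q) :
    2 * (q * (q - 1) * (q - ξ)) * Mero.ddx Ω (orbitH c q) =
      (2 * ξ - 1) * Mero.ddx Ω q + ξ * (ξ - 1) * Mero.ddx Ω (Mero.ddx Ω q) +
      (2 * ℓ c 2 * q + ℓ c 1) * Mero.ddx Ω q -
      (algebraMap ℂ _ c.κ0 + algebraMap ℂ _ c.κ1) * q + algebraMap ℂ _ c.κ0 -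
      2 * ((3 * q ^ 2 - 2 * (1 + ξ) * q + ξ) * Mero.ddx Ω q - q * (q - 1)) * orbitH c q := by
  have h1 := congrArg (Mero.ddx Ω) (orbitH_mul c hq)
  have h2 : Mero.ddx Ω (2 : Mero Ω) = 0 := by
    have := Derivation.map_natCast (Mero.ddx Ω) 2
    simpa using this
  simp only [linearCoeff, Matrix.cons_val_zero, Matrix.cons_val_one,
    Matrix.cons_val_two, Matrix.tail_cons, Matrix.head_cons, map_add, map_sub, map_neg, map_one,
    Derivation.leibniz, Derivation.leibniz_pow, Derivation.map_algebraMap, h2,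
    Derivation.map_one_eq_zero, Mero.ddx_coord, smul_eq_mul, nsmul_eq_mul] at h1 ⊢
  push_cast at h1
  linear_combination h1

/-- The sixth Painlevé equation solved for `α` is an affine function of the moving parameter. -/
theorem solvedForAlpha_eq (c : PVIParams) {q : Mero Ω} (hq : IsAdmissible q) :
    solvedForAlpha c q = algebraMap ℂ _ ((c.κ0 + c.κ1 + c.κt - 1) ^ 2 / 2) -
      2 * movingParameter c q := by
  have hx := Mero.coord_ne_zero (Ω := Ω)
  have hx1 := Mero.coord_sub_one_ne_zero (Ω := Ω)
  have hq0 := hq.1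
  have hq1 := sub_ne_zero.2 hq.2.1
  have hqx := sub_ne_zero.2 hq.2.2
  have h2 := Mero.two_ne_zero (Ω := Ω)
  have hh : orbitH c q = (ξ * (ξ - 1) * Mero.ddx Ω q + (ℓ c 2 * q ^ 2 + ℓ c 1 * q + ℓ c 0)) /
      (2 * (q * (q - 1) * (q - ξ))) := by
    rw [eq_div_iff (mul_ne_zero h2 hq.ne_zero), ← orbitH_mul c hq]
    ring
  have hh' := ddx_orbitH_mul c hq
  rw [mul_comm, ← eq_div_iff (mul_ne_zero h2 hq.ne_zero)] at hh'
  rw [movingParameter, atOrbit_okamotoG, hh', hh]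
  simp only [solvedForAlpha, linearCoeff, PVIParams.β, PVIParams.γ, PVIParams.δ, map_add, map_sub,
    map_neg, map_div₀, map_pow, map_one, map_ofNat, Matrix.cons_val_zero, Matrix.cons_val_one,
    Matrix.cons_val_two, Matrix.tail_cons, Matrix.head_cons]
  -- With `h` and `h'` eliminated, what remains is an identity of rational functions in which `x`,
  -- `q`, `q'`, `q''` and the parameters are independent.
  generalize Mero.ddx Ω (Mero.ddx Ω q) = q''
  generalize Mero.ddx Ω q = q'
  generalize algebraMap ℂ (Mero Ω) c.κ0 = k0
  generalize algebraMap ℂ (Mero Ω) c.κ1 = k1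
  generalize algebraMap ℂ (Mero Ω) c.κt = kt
  generalize algebraMap ℂ (Mero Ω) c.κ = κ
  field_simp
  ring

end Regularising

/-! ### The regularising condition and the sixth Painlevé equation. -/

section Equation

variable {Ω : PlaneDomain}

local notation "ξ" => Mero.coord Ω
local notation "ℓ" => linearCoeff Ω
local notation "ι" => algebraMap (Mero Ω) (RatFun (Mero Ω))

theorem regularisingCondition_iff (c : PVIParams) {q : Mero Ω} (hq : IsAdmissible q) :
    RegularisingCondition c q ↔ Mero.ddx Ω (movingParameter c q) = 0 := by
  rw [RegularisingCondition, solvedForAlpha_eq c hq, map_sub, Derivation.map_algebraMap, zero_sub,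
    neg_eq_zero, two_mul, map_add, ← two_mul, mul_eq_zero, or_iff_right Mero.two_ne_zero]

/-- The factor in front of the parameters in the equation and the factor in `A(q)` are inverse to
each other, so each form is a multiple of the other. -/
theorem solvesPVI_iff (c : PVIParams) (a : ℂ) (q : Mero Ω) :
    SolvesPVI a c.β c.γ c.δ q ↔
      IsAdmissible q ∧ solvedForAlpha c q = algebraMap ℂ (Mero Ω) a := by
  refine and_congr_right fun hq => ?_
  have hT := hq.ne_zero
  have hX : ξ ^ 2 * (ξ - 1) ^ 2 ≠ 0 :=
    mul_ne_zero (pow_ne_zero 2 Mero.coord_ne_zero) (pow_ne_zero 2 Mero.coord_sub_one_ne_zero)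
  have hUV : ξ ^ 2 * (ξ - 1) ^ 2 / (q * (q - 1) * (q - ξ)) *
      (q * (q - 1) * (q - ξ) / (ξ ^ 2 * (ξ - 1) ^ 2)) = 1 := by
    rw [div_mul_div_cancel₀ hT, div_self hX]
  rw [solvedForAlpha]
  generalize ξ ^ 2 * (ξ - 1) ^ 2 / (q * (q - 1) * (q - ξ)) = U at hUV ⊢
  generalize q * (q - 1) * (q - ξ) / (ξ ^ 2 * (ξ - 1) ^ 2) = V at hUV ⊢
  constructor <;> intro h1
  · linear_combination U * h1 + (algebraMap ℂ _ a + algebraMap ℂ _ c.β * ξ / q ^ 2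
      + algebraMap ℂ _ c.γ * (ξ - 1) / (q - 1) ^ 2
      + algebraMap ℂ _ c.δ * ξ * (ξ - 1) / (q - ξ) ^ 2) * hUV
  · linear_combination V * h1 - (Mero.ddx Ω (Mero.ddx Ω q)
      - 1 / 2 * (1 / q + 1 / (q - 1) + 1 / (q - ξ)) * Mero.ddx Ω q ^ 2
      + (1 / ξ + 1 / (ξ - 1) + 1 / (q - ξ)) * Mero.ddx Ω q) * hUV

/-- A function `k` with zero derivative is a complex number, so the quadratic has complex
coefficients and splits over the complex numbers. -/
theorem exists_roots (c : PVIParams) {q : Mero Ω} (hk : Mero.ddx Ω (movingParameter c q) = 0) :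
    ∃ m₁ m₂ : Mero Ω, m₁ + m₂ = ℓ c 2 ∧ m₁ * m₂ = movingParameter c q ∧
      Mero.ddx Ω m₁ = 0 ∧ Mero.ddx Ω m₂ = 0 := by
  obtain ⟨k, hk⟩ := Mero.exists_eq_algebraMap_of_ddx_eq_zero hk
  obtain ⟨d, hd⟩ := IsAlgClosed.exists_pow_nat_eq ((c.κ0 + c.κ1 + c.κt - 1) ^ 2 - 4 * k)
    (n := 2) two_pos
  refine ⟨algebraMap ℂ _ ((c.κ0 + c.κ1 + c.κt - 1 + d) / 2),
    algebraMap ℂ _ ((c.κ0 + c.κ1 + c.κt - 1 - d) / 2), ?_, ?_, Derivation.map_algebraMap _ _,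
    Derivation.map_algebraMap _ _⟩
  · change _ = algebraMap ℂ _ (c.κ0 + c.κ1 + c.κt - 1)
    rw [← map_add]
    congr 1
    ring
  · rw [hk, ← map_mul]
    congr 1
    linear_combination -hd / 4

section Charts

variable (c : PVIParams) (q : Mero Ω)

theorem okamotoPair_w : (okamotoPair c q).Y - ι q = RatFun.z (Mero Ω) :=
  add_sub_cancel_right _ _

theorem okamotoPair_ζ :
    (okamotoPair c q).Z - ι (orbitH c q) = RatFun.y (Mero Ω) * RatFun.z (Mero Ω) :=
  add_sub_cancel_right _ _

theorem okamotoPair_quotient : RatFun.y (Mero Ω) * ((okamotoPair c q).Y - ι q) =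
    (okamotoPair c q).Z - ι (orbitH c q) := by
  rw [okamotoPair_w, okamotoPair_ζ]

theorem one_div_y_mul : 1 / RatFun.y (Mero Ω) * RatFun.y (Mero Ω) = 1 :=
  one_div_mul_cancel (IsChart.coordinates (Mero Ω)).ne_zero_fst

theorem z_div_y : RatFun.z (Mero Ω) / RatFun.y (Mero Ω) =
    1 / RatFun.y (Mero Ω) * ((okamotoPair c q).Y - ι q) := by
  rw [okamotoPair_w]
  ring

theorem one_div_z_mul : 1 / RatFun.z (Mero Ω) * ((okamotoPair c q).Y - ι q) = 1 := by
  rw [okamotoPair_w, one_div_mul_cancel (IsChart.coordinates (Mero Ω)).ne_zero_snd]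

theorem y_mul_one_div_z : RatFun.y (Mero Ω) * (1 / RatFun.z (Mero Ω)) =
    RatFun.y (Mero Ω) / RatFun.z (Mero Ω) := by
  ring

end Charts

theorem isChart_vertical (c : PVIParams) {q : Mero Ω} (hq : IsAdmissible q) :
    IsChart (1 / RatFun.z (Mero Ω)) (RatFun.y (Mero Ω) / RatFun.z (Mero Ω)) :=
  ((okamotoPair_isOrbit c hq).deriv_chart_snd (okamotoPair_quotient c q) (one_div_z_mul c q)
    y_mul_one_div_z).1

theorem not_isBasePoint_affine (c : PVIParams) {q : Mero Ω} (hq : IsAdmissible q) (p) :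
    ¬ IsBasePoint (okamotoPair c q).D (RatFun.y (Mero Ω)) (RatFun.z (Mero Ω)) p := by
  refine RegularPlace.not_isBasePoint (IsChart.coordinates _) ?_
  have h1 := (okamotoPair_isOrbit c hq).regularPlace_affine (okamotoPair_quotient c q) p
  rwa [okamotoPair_w] at h1

theorem isBasePoint_horizontal_iff (c : PVIParams) {q : Mero Ω} (hq : IsAdmissible q) (p) :
    IsBasePoint (okamotoPair c q).D (1 / RatFun.y (Mero Ω))
      (RatFun.z (Mero Ω) / RatFun.y (Mero Ω)) p ↔ p = (0, 0) :=
  (okamotoPair_isOrbit c hq).isBasePoint_fst_iff (okamotoPair_quotient c q) one_div_y_mul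
    (z_div_y c q) p

theorem isBasePoint_vertical_iff (c : PVIParams) {q : Mero Ω} (hq : IsAdmissible q) (p) :
    IsBasePoint (okamotoPair c q).D (RatFun.y (Mero Ω) / RatFun.z (Mero Ω))
      (1 / RatFun.z (Mero Ω)) p ↔ p = (0, 0) := by
  obtain ⟨a, b⟩ := p
  rw [← IsBasePoint.swap (isChart_vertical c hq),
    (okamotoPair_isOrbit c hq).isBasePoint_snd_iff (okamotoPair_quotient c q) (one_div_z_mul c q)
      y_mul_one_div_z, Prod.mk.injEq, Prod.mk.injEq, and_comm]

/-- The regularising condition characterises the systems which are regularised. -/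
theorem isRegularised_iff (c : PVIParams) {q : Mero Ω} (hq : IsAdmissible q) :
    IsRegularised (Mero.ddx Ω) (newSystem c q) ↔ RegularisingCondition c q := by
  have hO := okamotoPair_isOrbit c hq
  have hy := okamotoPair_quotient c q
  have hch := isChart_vertical c hq
  have hiff : CascadesRegularised (okamotoPair c q).D (1 / RatFun.z (Mero Ω))
      (RatFun.y (Mero Ω) / RatFun.z (Mero Ω)) 0 0 ↔ Mero.ddx Ω (movingParameter c q) = 0 :=
    hO.cascades_snd_iff hy (one_div_z_mul c q) y_mul_one_div_z (Derivation.map_algebraMap _ _)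
      (exists_roots c)
  rw [regularisingCondition_iff c hq, ← hiff]
  constructor
  -- Only the chart `(y/z, 1/z)` carries information: the affine chart has no base points, and the
  -- cascades in the remaining one always end regularly.
  · rintro ⟨-, -, h3⟩
    obtain ⟨a, b, hab, hc⟩ := h3 (0, 0) ((isBasePoint_vertical_iff c hq _).2 rfl)
    obtain ⟨ha, hb⟩ := Prod.mk.inj hab
    obtain rfl : a = 0 := by simpa using ha.symm
    obtain rfl : b = 0 := by simpa using hb.symm
    exact hc.swap hch.symm
  · intro h3
    refine ⟨fun p hp => absurd hp (not_isBasePoint_affine c hq p), fun p hp => ⟨0, 0, ?_, ?_⟩,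
      fun p hp => ⟨0, 0, ?_, h3.swap hch⟩⟩
    · rw [(isBasePoint_horizontal_iff c hq p).1 hp, map_zero]
    · exact hO.cascades_fst (okamotoPair_isFuchsian c q) hy one_div_y_mul (z_div_y c q)
    · rw [(isBasePoint_vertical_iff c hq p).1 hp, map_zero]


end Equation

/-! ### Fields of definition of the coefficients. -/

section Coefficients

variable {k K : Type} [Field k] [Field K] [Algebra k K]

/-- The polynomials in the dependent variables whose coefficients lie in a given field. -/
def polynomialsOver (F : IntermediateField k K) : Subring (RatFun K) :=
  ((algebraMap (MvPolynomial (Fin 2) K) (RatFun K)).comp (MvPolynomial.map (algebraMap F K))).range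

theorem exists_of_mem_polynomialsOver {F : IntermediateField k K} {f : RatFun K}
    (hf : f ∈ polynomialsOver F) :
    ∃ A : MvPolynomial (Fin 2) K, f = algebraMap _ _ A ∧ ∀ m, A.coeff m ∈ F := by
  obtain ⟨A, rfl⟩ := hf
  refine ⟨MvPolynomial.map (algebraMap F K) A, rfl, fun m => ?_⟩
  rw [coeff_map]
  exact (A.coeff m).2

theorem const_mem_polynomialsOver {F : IntermediateField k K} {a : K} (ha : a ∈ F) :
    algebraMap K (RatFun K) a ∈ polynomialsOver F := by
  refine ⟨C ⟨a, ha⟩, ?_⟩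
  rw [RingHom.comp_apply, map_C]
  rfl

theorem y_mem_polynomialsOver (F : IntermediateField k K) : RatFun.y K ∈ polynomialsOver F :=
  ⟨X 0, by rw [RingHom.comp_apply, map_X, RatFun.y]⟩

theorem z_mem_polynomialsOver (F : IntermediateField k K) : RatFun.z K ∈ polynomialsOver F :=
  ⟨X 1, by rw [RingHom.comp_apply, map_X, RatFun.z]⟩

end Coefficients

section NewSystemCoefficients

variable {Ω : PlaneDomain}

local notation "ξ" => Mero.coord Ω
local notation "ℓ" => linearCoeff Ω
local notation "ι" => algebraMap (Mero Ω) (RatFun (Mero Ω))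

/-- In the expansion at the orbit the constant terms cancel, and the moving parameter, the only
place where `q''` could enter, cancels with them. What remains involves `x`, `q` and `h`, hence
`q'`, polynomially in `y, z`. -/
theorem newSystem_mem_polynomialsOver (c : PVIParams) {q : Mero Ω} (hq : IsAdmissible q)
    {F : IntermediateField ℂ (Mero Ω)} (hξ : ξ ∈ F) (hqF : q ∈ F) (hq' : Mero.ddx Ω q ∈ F) :
    (newSystem c q).1 ∈ polynomialsOver F ∧ (newSystem c q).2 ∈ polynomialsOver F := by
  have hO := okamotoPair_isOrbit c hq
  have hDw := hO.deriv_w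
  have hDy := OkamotoPair.deriv_quotient ((okamotoPair c q).chart_shift q (orbitH c q)).ne_zero_fst
    (okamotoPair_quotient c q) hDw hO.deriv_ζ
  have hC : ∀ a : ℂ, algebraMap ℂ (Mero Ω) a ∈ F := F.algebraMap_mem
  have h2 : (2 : Mero Ω) ∈ F := ofNat_mem F 2
  have h3 : (3 : Mero Ω) ∈ F := ofNat_mem F 3
  have hF1 : (1 : Mero Ω) ∈ F := one_mem F
  have hh : orbitH c q ∈ F := by
    simp only [orbitH]
    repeat (with_reducible first
      | assumption | exact hC _ | apply div_mem | apply add_mem | apply sub_mem | apply mul_mem)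
  have hl0 : ℓ c 0 ∈ F := mul_mem (hC _) hξ
  have hl1 : ℓ c 1 ∈ F := sub_mem (sub_mem (neg_mem (mul_mem (hC _) (add_mem hF1 hξ)))
    (mul_mem (hC _) hξ)) (sub_mem (hC _) hF1)
  have hl2 : ℓ c 2 ∈ F := hC _
  have hs : 1 / (ξ * (ξ - 1)) ∈ F := div_mem hF1 (mul_mem hξ (sub_mem hξ hF1))
  have hι : ∀ a ∈ F, ι a ∈ polynomialsOver F := fun a ha => const_mem_polynomialsOver ha
  have hT : q * (q - 1) * (q - ξ) ∈ F :=
    mul_mem (mul_mem hqF (sub_mem hqF hF1)) (sub_mem hqF hξ)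
  have hT1 : 3 * q ^ 2 - 2 * (1 + ξ) * q + ξ ∈ F := add_mem (sub_mem (mul_mem h3 (pow_mem hqF 2))
    (mul_mem (mul_mem h2 (add_mem hF1 hξ)) hqF)) hξ
  have hP2 : (2 : RatFun (Mero Ω)) ∈ polynomialsOver F := ofNat_mem _ 2
  have hP3 : (3 : RatFun (Mero Ω)) ∈ polynomialsOver F := ofNat_mem _ 3
  have hP1 : (1 : RatFun (Mero Ω)) ∈ polynomialsOver F := one_mem _
  have hy := y_mem_polynomialsOver F
  have hz := z_mem_polynomialsOver F
  rw [okamotoPair_w, okamotoPair_ζ] at hDw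
  rw [okamotoPair_w] at hDy
  have hιξ := hι _ hξ
  have hιq := hι _ hqF
  have hιh := hι _ hh
  have hιs := hι _ hs
  have hιT := hι _ hT
  have hιT1 := hι _ hT1
  have hιl1 := hι _ hl1
  have hιl2 := hι _ hl2
  constructor
  · have h4 : (okamotoPair c q).D (RatFun.y (Mero Ω)) = (newSystem c q).1 :=
      RatFun.totalDeriv_y _ _ _
    rw [← h4, hDy]
    simp only [okamotoPair]
    repeat (with_reducible first
      | assumption | apply neg_mem | apply add_mem | apply sub_mem | apply mul_mem
      | apply pow_mem)
  · have h4 : (okamotoPair c q).D (RatFun.z (Mero Ω)) = (newSystem c q).2 :=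
      RatFun.totalDeriv_z _ _ _
    rw [← h4, hDw]
    simp only [okamotoPair]
    repeat (with_reducible first
      | assumption | apply neg_mem | apply add_mem | apply sub_mem | apply mul_mem
      | apply pow_mem)

end NewSystemCoefficients

/-! ### The change of variables as an automorphism of the field of rational functions. -/

section Birational

variable {K : Type} [Field K]

/-- Algebraic independence of `u, v` extends the substitution to fractions, and their generating the
field makes it surjective. -/
theorem IsChart.exists_algEquiv {u v : RatFun K} (h : IsChart u v) :
    ∃ φ : RatFun K ≃ₐ[K] RatFun K,
      ∀ A : MvPolynomial (Fin 2) K, φ (algebraMap _ _ A) = aeval ![u, v] A := by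
  have hinj : Function.Injective (aeval (R := K) ![u, v]) := h.injective
  let φ : RatFun K →ₐ[K] RatFun K := IsFractionRing.liftAlgHom hinj
  have hφ : ∀ A : MvPolynomial (Fin 2) K, φ (algebraMap _ _ A) = aeval ![u, v] A :=
    fun A => IsFractionRing.lift_algebraMap hinj A
  refine ⟨AlgEquiv.ofBijective φ ⟨φ.toRingHom.injective, fun f => ?_⟩, hφ⟩
  obtain ⟨N, M, hM, hf⟩ := h.exists_fraction f
  refine ⟨algebraMap _ _ N / algebraMap _ _ M, ?_⟩
  rw [map_div₀, hφ, hφ, div_eq_iff hM, hf]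

variable {Ω : PlaneDomain}

/-- Total derivatives correspond under a substitution if they do on the dependent variables. -/
theorem intertwines_of {φ : RatFun (Mero Ω) ≃ₐ[Mero Ω] RatFun (Mero Ω)}
    {S T : RatFun (Mero Ω) × RatFun (Mero Ω)}
    (hy : φ S.1 = RatFun.totalDeriv (Mero.ddx Ω) T.1 T.2 (φ (RatFun.y _)))
    (hz : φ S.2 = RatFun.totalDeriv (Mero.ddx Ω) T.1 T.2 (φ (RatFun.z _))) :
    Intertwines φ S T := by
  intro f
  have hf : f ∈ IntermediateField.adjoin (Mero Ω) {RatFun.y (Mero Ω), RatFun.z (Mero Ω)} := by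
    rw [show IntermediateField.adjoin (Mero Ω) {RatFun.y (Mero Ω), RatFun.z (Mero Ω)} = ⊤ from
      IsChart.coordinates (Mero Ω)]
    trivial
  induction hf using IntermediateField.adjoin_induction with
  | mem f hf =>
    rcases hf with rfl | rfl
    · rw [RatFun.totalDeriv_y, hy]
    · rw [RatFun.totalDeriv_z, hz]
  | algebraMap a =>
    rw [RatFun.totalDeriv_algebraMap, AlgEquiv.commutes, AlgEquiv.commutes,
      RatFun.totalDeriv_algebraMap]
  | add f g _ _ hf hg => simp only [map_add, hf, hg]
  | inv f _ hf =>
    simp only [map_inv₀, Derivation.leibniz_inv, smul_eq_mul, map_mul, map_neg, map_pow, hf]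
  | mul f g _ _ hf hg => simp only [map_mul, Derivation.leibniz, smul_eq_mul, map_add, hf, hg]

/-- At a point moving along the orbit, the change of variables transforms the Okamoto system into
the system in `(y, z)`. -/
theorem exists_intertwines (c : PVIParams) {q : Mero Ω}
    (hG : atOrbit c q (okamotoG Ω c) = Mero.ddx Ω (orbitH c q)) :
    ∃ φ : RatFun (Mero Ω) ≃ₐ[Mero Ω] RatFun (Mero Ω),
      φ (RatFun.y _) = subY q ∧ φ (RatFun.z _) = subZ c q ∧
      Intertwines φ (okamotoSystem Ω c) (newSystem c q) := by
  obtain ⟨φ, hφ⟩ := (isChart_sub c q).exists_algEquiv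
  have hy : φ (RatFun.y _) = subY q := by
    rw [RatFun.y, hφ, aeval_X, Matrix.cons_val_zero]
  have hz : φ (RatFun.z _) = subZ c q := by
    rw [RatFun.z, hφ, aeval_X, Matrix.cons_val_one, Matrix.cons_val_zero]
  refine ⟨φ, hy, hz, intertwines_of ?_ ?_⟩
  · rw [hy, totalDeriv_subY]
    exact hφ _
  · rw [hz, totalDeriv_subZ, hG, sub_self, map_zero, add_zero]
    exact hφ _

end Birational

/-! ### Painlevé transcendents and the Bureau–Guillot property. -/

section Transcendents

variable {Ω : PlaneDomain}

/-- The equation with the given `α` fixes the value of `A(q)`, and `α` is related to `κ` exactly as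
`A(q)` is to the moving parameter. -/
theorem movingParameter_of_solvesPVI (c : PVIParams) {q : Mero Ω}
    (hq : SolvesPVI c.α c.β c.γ c.δ q) :
    movingParameter c q = algebraMap ℂ (Mero Ω) c.κ := by
  obtain ⟨hadm, hα⟩ := (solvesPVI_iff c _ q).1 hq
  rw [solvedForAlpha_eq c hadm] at hα
  apply mul_left_cancel₀ Mero.two_ne_zero
  have h1 : algebraMap ℂ (Mero Ω) ((c.κ0 + c.κ1 + c.κt - 1) ^ 2 / 2) =
      algebraMap ℂ _ c.α + 2 * algebraMap ℂ _ c.κ := by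
    rw [← map_ofNat (algebraMap ℂ (Mero Ω)), ← map_mul, ← map_add, PVIParams.α]
    congr 1
    ring
  linear_combination h1 - hα

/-- Along a transcendent the second Okamoto equation holds at the orbit. -/
theorem atOrbit_okamotoG_of_solvesPVI (c : PVIParams) {q : Mero Ω}
    (hq : SolvesPVI c.α c.β c.γ c.δ q) :
    atOrbit c q (okamotoG Ω c) = Mero.ddx Ω (orbitH c q) := by
  have h1 := movingParameter_of_solvesPVI c hq
  rw [movingParameter, sub_eq_self, mul_eq_zero, or_iff_left Mero.coord_mul_ne_zero,
    sub_eq_zero] at h1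
  exact h1.symm

/-- The third-order condition integrates once: on a connected domain `A(q)` is a constant, which is
the value of `α`. -/
theorem isRegularised_iff_exists_solvesPVI (c : PVIParams) {q : Mero Ω} (hq : IsAdmissible q) :
    IsRegularised (Mero.ddx Ω) (newSystem c q) ↔ ∃ a : ℂ, SolvesPVI a c.β c.γ c.δ q := by
  rw [isRegularised_iff c hq]
  constructor
  · intro h
    obtain ⟨a, ha⟩ := Mero.exists_eq_algebraMap_of_ddx_eq_zero h
    exact ⟨a, (solvesPVI_iff c a q).2 ⟨hq, ha⟩⟩
  · rintro ⟨a, ha⟩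
    rw [RegularisingCondition, ((solvesPVI_iff c a q).1 ha).2, Derivation.map_algebraMap]

theorem isBureauGuillot_newSystem (c : PVIParams) {q : Mero Ω}
    (hq : SolvesPVI c.α c.β c.γ c.δ q) : IsBureauGuillot c (newSystem c) q where
  transcendent := hq
  birational := by
    obtain ⟨φ, -, -, hφ⟩ := exists_intertwines c (atOrbit_okamotoG_of_solvesPVI c hq)
    exact ⟨φ, hφ⟩
  coefficients := by
    set F := IntermediateField.adjoin ℂ
      (insert (Mero.coord Ω) (Set.range fun n : ℕ => (Mero.ddx Ω)^[n] q))
    have h1 : Mero.coord Ω ∈ F := IntermediateField.subset_adjoin _ _ (Or.inl rfl)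
    have h2 : q ∈ F := IntermediateField.subset_adjoin _ _ (Or.inr ⟨0, rfl⟩)
    have h3 : Mero.ddx Ω q ∈ F := IntermediateField.subset_adjoin _ _ (Or.inr ⟨1, rfl⟩)
    obtain ⟨hA, hB⟩ := newSystem_mem_polynomialsOver c hq.1 h1 h2 h3
    obtain ⟨A, hA, hAF⟩ := exists_of_mem_polynomialsOver hA
    obtain ⟨B, hB, hBF⟩ := exists_of_mem_polynomialsOver hB
    have hone : ∀ m, (1 : MvPolynomial (Fin 2) (Mero Ω)).coeff m ∈ F := by
      intro m
      rw [coeff_one]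
      split_ifs
      exacts [one_mem F, zero_mem F]
    refine ⟨A, 1, B, 1, one_ne_zero, one_ne_zero, ?_, ?_⟩
    · rw [map_one, div_one, div_one, ← hA, ← hB]
    · rintro _ (rfl | rfl | rfl | rfl)
      exacts [hAF, hone, hBF, hone]
  regularised := (isRegularised_iff_exists_solvesPVI c hq.1).2 ⟨_, hq⟩
  regularising p hp := isRegularised_iff_exists_solvesPVI c hp

end Transcendents

end

theorem proposition3p7 (Ω : PlaneDomain) (c : PVIParams) :
    -- an arbitrary coefficient function `q`
    (∀ q : Mero Ω, IsAdmissible q →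
      -- the first Okamoto equation holds at `(q, h)`
      atOrbit c q (okamotoF Ω c) = Mero.ddx Ω q ∧
      -- the system in `(y, z)` is polynomial, with coefficients rational in `x`, `q`, `q'`
      (∃ A B : MvPolynomial (Fin 2) (Mero Ω),
        newSystem c q = (algebraMap _ _ A, algebraMap _ _ B) ∧
        ∀ m, A.coeff m ∈ IntermediateField.adjoin ℂ {Mero.coord Ω, q, Mero.ddx Ω q} ∧
          B.coeff m ∈ IntermediateField.adjoin ℂ {Mero.coord Ω, q, Mero.ddx Ω q}) ∧
      -- its base points in the projective plane are the origins of the two charts at infinity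
      (∀ D, D = RatFun.totalDeriv (Mero.ddx Ω) (newSystem c q).1 (newSystem c q).2 →
        ∀ p,
          (¬ IsBasePoint D (RatFun.y _) (RatFun.z _) p) ∧
          (IsBasePoint D (1 / RatFun.y _) (RatFun.z _ / RatFun.y _) p ↔ p = (0, 0)) ∧
          (IsBasePoint D (RatFun.y _ / RatFun.z _) (1 / RatFun.z _) p ↔ p = (0, 0))) ∧
      -- the regularising condition at the end of the cascades of blow-ups
      (IsRegularised (Mero.ddx Ω) (newSystem c q) ↔ RegularisingCondition c q)) ∧
    -- a transcendent `q`
    (∀ q : Mero Ω, SolvesPVI c.α c.β c.γ c.δ q →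
      -- the second Okamoto equation also holds at `(q, h)`: the point moves along the orbit
      atOrbit c q (okamotoG Ω c) = Mero.ddx Ω (orbitH c q) ∧
      -- the blow-up-like change of variables is birational and yields the system in `(y, z)`
      (∃ φ : RatFun (Mero Ω) ≃ₐ[Mero Ω] RatFun (Mero Ω),
        φ (RatFun.y _) = subY q ∧ φ (RatFun.z _) = subZ c q ∧
        Intertwines φ (okamotoSystem Ω c) (newSystem c q)) ∧
      -- the regularising condition holds
      RegularisingCondition c q ∧
      -- the system is Bureau-Guillot
      IsBureauGuillot c (newSystem c) q) := by
  refine ⟨fun q hq => ⟨atOrbit_okamotoF c hq, ?_, ?_, isRegularised_iff c hq⟩, fun q hq => ?_⟩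
  · obtain ⟨hA, hB⟩ := newSystem_mem_polynomialsOver c hq
      (F := IntermediateField.adjoin ℂ {Mero.coord Ω, q, Mero.ddx Ω q})
      (IntermediateField.subset_adjoin _ _ (Or.inl rfl))
      (IntermediateField.subset_adjoin _ _ (Or.inr (Or.inl rfl)))
      (IntermediateField.subset_adjoin _ _ (Or.inr (Or.inr rfl)))
    obtain ⟨A, hA, hAF⟩ := exists_of_mem_polynomialsOver hA
    obtain ⟨B, hB, hBF⟩ := exists_of_mem_polynomialsOver hB
    exact ⟨A, B, Prod.ext hA hB, fun m => ⟨hAF m, hBF m⟩⟩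
  · rintro _ rfl p
    exact ⟨not_isBasePoint_affine c hq p, isBasePoint_horizontal_iff c hq p,
      isBasePoint_vertical_iff c hq p⟩
  · have hG := atOrbit_okamotoG_of_solvesPVI c hq
    exact ⟨hG, exists_intertwines c hG,
      (isRegularised_iff c hq.1).1 ((isRegularised_iff_exists_solvesPVI c hq.1).2 ⟨_, hq⟩),
      isBureauGuillot_newSystem c hq⟩
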